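/- **Setting.** Let $f=f(\zeta,u)$ be a complex function that is smooth near $(\zeta_0,u_0)\in\mathbb C\times\mathbb R$ and holomorphic in $\zeta$, and consider near a point $p=(\zeta_0,u_0,v_0)$ the vacuum pp-wave metric $$g_f=2\,d\zeta\,d\bar\zeta-2\,du\,dv-(f+\bar f)\,du^2 .$$ All statements are local: they concern an unspecified neighbourhood of $p$, and equations are identities near $p$. A null tetrad $(e_1,e_2,e_3,e_4)=(\delta,\delta^*,\Delta,D)$ consists of smooth vector fields with $\delta^*=\bar\delta$, $\Delta$ and $D$ real, $g_f(\delta,\delta^*)=1$, $g_f(\Delta,D)=-1$ and all other products zero; $\omega^1,\dots,\omega^4$ is the dual coframe. Let $\omega_{ab}(Z)=g_f(e_a,\nabla_Z e_b)$ be the connection forms of the Levi-Civita connection and put $$\alpha=-\tfrac12(\omega_{12}+\omega_{34})(\delta^*),\quad \gamma=-\tfrac12(\omega_{12}+\omega_{34})(\Delta),\quad \mu=\omega_{23}(\delta),\quad \Psi_4=R(\delta^*,\Delta,\delta^*,\Delta),$$ where $R(X,Y,Z,W)=g_f(X,R(Z,W)Y)$ and $R(Z,W)=\nabla_Z\nabla_W-\nabla_W\nabla_Z-\nabla_{[Z,W]}$.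 The tetrad is called *invariant* if $D$ is a multiple of the covariantly constant null vector field $\partial_v$, $\Psi_4=1$, $\gamma=0$, and $\alpha(p)\neq0$. Complex conjugates are denoted by $*$, and for an invariant tetrad $$A=\delta^*\alpha/\alpha^2,\qquad B=\mu A-\mu^* .$$ The metric is a *type $(0,1)$ $G_2$-precursor* near $p$ if it admits an invariant tetrad near $p$ such that $d\alpha\wedge d\alpha^*=0$ and such that there is a real smooth vector field $V=V^1\delta+V^2\delta^*+V^3\Delta+V^4D$ with $\mathcal L_V\omega^1=\mathcal L_V\omega^3=0$ for which $V^1,V^3$ are not both identically zero near $p$. **Classes.** Consider the following nine classes. Here $k,k_0,k_1,k_2$ are real constants, $C$ is a complex constant, $g=g(u)$ is an arbitrary smooth complex function and $h=h(u)$ is a smooth real function; $k_0,C,h$ do not vanish, and $k_1,k_2\neq0$; in class $\mathrm{AE}_{13}$ also $k\ne0$; $\log$ is any local holomorphic branch and the powers of expressions containing $\zeta$ are defined by such a branch; $u>0$ in $\mathrm{BP}_{13}$ and $\mathrm{BE}_{13}$, and $u\neq0$ in $\mathrm{BL}_{13}$. In the invariant conditions, $\neq$ means "is not equal at $p$". |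 class | $f(\zeta,u)$ | invariant condition | |---|---|---| | $\mathrm{BP}_{13}$ | $(k_0u^{-ik_1}\zeta)^{2ik_2}+g\zeta$ | $B=0,\ \mu\ne0,\ \Delta^2(1/\mu)=0,\ \Delta\mu\neq0,\ A^2\neq1$ | | $\mathrm{CP}_{13}$ | $(k_0e^{iu}\zeta)^{2ik_1}+g\zeta$ | $B=0,\ \Delta\mu=0,\ \mu\neq0,\ A^2\neq1$ | | $\mathrm{BE}_{13}$ | $\exp(k_0u^{-ik_1}\zeta)+g\zeta$ | $B=0,\ A=-1,\ \mu\ne0,\ \Delta^2(1/\mu)=0,\ \Delta\mu\neq0$ | | $\mathrm{CE}_{13}$ | $\exp(k_0e^{iu}\zeta)+g\zeta$ | $B=0,\ A=-1,\ \Delta\mu=0,\ \mu\neq0$ | | $\mathrm{L}_{13}$ | $e^{ik}h\log\zeta+g\zeta$ | $B=0,\ A=1$ | | $\mathrm{BL}_{13}$ | $Cu^{-2}\log\zeta+g\zeta$ | $B=0,\ A=1,\ \Delta\mu=\mu^2,\ \mu\neq0$ | | $\mathrm{AP}_{13}$ | $(k_0\zeta)^{2ik_1}+g\zeta$ | $\mu=0,\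 AA^*=1,\ A^2\neq1$ | | $\mathrm{AE}_{13}$ | $\exp(k\zeta)+g\zeta$ | $\mu=0,\ A=-1$ | | $\mathrm{AL}_{13}$ | $e^{ik}\log\zeta+g\zeta$ | $\mu=0,\ A=1$ | We say that $f$ *belongs* to a class near $p$ if some coordinate transformation $$\hat\zeta=e^{i\kappa}(\zeta+H(u)),\qquad \hat u=(u+c)/a,\qquad \hat v=a\bigl(v+H'(u)\bar\zeta+\bar H'(u)\zeta+r(u)\bigr)$$ ($\kappa,c,a$ real, $a\neq0$, $H$ complex-valued and $r$ real-valued smooth functions of $u$) carries $g_f$ near $p$ to the metric $g_F$ for a function $F(\hat\zeta,\hat u)$ of the form listed for that class. **Proposition.** 1. The metric $g_f$ is a type $(0,1)$ $G_2$-precursor near $p$ if and only if $f$ belongs near $p$ to one of the nine classes. 2. For each of the nine classes: if $f$ belongs to it near $p$, then $g_f$ admits an invariant tetrad near $p$; and, for every invariant tetrad near $p$, the invariant condition of the class holds if and only if $f$ belongs to the class near $p$. -/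

import Mathlib

namespace PPWave

open Filter
open scoped Topology ContDiff ComplexConjugate

/-- Coordinates `(ζ, u, v)` with `ζ` complex and `u, v` real. -/
abbrev Spacetime := ℂ × ℝ × ℝ

/-- `φ` is of class `C^∞` on a neighbourhood of `x`. -/
def SmoothNear {E F : Type*} [NormedAddCommGroup E] [NormedSpace ℝ E]
    [NormedAddCommGroup F] [NormedSpace ℝ F] (φ : E → F) (x : E) : Prop :=
  ∀ᶠ y in 𝓝 x, ContDiffAt ℝ ∞ φ y

/-! ### Tensor calculus in the complex coordinates `x⁰ = ζ, x¹ = ζ̄, x² = u, x³ = v` -/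

/-- The coordinate functions `ζ, ζ̄, u, v`. -/
noncomputable def coord (i : Fin 4) (x : Spacetime) : ℂ :=
  match i with
  | 0 => x.1
  | 1 => conj x.1
  | 2 => (x.2.1 : ℂ)
  | 3 => (x.2.2 : ℂ)

/-- The coordinate derivations `∂_ζ, ∂_ζ̄` (Wirtinger derivatives), `∂_u, ∂_v`. -/
noncomputable def pd (i : Fin 4) (φ : Spacetime → ℂ) (x : Spacetime) : ℂ :=
  match i with
  | 0 => (fderiv ℝ φ x (1, 0, 0) - Complex.I * fderiv ℝ φ x (Complex.I, 0, 0)) / 2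
  | 1 => (fderiv ℝ φ x (1, 0, 0) + Complex.I * fderiv ℝ φ x (Complex.I, 0, 0)) / 2
  | 2 => fderiv ℝ φ x (0, 1, 0)
  | 3 => fderiv ℝ φ x (0, 0, 1)

/-- A complex vector field (a section of the complexified tangent bundle), given by its
components along `∂_ζ, ∂_ζ̄, ∂_u, ∂_v`. -/
abbrev VectorField := Spacetime → Fin 4 → ℂ

/-- The complex conjugate vector field. -/
noncomputable def VectorField.bar (X : VectorField) : VectorField :=
  fun x => ![conj (X x 1), conj (X x 0), conj (X x 2), conj (X x 3)]

/-- The derivative of the function `φ` along the vector field `X`. -/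
noncomputable def VectorField.app (X : VectorField) (φ : Spacetime → ℂ) : Spacetime → ℂ :=
  fun x => ∑ i, X x i * pd i φ x

/-- The metric `2 dζ dζ̄ - 2 du dv - (f + f̄) du²`. -/
noncomputable def metric (f : ℂ × ℝ → ℂ) (x : Spacetime) : Matrix (Fin 4) (Fin 4) ℂ :=
  !![0, 1, 0, 0;
     1, 0, 0, 0;
     0, 0, -(f (x.1, x.2.1) + conj (f (x.1, x.2.1))), -1;
     0, 0, -1, 0]

/-- The scalar product `g(X, Y)` (complex bilinear). -/
noncomputable def ip (f : ℂ × ℝ → ℂ) (X Y : VectorField) (x : Spacetime) : ℂ :=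
  ∑ i, ∑ j, metric f x i j * X x i * Y x j

/-- The covector field `g(X, ·)`, by its components along `dζ, dζ̄, du, dv`. -/
noncomputable def lower (f : ℂ × ℝ → ℂ) (X : VectorField) : Spacetime → Fin 4 → ℂ :=
  fun x i => ∑ j, metric f x i j * X x j

/-- The Christoffel symbols `Γ^k_{ij}` of the metric. -/
noncomputable def christoffel (f : ℂ × ℝ → ℂ) (k i j : Fin 4) (x : Spacetime) : ℂ :=
  (1 / 2) * ∑ l, (metric f x)⁻¹ k l *
    (pd i (fun y => metric f y l j) x + pd j (fun y => metric f y l i) x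
      - pd l (fun y => metric f y i j) x)

/-- The Levi-Civita covariant derivative `∇_Z Y`. -/
noncomputable def nabla (f : ℂ × ℝ → ℂ) (Z Y : VectorField) : VectorField :=
  fun x k => ∑ i, Z x i * (pd i (fun y => Y y k) x + ∑ j, christoffel f k i j x * Y x j)

/-- The curvature tensor `R^l_{kij}`, with `R(∂_i, ∂_j) ∂_k = R^l_{kij} ∂_l` and
`R(X, Y) = ∇_X ∇_Y - ∇_Y ∇_X - ∇_[X,Y]`. -/
noncomputable def riemann (f : ℂ × ℝ → ℂ) (l k i j : Fin 4) (x : Spacetime) : ℂ :=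
  pd i (christoffel f l j k) x - pd j (christoffel f l i k) x
    + ∑ r, (christoffel f l i r x * christoffel f r j k x
      - christoffel f l j r x * christoffel f r i k x)

/-- `R(X, Y, Z, W) = R_{abcd} X^a Y^b Z^c W^d`. -/
noncomputable def riemannLow (f : ℂ × ℝ → ℂ) (X Y Z W : VectorField) (x : Spacetime) : ℂ :=
  ∑ a, ∑ b, ∑ c, ∑ d, (∑ l, metric f x a l * riemann f l b c d x) *
    X x a * Y x b * Z x c * W x d

/-- The Lie derivative `L_V θ` of a covector field, in components. -/
noncomputable def lieCovector (V : VectorField) (θ : Spacetime → Fin 4 → ℂ) :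
    Spacetime → Fin 4 → ℂ :=
  fun x i => ∑ j, (V x j * pd j (fun y => θ y i) x + θ x j * pd i (fun y => V y j) x)

/-! ### Null tetrads and Newman-Penrose scalars -/

/-- The vectors `(δ, δ*, Δ, D) = (e₁, e₂, e₃, e₄)` of a complex null tetrad; `δ*` is the complex
conjugate of `δ`. -/
structure Tetrad where
  /-- `δ` -/
  m : VectorField
  /-- `Δ` -/
  n : VectorField
  /-- `D` -/
  l : VectorField

/-- A smooth null tetrad near `p`: `Δ, D` are real, `g(δ, δ*) = 1`, `g(Δ, D) = -1`, and the other
products vanish. With the dual coframe, `g = 2 ω¹ ω² - 2 ω³ ω⁴`. -/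
def IsNullTetrad (f : ℂ × ℝ → ℂ) (T : Tetrad) (p : Spacetime) : Prop :=
  SmoothNear T.m p ∧ SmoothNear T.n p ∧ SmoothNear T.l p ∧
  ∀ᶠ x in 𝓝 p,
    T.n.bar x = T.n x ∧ T.l.bar x = T.l x ∧
    ip f T.m T.m x = 0 ∧ ip f T.m T.m.bar x = 1 ∧
    ip f T.m T.n x = 0 ∧ ip f T.m T.l x = 0 ∧
    ip f T.n T.n x = 0 ∧ ip f T.l T.l x = 0 ∧ ip f T.n T.l x = -1

/-- The connection component `ω_{ab}(Z) = g(e_a, ∇_Z e_b)`; these are the connection forms with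
`dωᵃ = -ωᵃ_b ∧ ωᵇ`. -/
noncomputable def conn (f : ℂ × ℝ → ℂ) (ea eb Z : VectorField) : Spacetime → ℂ :=
  ip f ea (nabla f Z eb)

/-- The spin coefficient `α = -(ω₁₂ + ω₃₄)(δ*) / 2`. -/
noncomputable def alpha (f : ℂ × ℝ → ℂ) (T : Tetrad) : Spacetime → ℂ :=
  fun x => -(conn f T.m T.m.bar T.m.bar x + conn f T.n T.l T.m.bar x) / 2

/-- The spin coefficient `γ = -(ω₁₂ + ω₃₄)(Δ) / 2`. -/
noncomputable def gamma (f : ℂ × ℝ → ℂ) (T : Tetrad) : Spacetime → ℂ :=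
  fun x => -(conn f T.m T.m.bar T.n x + conn f T.n T.l T.n x) / 2

/-- The spin coefficient `μ = ω₂₃(δ)`. -/
noncomputable def mu (f : ℂ × ℝ → ℂ) (T : Tetrad) : Spacetime → ℂ :=
  conn f T.m.bar T.n T.m

/-- The Weyl component `Ψ₄ = R₂₃₂₃ = R(δ*, Δ, δ*, Δ)`. (The trace part of the curvature does not
contribute, because `δ*` and `Δ` are null and orthogonal.) -/
noncomputable def psi4 (f : ℂ × ℝ → ℂ) (T : Tetrad) : Spacetime → ℂ :=
  riemannLow f T.m.bar T.n T.m.bar T.n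

/-- The invariant tetrad of the class `α ≠ 0` near `p`: a null tetrad with `D` along the covariantly
constant null vector field `∂_v`, normalized by `Ψ₄ = 1` and `γ = 0`, and with `α ≠ 0`. -/
def IsInvariantTetrad (f : ℂ × ℝ → ℂ) (T : Tetrad) (p : Spacetime) : Prop :=
  IsNullTetrad f T p ∧
  (∀ᶠ x in 𝓝 p, T.l x 0 = 0 ∧ T.l x 1 = 0 ∧ T.l x 2 = 0) ∧
  (∀ᶠ x in 𝓝 p, psi4 f T x = 1) ∧
  (∀ᶠ x in 𝓝 p, gamma f T x = 0) ∧
  alpha f T p ≠ 0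

/-- The coframe element `ω¹ = g(δ*, ·)`, dual to `δ`. -/
noncomputable def omega1 (f : ℂ × ℝ → ℂ) (T : Tetrad) : Spacetime → Fin 4 → ℂ :=
  lower f T.m.bar

/-- The coframe element `ω³ = -g(D, ·)`, dual to `Δ`. -/
noncomputable def omega3 (f : ℂ × ℝ → ℂ) (T : Tetrad) : Spacetime → Fin 4 → ℂ :=
  fun x i => -lower f T.l x i

/-- The invariant `A = δ*α / α²`. -/
noncomputable def invA (f : ℂ × ℝ → ℂ) (T : Tetrad) : Spacetime → ℂ :=
  fun x => T.m.bar.app (alpha f T) x / alpha f T x ^ 2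

/-- The invariant `B = μ A - μ*`. -/
noncomputable def invB (f : ℂ × ℝ → ℂ) (T : Tetrad) : Spacetime → ℂ :=
  fun x => mu f T x * invA f T x - conj (mu f T x)

/-- Type `(0,1)`: the first order invariants `α, α*` are functionally dependent,
`dα ∧ dα* = 0` near `p`. -/
def IsType01 (f : ℂ × ℝ → ℂ) (T : Tetrad) (p : Spacetime) : Prop :=
  ∀ᶠ x in 𝓝 p, ∀ i j : Fin 4,
    pd i (alpha f T) x * pd j (fun y => conj (alpha f T y)) x
      = pd j (alpha f T) x * pd i (fun y => conj (alpha f T y)) x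

/-- `G₂`-precursor near `p`: there is a real vector field `V = V¹ δ + V² δ* + V³ Δ + V⁴ D` with
`L_V ω¹ = L_V ω³ = 0` such that `V¹` and `V³` are not both identically zero. -/
def IsPrecursor (f : ℂ × ℝ → ℂ) (T : Tetrad) (p : Spacetime) : Prop :=
  ∃ (V1 : Spacetime → ℂ) (V3 V4 : Spacetime → ℝ) (V : VectorField),
    SmoothNear V1 p ∧ SmoothNear V3 p ∧ SmoothNear V4 p ∧
    (∀ x i, V x i = V1 x * T.m x i + conj (V1 x) * T.m.bar x i
      + (V3 x : ℂ) * T.n x i + (V4 x : ℂ) * T.l x i) ∧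
    (∀ᶠ x in 𝓝 p, ∀ i, lieCovector V (omega1 f T) x i = 0 ∧ lieCovector V (omega3 f T) x i = 0) ∧
    (∃ᶠ x in 𝓝 p, V1 x ≠ 0 ∨ V3 x ≠ 0)

/-- The metric of `f` is, near `p`, a vacuum pp-wave with `α ≠ 0` that is a `G₂`-precursor of
type `(0,1)`. -/
def IsType01Precursor (f : ℂ × ℝ → ℂ) (p : Spacetime) : Prop :=
  ∃ T : Tetrad, IsInvariantTetrad f T p ∧ IsType01 f T p ∧ IsPrecursor f T p

/-! ### The nine classes -/

/-- Names of the classes of type `(0,1)` `G₂`-precursor solutions. -/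
inductive SolClass
  | BP | CP | BE | CE | L | BL | AP | AE | AL

/-- The invariant condition that defines a class. -/
def InvariantCondition (c : SolClass) (f : ℂ × ℝ → ℂ) (T : Tetrad) (p : Spacetime) : Prop :=
  match c with
  | .BP => (∀ᶠ x in 𝓝 p, invB f T x = 0) ∧ mu f T p ≠ 0 ∧
      (∀ᶠ x in 𝓝 p, T.n.app (T.n.app (fun y => 1 / mu f T y)) x = 0) ∧
      T.n.app (mu f T) p ≠ 0 ∧ invA f T p ^ 2 ≠ 1
  | .CP => (∀ᶠ x in 𝓝 p, invB f T x = 0) ∧ (∀ᶠ x in 𝓝 p, T.n.app (mu f T) x = 0) ∧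
      mu f T p ≠ 0 ∧ invA f T p ^ 2 ≠ 1
  | .BE => (∀ᶠ x in 𝓝 p, invB f T x = 0) ∧ (∀ᶠ x in 𝓝 p, invA f T x = -1) ∧ mu f T p ≠ 0 ∧
      (∀ᶠ x in 𝓝 p, T.n.app (T.n.app (fun y => 1 / mu f T y)) x = 0) ∧
      T.n.app (mu f T) p ≠ 0
  | .CE => (∀ᶠ x in 𝓝 p, invB f T x = 0) ∧ (∀ᶠ x in 𝓝 p, invA f T x = -1) ∧
      (∀ᶠ x in 𝓝 p, T.n.app (mu f T) x = 0) ∧ mu f T p ≠ 0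
  | .L => (∀ᶠ x in 𝓝 p, invB f T x = 0) ∧ (∀ᶠ x in 𝓝 p, invA f T x = 1)
  | .BL => (∀ᶠ x in 𝓝 p, invB f T x = 0) ∧ (∀ᶠ x in 𝓝 p, invA f T x = 1) ∧
      (∀ᶠ x in 𝓝 p, T.n.app (mu f T) x = mu f T x ^ 2) ∧ mu f T p ≠ 0
  | .AP => (∀ᶠ x in 𝓝 p, mu f T x = 0) ∧
      (∀ᶠ x in 𝓝 p, invA f T x * conj (invA f T x) = 1) ∧ invA f T p ^ 2 ≠ 1
  | .AE => (∀ᶠ x in 𝓝 p, mu f T x = 0) ∧ (∀ᶠ x in 𝓝 p, invA f T x = -1)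
  | .AL => (∀ᶠ x in 𝓝 p, mu f T x = 0) ∧ (∀ᶠ x in 𝓝 p, invA f T x = 1)

/-- `ℓ` is a holomorphic branch of the logarithm near `z₀`. A power `z ^ s` means `exp (s * ℓ z)`
for such a branch. -/
def IsLogBranch (ℓ : ℂ → ℂ) (z₀ : ℂ) : Prop :=
  AnalyticAt ℂ ℓ z₀ ∧ ∀ᶠ z in 𝓝 z₀, Complex.exp (ℓ z) = z

/-- `F` has, near the point `q` of the `(ζ, u)`-space, the explicit form of the class `c`. In each
case `g` is an arbitrary smooth complex function of `u`, and the `k`'s are real constants. -/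
def IsClassForm (c : SolClass) (F : ℂ × ℝ → ℂ) (q : ℂ × ℝ) : Prop :=
  ∃ g : ℝ → ℂ, SmoothNear g q.2 ∧
  match c with
  | .BP => 0 < q.2 ∧ ∃ k₀ k₁ k₂ : ℝ, k₀ ≠ 0 ∧ k₁ ≠ 0 ∧ k₂ ≠ 0 ∧ ∃ ℓ : ℂ → ℂ,
      IsLogBranch ℓ (k₀ * (q.2 : ℂ) ^ (-(Complex.I * k₁)) * q.1) ∧
      ∀ᶠ y in 𝓝 q, F y = Complex.exp
        (2 * Complex.I * k₂ * ℓ (k₀ * (y.2 : ℂ) ^ (-(Complex.I * k₁)) * y.1)) + g y.2 * y.1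
  | .CP => ∃ k₀ k₁ : ℝ, k₀ ≠ 0 ∧ k₁ ≠ 0 ∧ ∃ ℓ : ℂ → ℂ,
      IsLogBranch ℓ (k₀ * Complex.exp (Complex.I * q.2) * q.1) ∧
      ∀ᶠ y in 𝓝 q, F y = Complex.exp
        (2 * Complex.I * k₁ * ℓ (k₀ * Complex.exp (Complex.I * y.2) * y.1)) + g y.2 * y.1
  | .BE => 0 < q.2 ∧ ∃ k₀ k₁ : ℝ, k₀ ≠ 0 ∧ k₁ ≠ 0 ∧
      ∀ᶠ y in 𝓝 q, F y = Complex.exp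
        (k₀ * (y.2 : ℂ) ^ (-(Complex.I * k₁)) * y.1) + g y.2 * y.1
  | .CE => ∃ k₀ : ℝ, k₀ ≠ 0 ∧
      ∀ᶠ y in 𝓝 q, F y = Complex.exp
        (k₀ * Complex.exp (Complex.I * y.2) * y.1) + g y.2 * y.1
  | .L => ∃ (k : ℝ) (h : ℝ → ℝ), SmoothNear h q.2 ∧ h q.2 ≠ 0 ∧ ∃ ℓ : ℂ → ℂ,
      IsLogBranch ℓ q.1 ∧
      ∀ᶠ y in 𝓝 q, F y = Complex.exp (Complex.I * k) * h y.2 * ℓ y.1 + g y.2 * y.1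
  | .BL => q.2 ≠ 0 ∧ ∃ C : ℂ, C ≠ 0 ∧ ∃ ℓ : ℂ → ℂ, IsLogBranch ℓ q.1 ∧
      ∀ᶠ y in 𝓝 q, F y = C * ((y.2 : ℂ) ^ 2)⁻¹ * ℓ y.1 + g y.2 * y.1
  | .AP => ∃ k₀ k₁ : ℝ, k₀ ≠ 0 ∧ k₁ ≠ 0 ∧ ∃ ℓ : ℂ → ℂ, IsLogBranch ℓ (k₀ * q.1) ∧
      ∀ᶠ y in 𝓝 q, F y = Complex.exp (2 * Complex.I * k₁ * ℓ (k₀ * y.1)) + g y.2 * y.1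
  | .AE => ∃ k : ℝ, k ≠ 0 ∧
      ∀ᶠ y in 𝓝 q, F y = Complex.exp (k * y.1) + g y.2 * y.1
  | .AL => ∃ k : ℝ, ∃ ℓ : ℂ → ℂ, IsLogBranch ℓ q.1 ∧
      ∀ᶠ y in 𝓝 q, F y = Complex.exp (Complex.I * k) * ℓ y.1 + g y.2 * y.1

/-- The form-preserving coordinate transformations
`ζ̂ = e^{ik} (ζ + h(u))`, `û = (u + u₀) / a`, `v̂ = a (v + h'(u) ζ̄ + h̄'(u) ζ + r(u))`
(note that `h' ζ̄ + h̄' ζ = 2 Re (h' ζ̄)`). -/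
noncomputable def transf (a k u₀ : ℝ) (h : ℝ → ℂ) (r : ℝ → ℝ) (x : Spacetime) : Spacetime :=
  (Complex.exp (Complex.I * k) * (x.1 + h x.2.1),
   (x.2.1 + u₀) / a,
   a * (x.2.2 + 2 * (deriv h x.2.1 * conj x.1).re + r x.2.1))

/-- `Φ` pulls the metric of `F` back to the metric of `f` near `p`. -/
def PullsBack (Φ : Spacetime → Spacetime) (F f : ℂ × ℝ → ℂ) (p : Spacetime) : Prop :=
  ∀ᶠ x in 𝓝 p, ∀ i j : Fin 4, metric f x i j =
    ∑ r, ∑ s, pd i (fun y => coord r (Φ y)) x * pd j (fun y => coord s (Φ y)) x *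
      metric F (Φ x) r s

/-- The solution `f` belongs near `p` to the class `c`: a form-preserving coordinate transformation
brings its metric to the explicit form of the class. -/
def BelongsTo (c : SolClass) (f : ℂ × ℝ → ℂ) (p : Spacetime) : Prop :=
  ∃ (a k u₀ : ℝ) (h : ℝ → ℂ) (r : ℝ → ℝ) (F : ℂ × ℝ → ℂ),
    a ≠ 0 ∧ SmoothNear h p.2.1 ∧ SmoothNear r p.2.1 ∧
    IsClassForm c F ((transf a k u₀ h r p).1, (transf a k u₀ h r p).2.1) ∧
    PullsBack (transf a k u₀ h r) F f p

end PPWave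

namespace PPWave

open Filter
open scoped Topology ContDiff ComplexConjugate

/-! ### Functions that are smooth near a point -/

section SmoothNear

variable {E F G : Type*} [NormedAddCommGroup E] [NormedSpace ℝ E]
  [NormedAddCommGroup F] [NormedSpace ℝ F] [NormedAddCommGroup G] [NormedSpace ℝ G]

/-! Everything is expressed by the one function φ = ∂_ζ²f (`hess f`), which is holomorphic in ζ and
independent of v. If D is along ∂_v, then δ is, up to a multiple of ∂_v, a unimodular multiple of
∂_ζ̄ or of ∂_ζ. Interchanging δ and δ* conjugates all scalars, so the first case suffices
(`exists_adapted_of_invariant`). Let P be the ∂_ζ̄-component of δ and N the ∂_u-component of Δ. Then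
Ψ₄ = 1 reads N²P̄²φ = 2, γ = 0 reads Δφ = 0, so that Δ has ∂_ζ-component Nq with q = -φ_u/φ_ζ, and α
≠ 0 reads φ_ζ ≠ 0.

Put ψ = φ/φ_ζ and M = ∂_ζ q. Then A = -1 - 4ψ_ζ and μ = N M̄, and Δ annihilates N; hence all the
invariant conditions become conditions on A and M (`Adapted.invariantCondition_iff`). These two are
linked by (∂_u + q∂_ζ)ψ = Mψ (`Regular.flow_ratio`).

The condition dα ∧ dα* = 0 means |A| = 1 and M = A M̄ (`Adapted.isType01_iff`). Holomorphy then
makes A and M independent of ζ, and the link makes A constant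
(`ReducedType01.exists_constantModulus`). A vector field preserving ω¹ and ω³ is determined, up to
its ∂_v-component, by three real constants y₀, y₁, c subject to ic = M(y₀ + y₁u) + (y₁ + ic)(A +
1)/2 (`exists_constants_of_preserves`, `preserves_of_constants`). For A = 1 the choice y₀ = y₁ = 0
always works and M(u) stays free. For A ≠ 1 the product M(y₀ + y₁u) is constant, so M is zero, a
nonzero constant, or κ/(u + d). These cases are the normal forms of the classes
(`exists_normalForm`, `reducedPrecursor_of_normalForm`), and the invariant conditions describe the
same normal forms (`normalForm_of_reducedCondition`, `reducedCondition_of_normalForm`).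

It remains to integrate. For A ≠ -1 write A = -1 - 4/s; then sψ = ζ + h(u) and φ is a power of ζ + h
with exponent s. If A² ≠ 1, then A = (1 + ik)/(1 - ik) and s = 2ik - 2, so f has exponent 2ik; if A
= 1, then s = -2 and f is logarithmic. For A = -1, ψ depends on u alone and φ is an exponential. The
integration constants are absorbed by the shift, rotation and scaling of the coordinates. Since φ
determines f up to a function affine in ζ, the remainder goes into g and into the shift r of v
(`exists_pullsBack`); conversely, coordinate changes alter f + f̄ only by the real part of such a
function (`pullsBack_iff`). This gives `belongsTo_of_normalForm` and `normalForm_of_belongsTo`. -/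

theorem SmoothNear.contDiffAt {φ : E → F} {x : E} (h : SmoothNear φ x) : ContDiffAt ℝ ∞ φ x :=
  h.self_of_nhds

theorem SmoothNear.eventually {φ : E → F} {x : E} (h : SmoothNear φ x) :
    ∀ᶠ y in 𝓝 x, SmoothNear φ y :=
  h.eventually_nhds

theorem SmoothNear.differentiableAt {φ : E → F} {x : E} (h : SmoothNear φ x) :
    DifferentiableAt ℝ φ x :=
  h.contDiffAt.differentiableAt (by simp)

theorem SmoothNear.continuousAt {φ : E → F} {x : E} (h : SmoothNear φ x) : ContinuousAt φ x :=
  h.contDiffAt.continuousAt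

theorem SmoothNear.congr {φ ψ : E → F} {x : E} (h : SmoothNear φ x) (e : φ =ᶠ[𝓝 x] ψ) :
    SmoothNear ψ x := by
  filter_upwards [h, eventually_eventually_nhds.2 e] with y hy ey
  exact hy.congr_of_eventuallyEq (EventuallyEq.symm ey)

theorem SmoothNear.const (c : F) (x : E) : SmoothNear (fun _ => c) x :=
  Eventually.of_forall fun _ => contDiffAt_const

theorem smoothNear_of_contDiff {φ : E → F} (h : ContDiff ℝ ∞ φ) (x : E) : SmoothNear φ x :=
  Eventually.of_forall fun _ => h.contDiffAt

theorem SmoothNear.comp {φ : E → F} {g : F → G} {x : E} (hg : SmoothNear g (φ x))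
    (h : SmoothNear φ x) : SmoothNear (fun y => g (φ y)) x := by
  filter_upwards [h, h.continuousAt.eventually hg] with y hy hgy
  exact hgy.comp y hy

theorem SmoothNear.prodMk {φ : E → F} {g : E → G} {x : E} (hφ : SmoothNear φ x)
    (hg : SmoothNear g x) : SmoothNear (fun y => (φ y, g y)) x := by
  filter_upwards [hφ, hg] with y h h' using h.prodMk h'

theorem SmoothNear.pi {ι : Type*} [Fintype ι] {φ : E → ι → F} {x : E}
    (h : ∀ i, SmoothNear (fun y => φ y i) x) : SmoothNear φ x := by
  filter_upwards [eventually_all.2 h] with y hy using contDiffAt_pi.2 hy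

theorem SmoothNear.apply {ι : Type*} [Fintype ι] {φ : E → ι → F} {x : E}
    (h : SmoothNear φ x) (i : ι) : SmoothNear (fun y => φ y i) x := by
  filter_upwards [h] with y hy using contDiffAt_pi.1 hy i

variable {φ ψ : E → ℂ} {x : E}

theorem SmoothNear.add (h : SmoothNear φ x) (h' : SmoothNear ψ x) :
    SmoothNear (fun y => φ y + ψ y) x := by
  filter_upwards [h, h'] with y a b using a.add b

theorem SmoothNear.sub (h : SmoothNear φ x) (h' : SmoothNear ψ x) :
    SmoothNear (fun y => φ y - ψ y) x := by
  filter_upwards [h, h'] with y a b using a.sub b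

theorem SmoothNear.neg (h : SmoothNear φ x) : SmoothNear (fun y => -φ y) x := by
  filter_upwards [h] with y a using a.neg

theorem SmoothNear.mul (h : SmoothNear φ x) (h' : SmoothNear ψ x) :
    SmoothNear (fun y => φ y * ψ y) x := by
  filter_upwards [h, h'] with y a b using a.mul b

theorem SmoothNear.inv (h : SmoothNear φ x) (h0 : φ x ≠ 0) : SmoothNear (fun y => (φ y)⁻¹) x := by
  filter_upwards [h, h.continuousAt.eventually_ne h0] with y a b using a.inv b

theorem SmoothNear.div (h : SmoothNear φ x) (h' : SmoothNear ψ x) (h0 : ψ x ≠ 0) :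
    SmoothNear (fun y => φ y / ψ y) x := by
  simpa only [div_eq_mul_inv] using h.mul (h'.inv h0)

theorem SmoothNear.conj (h : SmoothNear φ x) : SmoothNear (fun y => conj (φ y)) x := by
  filter_upwards [h] with y a using Complex.conjCLE.contDiff.contDiffAt.comp y a

theorem SmoothNear.cexp (h : SmoothNear φ x) : SmoothNear (fun y => Complex.exp (φ y)) x := by
  filter_upwards [h] with y a using a.cexp

theorem SmoothNear.ofReal {r : E → ℝ} (h : SmoothNear r x) : SmoothNear (fun y => (r y : ℂ)) x := by
  filter_upwards [h] with y a using Complex.ofRealCLM.contDiff.contDiffAt.comp y a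

theorem SmoothNear.re (h : SmoothNear φ x) : SmoothNear (fun y => (φ y).re) x := by
  filter_upwards [h] with y a using Complex.reCLM.contDiff.contDiffAt.comp y a

theorem SmoothNear.im (h : SmoothNear φ x) : SmoothNear (fun y => (φ y).im) x := by
  filter_upwards [h] with y a using Complex.imCLM.contDiff.contDiffAt.comp y a

theorem _root_.AnalyticAt.smoothNear {g : ℂ → ℂ} {z : ℂ} (h : AnalyticAt ℂ g z) :
    SmoothNear g z := by
  filter_upwards [h.eventually_analyticAt] with w hw
  exact (hw.contDiffAt (n := ∞)).restrict_scalars ℝ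

theorem SmoothNear.fderiv_apply {φ : E → F} {x : E} (h : SmoothNear φ x) (v : E) :
    SmoothNear (fun y => fderiv ℝ φ y v) x := by
  filter_upwards [h] with y a
  exact (a.fderiv_right (m := ∞) (by simp)).clm_apply contDiffAt_const

theorem SmoothNear.deriv {c : ℝ → F} {u : ℝ} (h : SmoothNear c u) : SmoothNear (deriv c) u :=
  h.fderiv_apply 1

/-- Division by the value at x moves the argument of the principal branch to 1, away from its cut.
-/
theorem SmoothNear.exists_log (h : SmoothNear φ x) (h0 : φ x ≠ 0) :
    ∃ L : E → ℂ, SmoothNear L x ∧ ∀ᶠ y in 𝓝 x, Complex.exp (L y) = φ y := by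
  refine ⟨fun y => Complex.log (φ y / φ x) + Complex.log (φ x), ?_, ?_⟩
  · refine SmoothNear.add ?_ (SmoothNear.const _ _)
    refine SmoothNear.comp (g := Complex.log) ?_ (h.div (SmoothNear.const _ _) h0)
    rw [div_self h0]
    exact (analyticAt_clog (by simp)).smoothNear
  · filter_upwards [h.continuousAt.eventually_ne h0] with y hy
    rw [Complex.exp_add, Complex.exp_log (div_ne_zero hy h0), Complex.exp_log h0,
      div_mul_cancel₀ _ h0]

end SmoothNear

theorem smoothNear_fst (x : Spacetime) : SmoothNear (fun y : Spacetime => y.1) x :=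
  smoothNear_of_contDiff contDiff_fst x

theorem smoothNear_u (x : Spacetime) : SmoothNear (fun y : Spacetime => y.2.1) x :=
  smoothNear_of_contDiff (contDiff_fst.comp contDiff_snd) x

theorem SmoothNear.comp_u {F : Type*} [NormedAddCommGroup F] [NormedSpace ℝ F] {c : ℝ → F}
    {x : Spacetime} (h : SmoothNear c x.2.1) : SmoothNear (fun y : Spacetime => c y.2.1) x :=
  SmoothNear.comp (φ := fun y : Spacetime => y.2.1) h (smoothNear_u x)

/-! ### The coordinate derivations -/

/-- The derivations `pd i` as combinations of two directional derivatives. -/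
noncomputable def pdCoeff : Fin 4 → ℂ := ![1 / 2, 1 / 2, 1, 1]

/-- The second coefficient. -/
noncomputable def pdCoeff' : Fin 4 → ℂ := ![-Complex.I / 2, Complex.I / 2, 0, 0]

/-- The first direction. -/
noncomputable def pdDir : Fin 4 → Spacetime := ![(1, 0, 0), (1, 0, 0), (0, 1, 0), (0, 0, 1)]

/-- The second direction. -/
noncomputable def pdDir' : Spacetime := (Complex.I, 0, 0)

/-- The uniform shape lets the calculus rules be proved once for all four indices. For ∂_u and ∂_v
the second coefficient is zero, so the second direction does not matter there. -/
theorem pd_eq (i : Fin 4) (φ : Spacetime → ℂ) (x : Spacetime) :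
    pd i φ x = pdCoeff i * fderiv ℝ φ x (pdDir i) + pdCoeff' i * fderiv ℝ φ x pdDir' := by
  fin_cases i <;> simp [pd, pdCoeff, pdCoeff', pdDir, pdDir'] <;> ring

theorem pd_congr {φ ψ : Spacetime → ℂ} {x : Spacetime} (i : Fin 4) (h : φ =ᶠ[𝓝 x] ψ) :
    pd i φ x = pd i ψ x := by
  rw [pd_eq, pd_eq, h.fderiv_eq]

theorem SmoothNear.pd {φ : Spacetime → ℂ} {x : Spacetime} (h : SmoothNear φ x) (i : Fin 4) :
    SmoothNear (PPWave.pd i φ) x := by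
  have : PPWave.pd i φ = fun x => pdCoeff i * fderiv ℝ φ x (pdDir i)
      + pdCoeff' i * fderiv ℝ φ x pdDir' := funext (pd_eq i φ)
  rw [this]
  exact ((SmoothNear.const _ _).mul (h.fderiv_apply _)).add
    ((SmoothNear.const _ _).mul (h.fderiv_apply _))

theorem fderiv_fderiv_comm {φ : Spacetime → ℂ} {x : Spacetime} (h : SmoothNear φ x)
    (v w : Spacetime) : fderiv ℝ (fun y => fderiv ℝ φ y v) x w
      = fderiv ℝ (fun y => fderiv ℝ φ y w) x v := by
  have hs : IsSymmSndFDerivAt ℝ φ x := h.contDiffAt.isSymmSndFDerivAt (by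
    simpa using WithTop.coe_le_coe.2 (le_top : (2 : ℕ∞) ≤ ⊤))
  have hd : DifferentiableAt ℝ (fderiv ℝ φ) x :=
    (h.contDiffAt.fderiv_right (m := ∞) (by simp)).differentiableAt (by simp)
  have key : ∀ v w, fderiv ℝ (fun y => fderiv ℝ φ y v) x w = fderiv ℝ (fderiv ℝ φ) x w v := by
    intro v w
    rw [fderiv_clm_apply hd (by fun_prop)]
    simp
  rw [key, key, hs.eq]

theorem pd_comm {φ : Spacetime → ℂ} {x : Spacetime} (h : SmoothNear φ x) (i j : Fin 4) :
    pd i (pd j φ) x = pd j (pd i φ) x := by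
  have key : ∀ i v, fderiv ℝ (pd i φ) x v = pdCoeff i * fderiv ℝ (fun y => fderiv ℝ φ y (pdDir i)) x v
      + pdCoeff' i * fderiv ℝ (fun y => fderiv ℝ φ y pdDir') x v := by
    intro i v
    have e : pd i φ = fun x => pdCoeff i * fderiv ℝ φ x (pdDir i)
      + pdCoeff' i * fderiv ℝ φ x pdDir' := funext (pd_eq i φ)
    have d : ∀ v, DifferentiableAt ℝ (fun y => fderiv ℝ φ y v) x :=
      fun v => (h.fderiv_apply v).differentiableAt
    rw [e, fderiv_fun_add ((d _).const_mul _) ((d _).const_mul _), fderiv_const_mul (d _),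
      fderiv_const_mul (d _)]
    simp
  rw [pd_eq, pd_eq, key, key, key, key, fderiv_fderiv_comm h (pdDir j) (pdDir i),
    fderiv_fderiv_comm h (pdDir j) pdDir', fderiv_fderiv_comm h pdDir' (pdDir i)]
  ring

/-- `φ` is differentiable at `x` with coordinate derivatives `d i`. -/
def HasPd (φ : Spacetime → ℂ) (d : Fin 4 → ℂ) (x : Spacetime) : Prop :=
  DifferentiableAt ℝ φ x ∧ ∀ i, pd i φ x = d i

theorem SmoothNear.hasPd {φ : Spacetime → ℂ} {x : Spacetime} (h : SmoothNear φ x) :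
    HasPd φ (fun i => PPWave.pd i φ x) x :=
  ⟨h.differentiableAt, fun _ => rfl⟩

namespace HasPd

variable {φ ψ : Spacetime → ℂ} {d e : Fin 4 → ℂ} {x : Spacetime}

theorem congr (h : HasPd φ d x) (hφ : φ =ᶠ[𝓝 x] ψ) : HasPd ψ d x :=
  ⟨h.1.congr_of_eventuallyEq hφ.symm, fun i => by rw [← pd_congr i hφ, h.2]⟩

theorem const (c : ℂ) (x : Spacetime) : HasPd (fun _ => c) (fun _ => 0) x :=
  ⟨by fun_prop, fun i => by simp [pd_eq]⟩

theorem add (h : HasPd φ d x) (h' : HasPd ψ e x) :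
    HasPd (fun y => φ y + ψ y) (fun i => d i + e i) x :=
  ⟨h.1.add h'.1, fun i => by
    simp only [← h.2, ← h'.2]
    rw [pd_eq, pd_eq, pd_eq, fderiv_fun_add h.1 h'.1]; simp; ring⟩

theorem neg (h : HasPd φ d x) : HasPd (fun y => -φ y) (fun i => -d i) x :=
  ⟨h.1.neg, fun i => by
    simp only [← h.2]
    rw [pd_eq, pd_eq, fderiv_fun_neg]; simp; ring⟩

theorem sub (h : HasPd φ d x) (h' : HasPd ψ e x) :
    HasPd (fun y => φ y - ψ y) (fun i => d i - e i) x := by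
  simpa only [sub_eq_add_neg] using h.add h'.neg

theorem mul (h : HasPd φ d x) (h' : HasPd ψ e x) :
    HasPd (fun y => φ y * ψ y) (fun i => d i * ψ x + φ x * e i) x :=
  ⟨h.1.mul h'.1, fun i => by
    simp only [← h.2, ← h'.2]
    rw [pd_eq, pd_eq, pd_eq, fderiv_fun_mul h.1 h'.1]; simp; ring⟩

theorem comp_hol (h : HasPd φ d x) {g : ℂ → ℂ} {g' : ℂ} (hg : HasDerivAt g g' (φ x)) :
    HasPd (fun y => g (φ y)) (fun i => g' * d i) x := by
  have hc := (hg.hasFDerivAt.restrictScalars ℝ).comp x h.1.hasFDerivAt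
  refine ⟨hc.differentiableAt, fun i => ?_⟩
  have : fderiv ℝ (fun y => g (φ y)) x = _ := hc.fderiv
  simp only [← h.2]
  rw [pd_eq, pd_eq, this]
  simp
  ring

theorem inv (h : HasPd φ d x) (h0 : φ x ≠ 0) :
    HasPd (fun y => (φ y)⁻¹) (fun i => -(φ x ^ 2)⁻¹ * d i) x :=
  h.comp_hol (hasDerivAt_inv h0)

theorem div (h : HasPd φ d x) (h' : HasPd ψ e x) (h0 : ψ x ≠ 0) :
    HasPd (fun y => φ y / ψ y) (fun i => (d i * ψ x - φ x * e i) / ψ x ^ 2) x := by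
  have := h.mul (h'.inv h0)
  refine ⟨by simpa only [div_eq_mul_inv] using this.1, fun i => ?_⟩
  have h2 := this.2 i
  simp only [← div_eq_mul_inv] at h2
  rw [h2]
  field_simp
  ring

theorem cexp (h : HasPd φ d x) :
    HasPd (fun y => Complex.exp (φ y)) (fun i => Complex.exp (φ x) * d i) x :=
  h.comp_hol (Complex.hasDerivAt_exp _)

theorem fst (x : Spacetime) : HasPd (fun y => y.1) ![1, 0, 0, 0] x := by
  have hc : HasFDerivAt (fun y : Spacetime => y.1) (ContinuousLinearMap.fst ℝ ℂ (ℝ × ℝ)) x :=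
    hasFDerivAt_fst
  refine ⟨hc.differentiableAt, fun i => ?_⟩
  rw [pd_eq, hc.fderiv]
  fin_cases i <;> simp [pdCoeff, pdCoeff', pdDir, pdDir'] <;> ring_nf <;> simp <;> norm_num

theorem comp_u {c : ℝ → ℂ} {c' : ℂ} (h : HasDerivAt c c' x.2.1) :
    HasPd (fun y => c y.2.1) ![0, 0, c', 0] x := by
  have hu : HasFDerivAt (fun y : Spacetime => y.2.1)
      ((ContinuousLinearMap.fst ℝ ℝ ℝ).comp (ContinuousLinearMap.snd ℝ ℂ (ℝ × ℝ))) x :=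
    hasFDerivAt_fst.comp x hasFDerivAt_snd
  have hc := h.hasFDerivAt.comp x hu
  refine ⟨hc.differentiableAt, fun i => ?_⟩
  have e : fderiv ℝ (fun y : Spacetime => c y.2.1) x = _ := hc.fderiv
  rw [pd_eq, e]
  fin_cases i <;> simp [pdCoeff, pdCoeff', pdDir, pdDir']

theorem v (x : Spacetime) : HasPd (fun y => (y.2.2 : ℂ)) ![0, 0, 0, 1] x := by
  have hv : HasFDerivAt (fun y : Spacetime => y.2.2)
      ((ContinuousLinearMap.snd ℝ ℝ ℝ).comp (ContinuousLinearMap.snd ℝ ℂ (ℝ × ℝ))) x :=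
    hasFDerivAt_snd.comp x hasFDerivAt_snd
  have hc := (Complex.ofRealCLM.hasFDerivAt (x := x.2.2)).comp x hv
  refine ⟨hc.differentiableAt, fun i => ?_⟩
  have e : fderiv ℝ (fun y : Spacetime => (y.2.2 : ℂ)) x = _ := hc.fderiv
  rw [pd_eq, e]
  fin_cases i <;> simp [pdCoeff, pdCoeff', pdDir, pdDir']

end HasPd

/-- Conjugation exchanges ∂_ζ and ∂_ζ̄ and fixes the real derivations; on indices this is the
transposition of 0 and 1. -/
theorem HasPd.conj {φ : Spacetime → ℂ} {d : Fin 4 → ℂ} {x : Spacetime} (h : HasPd φ d x) :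
    HasPd (fun y => conj (φ y)) (fun i => conj (d (Equiv.swap 0 1 i))) x := by
  have hc := (Complex.conjCLE.toContinuousLinearMap.hasFDerivAt (x := φ x)).comp x h.1.hasFDerivAt
  refine ⟨hc.differentiableAt, fun i => ?_⟩
  have e : fderiv ℝ (fun y => (starRingEnd ℂ) (φ y)) x = _ := hc.fderiv
  simp only [← h.2]
  rw [pd_eq, pd_eq, e]
  fin_cases i <;>
    simp [pdCoeff, pdCoeff', pdDir, pdDir', Equiv.swap_apply_def, map_ofNat]

/-- No regularity is needed: φ and its conjugate fail to be differentiable at the same points, and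
there both derivatives take the default value zero. -/
theorem pd_conj (i : Fin 4) (φ : Spacetime → ℂ) (x : Spacetime) :
    pd i (fun y => conj (φ y)) x = conj (pd (Equiv.swap 0 1 i) φ x) := by
  by_cases h : DifferentiableAt ℝ φ x
  · exact (HasPd.conj ⟨h, fun _ => rfl⟩).2 i
  · have h' : ¬ DifferentiableAt ℝ (fun y => conj (φ y)) x := fun h' => h (by
      simpa using (HasPd.conj (φ := fun y => conj (φ y)) ⟨h', fun _ => rfl⟩).1)
    simp [pd_eq, fderiv_zero_of_not_differentiableAt h, fderiv_zero_of_not_differentiableAt h']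

/-! ### Functions with vanishing derivatives -/

/-- The restriction to the segment from y to x has zero derivative. Only the direction x - y enters,
so the lemma also serves functions that are constant in some directions only. -/
theorem eq_of_fderiv_segment {φ : Spacetime → ℂ} {p x y : Spacetime} {ε : ℝ}
    (hd : ∀ z ∈ Metric.ball p ε, DifferentiableAt ℝ φ z)
    (hx : x ∈ Metric.ball p ε) (hy : y ∈ Metric.ball p ε)
    (h0 : ∀ z ∈ Metric.ball p ε, fderiv ℝ φ z (x - y) = 0) : φ x = φ y := by
  have hmem : ∀ t ∈ Set.Icc (0 : ℝ) 1, y + t • (x - y) ∈ Metric.ball p ε := fun t ht =>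
    (convex_ball p ε).add_smul_sub_mem hy hx ht
  have hder : ∀ t ∈ Set.Icc (0 : ℝ) 1, HasDerivAt (fun t : ℝ => φ (y + t • (x - y))) 0 t := by
    intro t ht
    have h1 : HasDerivAt (fun t : ℝ => y + t • (x - y)) (x - y) t := by
      simpa using ((hasDerivAt_id t).smul_const (x - y)).const_add y
    have h2 := (hd _ (hmem t ht)).hasFDerivAt.comp_hasDerivAt t h1
    rwa [h0 _ (hmem t ht)] at h2
  have := constant_of_has_deriv_right_zero
    (fun t ht => (hder t ht).continuousAt.continuousWithinAt)
    (fun t ht => (hder t (Set.Ico_subset_Icc_self ht)).hasDerivWithinAt) 1 (by simp)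
  simpa using this

theorem fderiv_eq_sum (φ : Spacetime → ℂ) (x w : Spacetime) : fderiv ℝ φ x w =
    w.1 * pd 0 φ x + conj w.1 * pd 1 φ x + w.2.1 * pd 2 φ x + w.2.2 * pd 3 φ x := by
  have e : w = w.1.re • ((1, 0, 0) : Spacetime) + w.1.im • ((Complex.I, 0, 0) : Spacetime)
      + w.2.1 • ((0, 1, 0) : Spacetime) + w.2.2 • ((0, 0, 1) : Spacetime) := by
    ext <;> simp
  conv_lhs => rw [e]
  have h1 : conj w.1 = w.1.re - w.1.im * Complex.I := by
    apply Complex.ext <;> simp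
  rw [h1]
  conv_rhs => enter [1, 1, 1, 1]; rw [← Complex.re_add_im w.1]
  simp only [map_add, map_smul, pd, Complex.real_smul]
  linear_combination (w.1.im : ℂ) * fderiv ℝ φ x (Complex.I, 0, 0) * Complex.I_mul_I

/-- A smooth function with `∂_ζ = ∂_ζ̄ = ∂_v = 0` depends on `u` only. -/
theorem exists_eq_comp_u {φ : Spacetime → ℂ} {p : Spacetime} (h : SmoothNear φ p)
    (h0 : ∀ᶠ x in 𝓝 p, pd 0 φ x = 0 ∧ pd 1 φ x = 0 ∧ pd 3 φ x = 0) :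
    ∃ c : ℝ → ℂ, SmoothNear c p.2.1 ∧ ∀ᶠ x in 𝓝 p, φ x = c x.2.1 := by
  refine ⟨fun u => φ (p.1, u, p.2.2), ?_, ?_⟩
  · exact SmoothNear.comp (φ := fun u : ℝ => ((p.1, u, p.2.2) : Spacetime)) h
      (smoothNear_of_contDiff (by fun_prop) _)
  · obtain ⟨ε, hε, hb⟩ := Metric.eventually_nhds_iff_ball.1 (h.and h0)
    filter_upwards [Metric.ball_mem_nhds p hε] with x hx
    refine eq_of_fderiv_segment (p := p) (ε := ε)
      (fun z hz => (hb z hz).1.differentiableAt (by simp)) hx ?_ ?_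
    -- The product distance is a supremum, so replacing ζ and v by their values at p keeps the point
    -- in the ball.
    · simp only [Metric.mem_ball, Prod.dist_eq, sup_lt_iff] at hx ⊢
      exact ⟨by simpa using hε, hx.2.1, by simpa using hε⟩
    · intro z hz
      obtain ⟨-, e0, e1, e3⟩ := hb z hz
      rw [fderiv_eq_sum, e0, e1, e3]
      simp

theorem eventually_eq_const {φ : Spacetime → ℂ} {p : Spacetime} (h : SmoothNear φ p)
    (h0 : ∀ᶠ x in 𝓝 p, ∀ i, pd i φ x = 0) : ∀ᶠ x in 𝓝 p, φ x = φ p := by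
  obtain ⟨ε, hε, hb⟩ := Metric.eventually_nhds_iff_ball.1 (h.and h0)
  filter_upwards [Metric.ball_mem_nhds p hε] with x hx
  refine eq_of_fderiv_segment (p := p) (ε := ε)
    (fun z hz => (hb z hz).1.differentiableAt (by simp)) hx (Metric.mem_ball_self hε) ?_
  intro z hz
  rw [fderiv_eq_sum]
  simp [(hb z hz).2]

/-! ### Functions holomorphic in `ζ` and independent of `v` -/

/-- `φ` is smooth near `p`, with `∂_ζ̄ φ = ∂_v φ = 0`. -/
def Hol (φ : Spacetime → ℂ) (p : Spacetime) : Prop :=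
  SmoothNear φ p ∧ ∀ᶠ x in 𝓝 p, pd 1 φ x = 0 ∧ pd 3 φ x = 0

namespace Hol

variable {φ ψ : Spacetime → ℂ} {p : Spacetime}

theorem smooth (h : Hol φ p) : SmoothNear φ p := h.1

theorem eventually (h : Hol φ p) : ∀ᶠ x in 𝓝 p, Hol φ x := by
  filter_upwards [h.1.eventually, h.2.eventually_nhds] with x a b using ⟨a, b⟩

theorem pd_one (h : Hol φ p) : pd 1 φ p = 0 := h.2.self_of_nhds.1

theorem pd_three (h : Hol φ p) : pd 3 φ p = 0 := h.2.self_of_nhds.2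

theorem hasPd (h : Hol φ p) : HasPd φ ![PPWave.pd 0 φ p, 0, PPWave.pd 2 φ p, 0] p :=
  ⟨h.1.differentiableAt, fun i => by
    fin_cases i <;> simp [h.pd_one, h.pd_three]⟩

theorem hasPd_conj (h : Hol φ p) : HasPd (fun y => conj (φ y))
    ![0, conj (PPWave.pd 0 φ p), conj (PPWave.pd 2 φ p), 0] p :=
  ⟨h.1.conj.differentiableAt, fun i => by
    fin_cases i <;> simp [pd_conj, Equiv.swap_apply_def, h.pd_one, h.pd_three]⟩

theorem congr (h : Hol φ p) (e : φ =ᶠ[𝓝 p] ψ) : Hol ψ p := by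
  refine ⟨h.1.congr e, ?_⟩
  filter_upwards [h.2, e.eventually_nhds] with x hx ex
  rwa [← pd_congr 1 ex, ← pd_congr 3 ex]

theorem of_hasPd (h : SmoothNear φ p) (hd : ∀ᶠ x in 𝓝 p, ∃ a b, HasPd φ ![a, 0, b, 0] x) :
    Hol φ p := by
  refine ⟨h, ?_⟩
  filter_upwards [hd] with x ⟨a, b, hx⟩
  exact ⟨hx.2 1, hx.2 3⟩

theorem const (c : ℂ) (p : Spacetime) : Hol (fun _ => c) p :=
  ⟨SmoothNear.const _ _, Eventually.of_forall fun x => ⟨(HasPd.const c x).2 1, (HasPd.const c x).2 3⟩⟩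

theorem add (h : Hol φ p) (h' : Hol ψ p) : Hol (fun y => φ y + ψ y) p := by
  refine ⟨h.1.add h'.1, ?_⟩
  filter_upwards [h.eventually, h'.eventually] with x a b
  have := (a.hasPd.add b.hasPd).2
  exact ⟨by simpa using this 1, by simpa using this 3⟩

theorem neg (h : Hol φ p) : Hol (fun y => -φ y) p := by
  refine ⟨h.1.neg, ?_⟩
  filter_upwards [h.eventually] with x a
  have := a.hasPd.neg.2
  exact ⟨by simpa using this 1, by simpa using this 3⟩

theorem sub (h : Hol φ p) (h' : Hol ψ p) : Hol (fun y => φ y - ψ y) p := by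
  simpa only [sub_eq_add_neg] using h.add h'.neg

theorem mul (h : Hol φ p) (h' : Hol ψ p) : Hol (fun y => φ y * ψ y) p := by
  refine ⟨h.1.mul h'.1, ?_⟩
  filter_upwards [h.eventually, h'.eventually] with x a b
  have := (a.hasPd.mul b.hasPd).2
  exact ⟨by simpa using this 1, by simpa using this 3⟩

theorem comp_hol (h : Hol φ p) {g : ℂ → ℂ} (hg : AnalyticAt ℂ g (φ p)) :
    Hol (fun y => g (φ y)) p := by
  refine ⟨hg.smoothNear.comp h.1, ?_⟩
  filter_upwards [h.eventually, h.1.continuousAt.eventually hg.eventually_analyticAt] with x a b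
  have := (a.hasPd.comp_hol b.differentiableAt.hasDerivAt).2
  exact ⟨by simpa using this 1, by simpa using this 3⟩

theorem cexp (h : Hol φ p) : Hol (fun y => Complex.exp (φ y)) p :=
  h.comp_hol analyticAt_cexp

theorem inv (h : Hol φ p) (h0 : φ p ≠ 0) : Hol (fun y => (φ y)⁻¹) p :=
  h.comp_hol (analyticAt_inv h0)

theorem div (h : Hol φ p) (h' : Hol ψ p) (h0 : ψ p ≠ 0) : Hol (fun y => φ y / ψ y) p := by
  simpa only [div_eq_mul_inv] using h.mul (h'.inv h0)

/-- The coordinate derivations commute, and ∂_ζ̄φ and ∂_vφ vanish on a whole neighbourhood. -/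
theorem pd (h : Hol φ p) (i : Fin 4) : Hol (PPWave.pd i φ) p := by
  refine ⟨h.1.pd i, ?_⟩
  filter_upwards [h.eventually] with x a
  rw [pd_comm a.1 1 i, pd_comm a.1 3 i, pd_congr i (ψ := fun _ => 0) (a.2.mono fun _ h => h.1),
    pd_congr i (ψ := fun _ => 0) (a.2.mono fun _ h => h.2), (HasPd.const 0 x).2]
  simp

theorem fst (p : Spacetime) : Hol (fun y => y.1) p :=
  ⟨smoothNear_fst p, Eventually.of_forall fun x => ⟨(HasPd.fst x).2 1, (HasPd.fst x).2 3⟩⟩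

theorem comp_u {c : ℝ → ℂ} (h : SmoothNear c p.2.1) : Hol (fun y => c y.2.1) p := by
  refine ⟨h.comp_u, ?_⟩
  have : ContinuousAt (fun y : Spacetime => y.2.1) p := (smoothNear_u p).continuousAt
  filter_upwards [this.eventually h.eventually] with x hx
  have := (HasPd.comp_u (x := x) hx.differentiableAt.hasDerivAt).2
  exact ⟨this 1, this 3⟩

end Hol

theorem eventually_u {P : ℝ → Prop} {p : Spacetime} (h : ∀ᶠ u in 𝓝 p.2.1, P u) :
    ∀ᶠ x in 𝓝 p, P x.2.1 :=
  (smoothNear_u p).continuousAt.eventually h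

theorem eventually_of_eventually_u {P : ℝ → Prop} {p : Spacetime}
    (h : ∀ᶠ x in 𝓝 p, P x.2.1) : ∀ᶠ u in 𝓝 p.2.1, P u := by
  have hc : ContinuousAt (fun u : ℝ => ((p.1, u, p.2.2) : Spacetime)) p.2.1 := by fun_prop
  exact hc.eventually (p := fun x : Spacetime => P x.2.1) h

theorem Hol.exists_eq_comp_u {φ : Spacetime → ℂ} {p : Spacetime} (h : Hol φ p)
    (h0 : ∀ᶠ x in 𝓝 p, PPWave.pd 0 φ x = 0) :
    ∃ c : ℝ → ℂ, SmoothNear c p.2.1 ∧ ∀ᶠ x in 𝓝 p, φ x = c x.2.1 :=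
  PPWave.exists_eq_comp_u h.1 (h0.and h.2)

theorem Hol.eventually_eq_const {φ : Spacetime → ℂ} {p : Spacetime} (h : Hol φ p)
    (h0 : ∀ᶠ x in 𝓝 p, PPWave.pd 0 φ x = 0 ∧ PPWave.pd 2 φ x = 0) : ∀ᶠ x in 𝓝 p, φ x = φ p := by
  refine PPWave.eventually_eq_const h.1 ?_
  filter_upwards [h0, h.2] with x a b i
  fin_cases i
  exacts [a.1, b.1, a.2, b.2]

/-- The function `f(ζ, u)` regarded as a function on spacetime. -/
def lift (f : ℂ × ℝ → ℂ) (x : Spacetime) : ℂ := f (x.1, x.2.1)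

theorem smoothNear_lift {f : ℂ × ℝ → ℂ} {p : Spacetime} (h : SmoothNear f (p.1, p.2.1)) :
    SmoothNear (lift f) p :=
  SmoothNear.comp (φ := fun x : Spacetime => (x.1, x.2.1)) h
    ((smoothNear_fst p).prodMk (smoothNear_u p))

/-- Complex differentiability in ζ makes the real differential complex linear on the ζ-directions,
which is the Cauchy–Riemann equation ∂_ζ̄ = 0. -/
theorem hol_lift {f : ℂ × ℝ → ℂ} {p : Spacetime} (h : SmoothNear f (p.1, p.2.1))
    (hh : ∀ᶠ q in 𝓝 (p.1, p.2.1), DifferentiableAt ℂ (fun z : ℂ => f (z, q.2)) q.1) :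
    Hol (lift f) p := by
  refine ⟨smoothNear_lift h, ?_⟩
  have hc : ContinuousAt (fun x : Spacetime => (x.1, x.2.1)) p := by fun_prop
  filter_upwards [hc.eventually h, hc.eventually hh, smoothNear_lift h] with x hx hhx hl
  have hd : DifferentiableAt ℝ (lift f) x := hl.differentiableAt (by simp)
  constructor
  · have key : ∀ w : ℂ, fderiv ℝ (lift f) x (w, 0, 0) = w * deriv (fun z : ℂ => f (z, x.2.1)) x.1 := by
      intro w
      have h1 : HasFDerivAt (fun z : ℂ => ((z, x.2) : Spacetime))
        (ContinuousLinearMap.inl ℝ ℂ (ℝ × ℝ)) x.1 := hasFDerivAt_prodMk_left x.1 x.2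
      have h2 := HasFDerivAt.comp x.1 (g := lift f) hd.hasFDerivAt h1
      have h3 := hhx.hasDerivAt.hasFDerivAt.restrictScalars ℝ
      have := congrArg (fun L => L w) (h2.unique h3)
      simpa [Prod.mk_zero_zero] using this
    simp only [pd, key]
    linear_combination (deriv (fun z : ℂ => f (z, x.2.1)) x.1 / 2) * Complex.I_mul_I
  · have h1 : HasDerivAt (fun t : ℝ => ((x.1, x.2.1, t) : Spacetime)) ((0, 0, 1) : Spacetime) x.2.2 :=
      (hasDerivAt_const _ _).prodMk ((hasDerivAt_const _ _).prodMk (hasDerivAt_id _))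
    have h2 := HasFDerivAt.comp_hasDerivAt (l := lift f) x.2.2 hd.hasFDerivAt h1
    have h3 : HasDerivAt (lift f ∘ fun t : ℝ => ((x.1, x.2.1, t) : Spacetime)) 0 x.2.2 :=
      hasDerivAt_const x.2.2 (f (x.1, x.2.1))
    exact h2.unique h3

/-! ### The Levi-Civita connection and the curvature -/

/-- The function `f + f̄`. -/
noncomputable def profile (f : ℂ × ℝ → ℂ) (x : Spacetime) : ℂ := lift f x + conj (lift f x)

theorem pd_const (i : Fin 4) (c : ℂ) (x : Spacetime) : pd i (fun _ => c) x = 0 :=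
  (HasPd.const c x).2 i

theorem pd_neg (i : Fin 4) (φ : Spacetime → ℂ) (x : Spacetime) :
    pd i (fun y => -φ y) x = -pd i φ x := by
  rw [pd_eq, pd_eq, fderiv_fun_neg]
  simp
  ring

theorem pd_metric (f : ℂ × ℝ → ℂ) (i j k : Fin 4) (x : Spacetime) :
    pd i (fun y => metric f y j k) x = if j = 2 ∧ k = 2 then -pd i (profile f) x else 0 := by
  have h : (fun y => metric f y 2 2) = fun y => -profile f y := by
    funext y
    simp [metric, profile, lift]
  by_cases hjk : j = 2 ∧ k = 2
  · rw [if_pos hjk, hjk.1, hjk.2, h, pd_neg]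
  · rw [if_neg hjk, ← pd_const i (metric f x j k) x]
    congr 1
    funext y
    fin_cases j <;> fin_cases k <;> simp_all [metric]

theorem metric_inv (f : ℂ × ℝ → ℂ) (x : Spacetime) : (metric f x)⁻¹ =
    !![0, 1, 0, 0; 1, 0, 0, 0; 0, 0, 0, -1; 0, 0, -1, profile f x] := by
  apply Matrix.inv_eq_right_inv
  ext i j
  fin_cases i <;> fin_cases j <;>
    simp [metric, Matrix.mul_apply, Fin.sum_univ_four, profile, lift]

theorem christoffel_zero (f : ℂ × ℝ → ℂ) (i j : Fin 4) (x : Spacetime) :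
    christoffel f 0 i j x = if i = 2 ∧ j = 2 then pd 1 (profile f) x / 2 else 0 := by
  simp only [christoffel, metric_inv, pd_metric, Fin.sum_univ_four]
  fin_cases i <;> fin_cases j <;> simp <;> ring

theorem christoffel_one (f : ℂ × ℝ → ℂ) (i j : Fin 4) (x : Spacetime) :
    christoffel f 1 i j x = if i = 2 ∧ j = 2 then pd 0 (profile f) x / 2 else 0 := by
  simp only [christoffel, metric_inv, pd_metric, Fin.sum_univ_four]
  fin_cases i <;> fin_cases j <;> simp <;> ring

theorem christoffel_two {f : ℂ × ℝ → ℂ} {x : Spacetime} (h : pd 3 (profile f) x = 0)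
    (i j : Fin 4) : christoffel f 2 i j x = 0 := by
  simp only [christoffel, metric_inv, pd_metric, Fin.sum_univ_four]
  fin_cases i <;> fin_cases j <;> simp [h]

theorem christoffel_three_three {f : ℂ × ℝ → ℂ} {x : Spacetime} (h : pd 3 (profile f) x = 0)
    (i : Fin 4) : christoffel f 3 i 3 x = 0 := by
  simp only [christoffel, metric_inv, pd_metric, Fin.sum_univ_four]
  fin_cases i <;> simp [h]

theorem nabla_zero (f : ℂ × ℝ → ℂ) (Z Y : VectorField) (x : Spacetime) : nabla f Z Y x 0 =
    Z.app (fun y => Y y 0) x + Z x 2 * Y x 2 * pd 1 (profile f) x / 2 := by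
  simp [nabla, VectorField.app, christoffel_zero, Fin.sum_univ_four]
  ring

theorem nabla_one (f : ℂ × ℝ → ℂ) (Z Y : VectorField) (x : Spacetime) : nabla f Z Y x 1 =
    Z.app (fun y => Y y 1) x + Z x 2 * Y x 2 * pd 0 (profile f) x / 2 := by
  simp [nabla, VectorField.app, christoffel_one, Fin.sum_univ_four]
  ring

theorem nabla_two {f : ℂ × ℝ → ℂ} {x : Spacetime} (h : pd 3 (profile f) x = 0)
    (Z Y : VectorField) : nabla f Z Y x 2 = Z.app (fun y => Y y 2) x := by
  simp [nabla, VectorField.app, christoffel_two h, Fin.sum_univ_four]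

/-- For a multiple of ∂_v, such as D, all Christoffel terms drop out. No other covariant derivative
is needed in this component. -/
theorem nabla_three {f : ℂ × ℝ → ℂ} {x : Spacetime} (h : pd 3 (profile f) x = 0)
    (Z Y : VectorField) (h0 : Y x 0 = 0) (h1 : Y x 1 = 0) (h2 : Y x 2 = 0) :
    nabla f Z Y x 3 = Z.app (fun y => Y y 3) x := by
  simp [nabla, VectorField.app, christoffel_three_three h, Fin.sum_univ_four, h0, h1, h2]

theorem app_congr (Z : VectorField) {φ ψ : Spacetime → ℂ} {x : Spacetime} (h : φ =ᶠ[𝓝 x] ψ) :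
    Z.app φ x = Z.app ψ x := by
  simp only [VectorField.app, pd_congr _ h]

theorem app_const (Z : VectorField) (c : ℂ) (x : Spacetime) : Z.app (fun _ => c) x = 0 := by
  simp [VectorField.app, pd_const]

theorem app_of_hasPd (Z : VectorField) {φ : Spacetime → ℂ} {d : Fin 4 → ℂ} {x : Spacetime}
    (h : HasPd φ d x) : Z.app φ x = Z x 0 * d 0 + Z x 1 * d 1 + Z x 2 * d 2 + Z x 3 * d 3 := by
  simp [VectorField.app, Fin.sum_univ_four, h.2]

theorem ip_eq (f : ℂ × ℝ → ℂ) (X Y : VectorField) (x : Spacetime) : ip f X Y x =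
    X x 0 * Y x 1 + X x 1 * Y x 0 - profile f x * X x 2 * Y x 2 - X x 2 * Y x 3 - X x 3 * Y x 2 := by
  simp [ip, metric, Fin.sum_univ_four, profile, lift]
  ring

theorem lower_eq (f : ℂ × ℝ → ℂ) (X : VectorField) (x : Spacetime) : lower f X x =
    ![X x 1, X x 0, -profile f x * X x 2 - X x 3, -X x 2] := by
  funext i
  fin_cases i <;> simp [lower, metric, Fin.sum_univ_four, profile, lift]
  ring

/-! ### Curvature components -/

section Riemann

variable {f : ℂ × ℝ → ℂ} {x : Spacetime}

/-- The quadratic terms vanish: a nonzero first factor forces the summation index to be u, and the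
Christoffel symbols with upper index u are zero. -/
theorem riemann_zero (h : ∀ᶠ y in 𝓝 x, pd 3 (profile f) y = 0) (b c d : Fin 4) :
    riemann f 0 b c d x = (if d = 2 ∧ b = 2 then pd c (fun y => pd 1 (profile f) y / 2) x else 0)
      - if c = 2 ∧ b = 2 then pd d (fun y => pd 1 (profile f) y / 2) x else 0 := by
  have e : ∀ i j, christoffel f 0 i j =
      if i = 2 ∧ j = 2 then fun y => pd 1 (profile f) y / 2 else fun _ => 0 := fun i j => by
    funext y
    rw [christoffel_zero]
    split_ifs <;> rfl
  have z : ∀ i j, christoffel f 2 i j x = 0 := christoffel_two h.self_of_nhds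
  simp only [riemann, Fin.sum_univ_four, e, z]
  fin_cases b <;> fin_cases c <;> fin_cases d <;> simp [pd_const]

theorem riemann_one (h : ∀ᶠ y in 𝓝 x, pd 3 (profile f) y = 0) (b c d : Fin 4) :
    riemann f 1 b c d x = (if d = 2 ∧ b = 2 then pd c (fun y => pd 0 (profile f) y / 2) x else 0)
      - if c = 2 ∧ b = 2 then pd d (fun y => pd 0 (profile f) y / 2) x else 0 := by
  have e : ∀ i j, christoffel f 1 i j =
      if i = 2 ∧ j = 2 then fun y => pd 0 (profile f) y / 2 else fun _ => 0 := fun i j => by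
    funext y
    rw [christoffel_one]
    split_ifs <;> rfl
  have z : ∀ i j, christoffel f 2 i j x = 0 := christoffel_two h.self_of_nhds
  simp only [riemann, Fin.sum_univ_four, e, z]
  fin_cases b <;> fin_cases c <;> fin_cases d <;> simp [pd_const]

theorem riemann_two (h : ∀ᶠ y in 𝓝 x, pd 3 (profile f) y = 0) (b c d : Fin 4) :
    riemann f 2 b c d x = 0 := by
  have e : ∀ i j, christoffel f 2 i j =ᶠ[𝓝 x] fun _ => 0 := fun i j => by
    filter_upwards [h] with y hy using christoffel_two hy i j
  have z : ∀ i j, christoffel f 2 i j x = 0 := christoffel_two h.self_of_nhds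
  simp only [riemann, Fin.sum_univ_four, pd_congr _ (e _ _), pd_const, z]
  simp

/-- In the first slot the u-term is multiplied by X^u = 0, and the v-term lowers to the vanishing
component with upper index u. Hence the Christoffel symbols with upper index v never have to be
differentiated. -/
theorem riemannLow_eq (h : ∀ᶠ y in 𝓝 x, pd 3 (profile f) y = 0) (X Y : VectorField)
    (hX : X x 2 = 0) : riemannLow f X Y X Y x = Y x 2 ^ 2 *
      (X x 0 * X.app (fun y => pd 0 (profile f) y / 2) x
        + X x 1 * X.app (fun y => pd 1 (profile f) y / 2) x) := by
  have e : ∀ a b c d, (∑ l, metric f x a l * riemann f l b c d x) * X x a =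
      (if a = 0 then riemann f 1 b c d x * X x 0 else 0)
        + if a = 1 then riemann f 0 b c d x * X x 1 else 0 := by
    intro a b c d
    fin_cases a <;> simp [Fin.sum_univ_four, metric, hX, riemann_two h]
  simp only [riemannLow, e]
  simp only [riemann_zero h, riemann_one h, VectorField.app, Fin.sum_univ_four]
  simp [hX]
  ring

end Riemann

/-! ### Complex conjugation -/

theorem VectorField.bar_apply (X : VectorField) (x : Spacetime) (i : Fin 4) :
    X.bar x i = conj (X x (Equiv.swap 0 1 i)) := by
  fin_cases i <;> simp [VectorField.bar, Equiv.swap_apply_def]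

theorem VectorField.bar_bar (X : VectorField) : X.bar.bar = X := by
  funext x i
  simp [VectorField.bar_apply]

theorem metric_conj (f : ℂ × ℝ → ℂ) (x : Spacetime) (i j : Fin 4) :
    conj (metric f x i j) = metric f x (Equiv.swap 0 1 i) (Equiv.swap 0 1 j) := by
  fin_cases i <;> fin_cases j <;> simp [metric, Equiv.swap_apply_def]
  ring

theorem metric_inv_conj (f : ℂ × ℝ → ℂ) (x : Spacetime) (i j : Fin 4) :
    conj ((metric f x)⁻¹ i j) = (metric f x)⁻¹ (Equiv.swap 0 1 i) (Equiv.swap 0 1 j) := by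
  rw [metric_inv]
  fin_cases i <;> fin_cases j <;> simp [profile, Equiv.swap_apply_def]
  ring

theorem pd_metric_conj (f : ℂ × ℝ → ℂ) (x : Spacetime) (i j k : Fin 4) :
    conj (pd i (fun y => metric f y j k) x) = pd (Equiv.swap 0 1 i)
      (fun y => metric f y (Equiv.swap 0 1 j) (Equiv.swap 0 1 k)) x := by
  simp only [← metric_conj, pd_conj, Equiv.swap_apply_self]

theorem christoffel_conj (f : ℂ × ℝ → ℂ) (k i j : Fin 4) (x : Spacetime) :
    conj (christoffel f k i j x) = christoffel f (Equiv.swap 0 1 k) (Equiv.swap 0 1 i)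
      (Equiv.swap 0 1 j) x := by
  simp only [christoffel, map_mul, map_sum, map_sub, map_add, pd_metric_conj, metric_inv_conj,
    map_div₀, map_one, map_ofNat]
  rw [← Equiv.sum_comp (Equiv.swap 0 1)]
  simp only [Equiv.swap_apply_self]

theorem ip_conj (f : ℂ × ℝ → ℂ) (X Y : VectorField) (x : Spacetime) :
    conj (ip f X Y x) = ip f X.bar Y.bar x := by
  simp [ip_eq, VectorField.bar, profile]
  try ring

theorem app_conj (X : VectorField) (φ : Spacetime → ℂ) (x : Spacetime) :
    conj (X.app φ x) = X.bar.app (fun y => conj (φ y)) x := by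
  simp only [VectorField.app, map_sum, map_mul, VectorField.bar_apply, pd_conj]
  rw [← Equiv.sum_comp (Equiv.swap 0 1)]

/-- The connection is real: exchanging the indices 0 and 1 conjugates the Christoffel symbols, and
the sums are reindexed by this exchange. -/
theorem nabla_bar (f : ℂ × ℝ → ℂ) (Z Y : VectorField) :
    (nabla f Z Y).bar = nabla f Z.bar Y.bar := by
  funext x k
  rw [VectorField.bar_apply]
  simp only [nabla, map_sum, map_mul, map_add, christoffel_conj, VectorField.bar_apply, pd_conj,
    Equiv.swap_apply_self]
  rw [← Equiv.sum_comp (Equiv.swap 0 1)]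
  simp only [Equiv.swap_apply_self]
  refine Finset.sum_congr rfl fun i _ => ?_
  congr 2
  rw [← Equiv.sum_comp (Equiv.swap 0 1)]
  simp only [Equiv.swap_apply_self]

theorem conn_conj (f : ℂ × ℝ → ℂ) (a b Z : VectorField) (x : Spacetime) :
    conj (conn f a b Z x) = conn f a.bar b.bar Z.bar x := by
  rw [conn, ip_conj, nabla_bar, conn]

theorem lieCovector_conj (V : VectorField) (θ : Spacetime → Fin 4 → ℂ) (x : Spacetime)
    (i : Fin 4) : conj (lieCovector V θ x i) =
      lieCovector V.bar (fun y i => conj (θ y (Equiv.swap 0 1 i))) x (Equiv.swap 0 1 i) := by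
  simp only [lieCovector, map_sum, map_add, map_mul, VectorField.bar_apply, pd_conj,
    Equiv.swap_apply_self]
  rw [← Equiv.sum_comp (Equiv.swap 0 1)]

/-- The tetrad with `δ` and `δ*` interchanged. -/
noncomputable def Tetrad.flip (T : Tetrad) : Tetrad := ⟨T.m.bar, T.n, T.l⟩

/-! ### The second derivative of the profile -/

section Profile

variable {f : ℂ × ℝ → ℂ} {p : Spacetime}

theorem hasPd_profile (hf : Hol (lift f) p) : HasPd (profile f)
    ![pd 0 (lift f) p, conj (pd 0 (lift f) p), pd 2 (lift f) p + conj (pd 2 (lift f) p), 0] p := by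
  have := hf.hasPd.add hf.hasPd_conj
  refine ⟨this.1, fun i => (this.2 i).trans ?_⟩
  fin_cases i <;> simp

theorem eventually_pd_profile (hf : Hol (lift f) p) :
    ∀ᶠ x in 𝓝 p, pd 3 (profile f) x = 0 ∧ pd 0 (profile f) x = pd 0 (lift f) x ∧
      pd 1 (profile f) x = conj (pd 0 (lift f) x) := by
  filter_upwards [hf.eventually] with x hx
  have := (hasPd_profile hx).2
  exact ⟨this 3, this 0, this 1⟩

/-- The second derivative `∂_ζ² f`. -/
noncomputable def hess (f : ℂ × ℝ → ℂ) : Spacetime → ℂ := pd 0 (pd 0 (lift f))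

theorem hol_hess (hf : Hol (lift f) p) : Hol (hess f) p := (hf.pd 0).pd 0

/-- The mixed derivative ∂_ζ∂_ζ̄(f + f̄) vanishes, so only the two pure second derivatives survive.
-/
theorem riemannLow_eq_hess (hf : Hol (lift f) p) (X Y : VectorField) (hX : X p 2 = 0) :
    riemannLow f X Y X Y p =
      Y p 2 ^ 2 * (X p 0 ^ 2 * hess f p + X p 1 ^ 2 * conj (hess f p)) / 2 := by
  have h := eventually_pd_profile hf
  rw [riemannLow_eq (h.mono fun _ h => h.1) X Y hX]
  have e0 : HasPd (fun y => pd 0 (profile f) y / 2) _ p :=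
    (((hf.pd 0).hasPd.mul (HasPd.const (1 / 2) p))).congr <| by
      filter_upwards [h] with x hx
      rw [hx.2.1]; ring
  have e1 : HasPd (fun y => pd 1 (profile f) y / 2) _ p :=
    (((hf.pd 0).hasPd_conj.mul (HasPd.const (1 / 2) p))).congr <| by
      filter_upwards [h] with x hx
      rw [hx.2.2]; ring
  rw [app_of_hasPd X e0, app_of_hasPd X e1, hX]
  simp [hess]
  ring

end Profile

/-! ### Invariants of a function holomorphic in `ζ` -/

/-- The quotient `φ / ∂_ζ φ`. -/
noncomputable def ratio (φ : Spacetime → ℂ) (x : Spacetime) : ℂ := φ x / pd 0 φ x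

/-- The function `q` for which `∂_u + q ∂_ζ` annihilates `φ`. -/
noncomputable def slope (φ : Spacetime → ℂ) (x : Spacetime) : ℂ := -(pd 2 φ x / pd 0 φ x)

/-- The derivative `∂_ζ q`. -/
noncomputable def shear (φ : Spacetime → ℂ) : Spacetime → ℂ := pd 0 (slope φ)

/-- The expression of the invariant `A` by `φ`. -/
noncomputable def modulus (φ : Spacetime → ℂ) (x : Spacetime) : ℂ :=
  4 * (φ x * pd 0 (pd 0 φ) x / pd 0 φ x ^ 2) - 5

/-- The derivation `∂_u + q ∂_ζ`. -/
noncomputable def flow (φ h : Spacetime → ℂ) (x : Spacetime) : ℂ := pd 2 h x + slope φ x * pd 0 h x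

/-- `φ` is holomorphic in `ζ`, and `φ` and `∂_ζ φ` do not vanish at `p`. -/
structure Regular (φ : Spacetime → ℂ) (p : Spacetime) : Prop where
  hol : Hol φ p
  ne : φ p ≠ 0
  ne' : pd 0 φ p ≠ 0

namespace Regular

variable {φ : Spacetime → ℂ} {p : Spacetime}

theorem eventually (h : Regular φ p) : ∀ᶠ x in 𝓝 p, Regular φ x := by
  filter_upwards [h.hol.eventually, h.hol.smooth.continuousAt.eventually_ne h.ne,
    (h.hol.pd 0).smooth.continuousAt.eventually_ne h.ne'] with x a b c using ⟨a, b, c⟩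

theorem hol_ratio (h : Regular φ p) : Hol (ratio φ) p := h.hol.div (h.hol.pd 0) h.ne'

theorem hol_slope (h : Regular φ p) : Hol (slope φ) p := ((h.hol.pd 2).div (h.hol.pd 0) h.ne').neg

theorem hol_shear (h : Regular φ p) : Hol (shear φ) p := h.hol_slope.pd 0

theorem hol_modulus (h : Regular φ p) : Hol (modulus φ) p := by
  have := (((Hol.const 4 p).mul ((h.hol.mul ((h.hol.pd 0).pd 0)).div
    ((h.hol.pd 0).mul (h.hol.pd 0)) (mul_ne_zero h.ne' h.ne')))).sub (Hol.const 5 p)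
  simp only [← sq] at this
  exact this

theorem hol_flow (h : Regular φ p) {g : Spacetime → ℂ} (hg : Hol g p) : Hol (flow φ g) p :=
  (hg.pd 2).add (h.hol_slope.mul (hg.pd 0))

theorem pd_ratio (h : Regular φ p) (i : Fin 4) : pd i (ratio φ) p =
    (pd i φ p * pd 0 φ p - φ p * pd i (pd 0 φ) p) / pd 0 φ p ^ 2 :=
  ((h.hol.1.hasPd).div (h.hol.1.pd 0).hasPd h.ne').2 i

theorem shear_eq (h : Regular φ p) : shear φ p =
    -((pd 0 (pd 2 φ) p * pd 0 φ p - pd 2 φ p * pd 0 (pd 0 φ) p) / pd 0 φ p ^ 2) :=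
  ((((h.hol.1.pd 2).hasPd).div (h.hol.1.pd 0).hasPd h.ne').neg).2 0

/-- In this form, constancy of A is an equation for φ/φ_ζ that can be integrated. -/
theorem modulus_eq (h : Regular φ p) : modulus φ p = -1 - 4 * pd 0 (ratio φ) p := by
  rw [h.pd_ratio, modulus]
  have := h.ne'
  field_simp
  ring

/-- The derivation L = ∂_u + q∂_ζ kills φ and satisfies [L, ∂_ζ] = -q_ζ∂_ζ. Hence Lφ_ζ = -q_ζφ_ζ,
and the quotient φ/φ_ζ is multiplied by q_ζ. This is the one differential identity that links A and
M. -/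
theorem flow_ratio (h : Regular φ p) : flow φ (ratio φ) p = shear φ p * ratio φ p := by
  have := h.ne'
  rw [flow, h.pd_ratio, h.pd_ratio, h.shear_eq, slope, ratio, pd_comm h.hol.1 2 0]
  field_simp
  ring

end Regular

/-! ### Null tetrads adapted to `∂_v` -/

/-- The algebraic relations at `x` of a null tetrad with `D ∝ ∂_v` for which `δ` has no component
along `∂_ζ`. -/
structure Oriented (T : Tetrad) (x : Spacetime) : Prop where
  m0 : T.m x 0 = 0
  m2 : T.m x 2 = 0
  l0 : T.l x 0 = 0
  l1 : T.l x 1 = 0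
  l2 : T.l x 2 = 0
  unit : T.m x 1 * conj (T.m x 1) = 1
  n1 : T.n x 1 = conj (T.n x 0)
  n_real : conj (T.n x 2) = T.n x 2
  l_real : conj (T.l x 3) = T.l x 3
  nl : T.n x 2 * T.l x 3 = 1
  mn : T.m x 1 * T.n x 0 = T.n x 2 * T.m x 3

namespace Oriented

variable {T : Tetrad} {x : Spacetime}

theorem m1_ne (h : Oriented T x) : T.m x 1 ≠ 0 := left_ne_zero_of_mul_eq_one h.unit

theorem n2_ne (h : Oriented T x) : T.n x 2 ≠ 0 := left_ne_zero_of_mul_eq_one h.nl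

end Oriented

/-- The Christoffel terms carry the ∂_u-component of δ*, which is zero; what remains is the
variation of the phase of δ. -/
theorem conn_m_eq {f : ℂ × ℝ → ℂ} {T : Tetrad} {x : Spacetime} (hp : pd 3 (profile f) x = 0)
    (ho : ∀ᶠ y in 𝓝 x, Oriented T y) (Z : VectorField) :
    conn f T.m T.m.bar Z x = T.m x 1 * Z.app (fun y => conj (T.m y 1)) x := by
  have h := ho.self_of_nhds
  have e2 : Z.app (fun y => T.m.bar y 2) x = 0 := by
    rw [app_congr Z (ψ := fun _ => 0), app_const]
    filter_upwards [ho] with y hy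
    simp [VectorField.bar, hy.m2]
  rw [conn, ip_eq, nabla_zero, nabla_two hp, e2, h.m0, h.m2]
  simp [VectorField.bar, h.m2]

theorem conn_n_eq {f : ℂ × ℝ → ℂ} {T : Tetrad} {x : Spacetime} (hp : pd 3 (profile f) x = 0)
    (ho : ∀ᶠ y in 𝓝 x, Oriented T y) (Z : VectorField) :
    conn f T.n T.l Z x = -(T.n x 2 * Z.app (fun y => T.l y 3) x) := by
  have h := ho.self_of_nhds
  have e0 : Z.app (fun y => T.l y 0) x = 0 := by
    rw [app_congr Z (ψ := fun _ => 0), app_const]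
    filter_upwards [ho] with y hy using hy.l0
  have e1 : Z.app (fun y => T.l y 1) x = 0 := by
    rw [app_congr Z (ψ := fun _ => 0), app_const]
    filter_upwards [ho] with y hy using hy.l1
  have e2 : Z.app (fun y => T.l y 2) x = 0 := by
    rw [app_congr Z (ψ := fun _ => 0), app_const]
    filter_upwards [ho] with y hy using hy.l2
  rw [conn, ip_eq, nabla_zero, nabla_one, nabla_two hp, nabla_three hp _ _ h.l0 h.l1 h.l2, e0, e1,
    e2, h.l2]
  ring

theorem mu_eq {f : ℂ × ℝ → ℂ} {T : Tetrad} {x : Spacetime} (hp : pd 3 (profile f) x = 0)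
    (ho : ∀ᶠ y in 𝓝 x, Oriented T y) :
    mu f T x = conj (T.m x 1) * T.m.app (fun y => conj (T.n y 0)) x
      - conj (T.m x 3) * T.m.app (fun y => T.n y 2) x := by
  have h := ho.self_of_nhds
  have e1 : T.m.app (fun y => T.n y 1) x = T.m.app (fun y => conj (T.n y 0)) x := by
    apply app_congr
    filter_upwards [ho] with y hy using hy.n1
  rw [mu, conn, ip_eq, nabla_one, nabla_two hp, e1, h.m2]
  simp [VectorField.bar, h.m0, h.m2]

theorem psi4_eq {f : ℂ × ℝ → ℂ} {T : Tetrad} {x : Spacetime} (hf : Hol (lift f) x)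
    (h : Oriented T x) :
    psi4 f T x = T.n x 2 ^ 2 * conj (T.m x 1) ^ 2 * hess f x / 2 := by
  rw [psi4, riemannLow_eq_hess hf _ _ (by simp [VectorField.bar, h.m2])]
  simp [VectorField.bar, h.m0]
  ring

/-- The derivatives of the components of a tetrad with `Ψ₄ = 1`. -/
theorem hasPd_components {φ N P : Spacetime → ℂ} {x : Spacetime} (hφ : Hol φ x)
    (hN : SmoothNear N x) (hP : SmoothNear P x) (hφ0 : φ x ≠ 0)
    (hNr : ∀ᶠ y in 𝓝 x, conj (N y) = N y) (hPu : ∀ᶠ y in 𝓝 x, P y * conj (P y) = 1)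
    (hK : ∀ᶠ y in 𝓝 x, N y ^ 2 * conj (P y) ^ 2 * φ y = 2) :
    HasPd (fun y => conj (P y)) ![-conj (P x) * (pd 0 φ x / φ x) / 4,
      conj (P x) * conj (pd 0 φ x / φ x) / 4,
      conj (P x) * (conj (pd 2 φ x / φ x) - pd 2 φ x / φ x) / 4, 0] x ∧
    HasPd N ![-N x * (pd 0 φ x / φ x) / 4, -N x * conj (pd 0 φ x / φ x) / 4,
      -N x * (conj (pd 2 φ x / φ x) + pd 2 φ x / φ x) / 4, 0] x := by
  have dN := hN.hasPd
  have dP := hP.hasPd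
  have dPc := hP.conj.hasPd
  have dφ := hφ.hasPd
  have dφc := hφ.hasPd_conj
  have hK0 := hK.self_of_nhds
  have hu := hPu.self_of_nhds
  have hN0 : N x ≠ 0 := by
    intro h
    simp [h] at hK0
  have hP0 : P x ≠ 0 := left_ne_zero_of_mul_eq_one hu
  have hPc0 : conj (P x) ≠ 0 := right_ne_zero_of_mul_eq_one hu
  have hφc0 : conj (φ x) ≠ 0 := by simpa using hφ0
  -- Differentiating N²P̄²φ = 2, its conjugate and PP̄ = 1 gives, after elimination of ∂P, two
  -- linear equations `f1` and `f2` for ∂N and ∂P̄. Their combinations isolate the two unknowns;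
  -- denominators are cleared.
  have key : ∀ i, 4 * (P x * pd i (fun y => conj (P y)) x) * (φ x * conj (φ x)) =
        ![0, conj (pd 0 φ x), conj (pd 2 φ x), 0] i * φ x
          - ![pd 0 φ x, 0, pd 2 φ x, 0] i * conj (φ x) ∧
      4 * pd i N x * (φ x * conj (φ x)) =
        -N x * (![0, conj (pd 0 φ x), conj (pd 2 φ x), 0] i * φ x
          + ![pd 0 φ x, 0, pd 2 φ x, 0] i * conj (φ x)) := by
    intro i
    have h1 : HasPd (fun y => N y * N y * (conj (P y) * conj (P y)) * φ y) _ x :=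
      ((dN.mul dN).mul (dPc.mul dPc)).mul dφ
    have h2 : HasPd (fun y => N y * N y * (P y * P y) * conj (φ y)) _ x :=
      ((dN.mul dN).mul (dP.mul dP)).mul dφc
    have h3 := dP.mul dPc
    have e1 := (h1.2 i).symm.trans ((pd_congr i (ψ := fun _ => 2) (by
      filter_upwards [hK] with y hy
      linear_combination hy)).trans (pd_const i 2 x))
    have e2 := (h2.2 i).symm.trans ((pd_congr i (ψ := fun _ => 2) (by
      filter_upwards [hK, hNr] with y hy hy'
      have := congrArg (starRingEnd ℂ) hy
      simp only [map_mul, map_pow, Complex.conj_conj, hy', map_ofNat] at this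
      linear_combination this)).trans (pd_const i 2 x))
    have e3 := (h3.2 i).symm.trans ((pd_congr i (ψ := fun _ => 1) hPu).trans (pd_const i 1 x))
    simp only at e1 e2 e3
    generalize ![0, conj (pd 0 φ x), conj (pd 2 φ x), 0] i = d at e2 ⊢
    generalize ![pd 0 φ x, 0, pd 2 φ x, 0] i = c at e1 ⊢
    generalize pd i (fun y => conj (P y)) x = b at *
    generalize pd i P x = e at *
    generalize pd i N x = a at *
    have f1 : 2 * a * φ x + 2 * N x * P x * b * φ x + N x * c = 0 := by
      refine (mul_eq_zero.1 (?_ : (N x * conj (P x) ^ 2) * _ = 0)).resolve_left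
        (mul_ne_zero hN0 (pow_ne_zero 2 hPc0))
      linear_combination e1 + 2 * N x ^ 2 * conj (P x) * b * φ x * hu
    have f2 : 2 * a * conj (φ x) - 2 * N x * P x * b * conj (φ x) + N x * d = 0 := by
      refine (mul_eq_zero.1 (?_ : (N x * P x ^ 2) * _ = 0)).resolve_left
        (mul_ne_zero hN0 (pow_ne_zero 2 hP0))
      linear_combination e2 - 2 * N x ^ 2 * P x ^ 2 * conj (φ x) * e3
        + 2 * N x ^ 2 * P x * conj (φ x) * e * hu
    constructor
    · refine mul_left_cancel₀ hN0 ?_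
      linear_combination conj (φ x) * f1 - φ x * f2
    · linear_combination conj (φ x) * f1 + φ x * f2
  refine ⟨⟨dPc.1, fun i => ?_⟩, ⟨dN.1, fun i => ?_⟩⟩
  · have h := (key i).1
    have hb : pd i (fun y => conj (P y)) x = conj (P x) *
        (![0, conj (pd 0 φ x), conj (pd 2 φ x), 0] i * φ x
          - ![pd 0 φ x, 0, pd 2 φ x, 0] i * conj (φ x)) / (4 * (φ x * conj (φ x))) := by
      rw [← h]
      field_simp
      linear_combination (-pd i (fun y => conj (P y)) x) * hu
    rw [hb]
    fin_cases i <;> simp <;> field_simp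
  · have h := (key i).2
    have hb : pd i N x = -N x *
        (![0, conj (pd 0 φ x), conj (pd 2 φ x), 0] i * φ x
          + ![pd 0 φ x, 0, pd 2 φ x, 0] i * conj (φ x)) / (4 * (φ x * conj (φ x))) := by
      rw [← h]
      field_simp
    rw [hb]
    fin_cases i <;> simp <;> field_simp

/-- A smooth null tetrad adapted to `∂_v`, with `Ψ₄ = 1`, `γ = 0` and `α ≠ 0`, for which `δ` has no
component along `∂_ζ`; the conditions are expressed by `φ = ∂_ζ² f`. -/
structure Adapted (f : ℂ × ℝ → ℂ) (T : Tetrad) (p : Spacetime) : Prop where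
  hol : Hol (lift f) p
  smooth_m : SmoothNear T.m p
  smooth_n : SmoothNear T.n p
  smooth_l : SmoothNear T.l p
  oriented : ∀ᶠ x in 𝓝 p, Oriented T x
  psi : ∀ᶠ x in 𝓝 p, T.n x 2 ^ 2 * conj (T.m x 1) ^ 2 * hess f x = 2
  n0 : ∀ᶠ x in 𝓝 p, T.n x 0 = T.n x 2 * slope (hess f) x
  regular : Regular (hess f) p

namespace Adapted

variable {f : ℂ × ℝ → ℂ} {T : Tetrad} {p : Spacetime}

theorem eventually (h : Adapted f T p) : ∀ᶠ x in 𝓝 p, Adapted f T x := by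
  filter_upwards [h.hol.eventually, h.smooth_m.eventually, h.smooth_n.eventually,
    h.smooth_l.eventually, h.oriented.eventually_nhds, h.psi.eventually_nhds,
    h.n0.eventually_nhds, h.regular.eventually] with x a b c d e g i j
  exact ⟨a, b, c, d, e, g, i, j⟩

end Adapted

/-! ### Spin coefficients of an adapted tetrad -/

section Components

variable {f : ℂ × ℝ → ℂ} {T : Tetrad} {p : Spacetime}

/-- Derivatives of the components, before the normalization `γ = 0`. -/
theorem hasPd_tetrad (hf : Hol (lift f) p) (hm : SmoothNear T.m p) (hn : SmoothNear T.n p)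
    (ho : ∀ᶠ x in 𝓝 p, Oriented T x)
    (hpsi : ∀ᶠ x in 𝓝 p, T.n x 2 ^ 2 * conj (T.m x 1) ^ 2 * hess f x = 2) :
    HasPd (fun y => conj (T.m y 1)) ![-conj (T.m p 1) * (pd 0 (hess f) p / hess f p) / 4,
      conj (T.m p 1) * conj (pd 0 (hess f) p / hess f p) / 4,
      conj (T.m p 1) * (conj (pd 2 (hess f) p / hess f p) - pd 2 (hess f) p / hess f p) / 4, 0] p ∧
    HasPd (fun y => T.n y 2) ![-T.n p 2 * (pd 0 (hess f) p / hess f p) / 4,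
      -T.n p 2 * conj (pd 0 (hess f) p / hess f p) / 4,
      -T.n p 2 * (conj (pd 2 (hess f) p / hess f p) + pd 2 (hess f) p / hess f p) / 4, 0] p := by
  refine hasPd_components (φ := hess f) (N := fun y => T.n y 2) (P := fun y => T.m y 1)
    (hol_hess hf) (hn.apply 2) (hm.apply 1) ?_ ?_ ?_ hpsi
  · intro h
    simpa [h] using hpsi.self_of_nhds
  · filter_upwards [ho] with x hx using hx.n_real
  · filter_upwards [ho] with x hx using hx.unit

theorem hasPd_l (hf : Hol (lift f) p) (hm : SmoothNear T.m p) (hn : SmoothNear T.n p)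
    (ho : ∀ᶠ x in 𝓝 p, Oriented T x)
    (hpsi : ∀ᶠ x in 𝓝 p, T.n x 2 ^ 2 * conj (T.m x 1) ^ 2 * hess f x = 2) :
    HasPd (fun y => T.l y 3) ![T.l p 3 * (pd 0 (hess f) p / hess f p) / 4,
      T.l p 3 * conj (pd 0 (hess f) p / hess f p) / 4,
      T.l p 3 * (conj (pd 2 (hess f) p / hess f p) + pd 2 (hess f) p / hess f p) / 4, 0] p := by
  have h := ho.self_of_nhds
  have hN := (hasPd_tetrad hf hm hn ho hpsi).2
  have hl := (hN.inv h.n2_ne).congr (ψ := fun y => T.l y 3) (by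
    filter_upwards [ho] with x hx
    exact inv_eq_of_mul_eq_one_right hx.nl)
  have e : T.l p 3 = (T.n p 2)⁻¹ := (inv_eq_of_mul_eq_one_right h.nl).symm
  have := h.n2_ne
  refine ⟨hl.1, fun i => (hl.2 i).trans ?_⟩
  rw [e]
  fin_cases i <;> simp <;> field_simp

/-- For every `Z` the spin connection is the logarithmic derivative of `φ` along `Z`. -/
theorem spin_eq (hf : Hol (lift f) p) (hm : SmoothNear T.m p) (hn : SmoothNear T.n p)
    (ho : ∀ᶠ x in 𝓝 p, Oriented T x)
    (hpsi : ∀ᶠ x in 𝓝 p, T.n x 2 ^ 2 * conj (T.m x 1) ^ 2 * hess f x = 2) (Z : VectorField) :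
    -(conn f T.m T.m.bar Z p + conn f T.n T.l Z p) / 2
      = (Z p 0 * pd 0 (hess f) p + Z p 2 * pd 2 (hess f) p) / (4 * hess f p) := by
  have h := ho.self_of_nhds
  have hp : pd 3 (profile f) p = 0 := (eventually_pd_profile hf).self_of_nhds.1
  have h0 : hess f p ≠ 0 := by
    intro h
    simpa [h] using hpsi.self_of_nhds
  rw [conn_m_eq hp ho, conn_n_eq hp ho, app_of_hasPd Z (hasPd_tetrad hf hm hn ho hpsi).1,
    app_of_hasPd Z (hasPd_l hf hm hn ho hpsi)]
  simp
  have hc : conj (hess f p) ≠ 0 := by simpa using h0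
  field_simp
  linear_combination
    (-Z p 1 * conj (pd 0 (hess f) p) * hess f p + Z p 0 * pd 0 (hess f) p * conj (hess f p)
      - Z p 2 * (conj (pd 2 (hess f) p) * hess f p - pd 2 (hess f) p * conj (hess f p))) * h.unit
    + (Z p 1 * conj (pd 0 (hess f) p) * hess f p + Z p 0 * pd 0 (hess f) p * conj (hess f p)
      + Z p 2 * (conj (pd 2 (hess f) p) * hess f p + pd 2 (hess f) p * conj (hess f p))) * h.nl

theorem alpha_eq (hf : Hol (lift f) p) (hm : SmoothNear T.m p) (hn : SmoothNear T.n p)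
    (ho : ∀ᶠ x in 𝓝 p, Oriented T x)
    (hpsi : ∀ᶠ x in 𝓝 p, T.n x 2 ^ 2 * conj (T.m x 1) ^ 2 * hess f x = 2) :
    alpha f T p = conj (T.m p 1) * pd 0 (hess f) p / (4 * hess f p) := by
  rw [alpha, spin_eq hf hm hn ho hpsi]
  simp [VectorField.bar, ho.self_of_nhds.m2]

theorem gamma_eq (hf : Hol (lift f) p) (hm : SmoothNear T.m p) (hn : SmoothNear T.n p)
    (ho : ∀ᶠ x in 𝓝 p, Oriented T x)
    (hpsi : ∀ᶠ x in 𝓝 p, T.n x 2 ^ 2 * conj (T.m x 1) ^ 2 * hess f x = 2) :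
    gamma f T p = (T.n p 0 * pd 0 (hess f) p + T.n p 2 * pd 2 (hess f) p) / (4 * hess f p) := by
  rw [gamma, spin_eq hf hm hn ho hpsi]

/-- The condition α ≠ 0 says that φ_ζ does not vanish, so that γ = 0, which reads Δφ = 0, can be
solved for the ∂_ζ-component of Δ. -/
theorem adapted_of_invariant (hf : Hol (lift f) p) (hT : IsInvariantTetrad f T p)
    (ho : ∀ᶠ x in 𝓝 p, Oriented T x) : Adapted f T p := by
  obtain ⟨⟨hm, hn, hl, -⟩, -, hpsi, hgamma, halpha⟩ := hT
  have hpsi' : ∀ᶠ x in 𝓝 p, T.n x 2 ^ 2 * conj (T.m x 1) ^ 2 * hess f x = 2 := by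
    filter_upwards [hf.eventually, ho, hpsi] with x a b c
    rw [psi4_eq a b] at c
    linear_combination 2 * c
  have h0 : hess f p ≠ 0 := by
    intro h
    simpa [h] using hpsi'.self_of_nhds
  rw [alpha_eq hf hm hn ho hpsi'] at halpha
  have h1 : pd 0 (hess f) p ≠ 0 := by
    intro h
    simp [h] at halpha
  have hr : Regular (hess f) p := ⟨hol_hess hf, h0, h1⟩
  refine ⟨hf, hm, hn, hl, ho, hpsi', ?_, hr⟩
  filter_upwards [hf.eventually, hm.eventually, hn.eventually, ho.eventually_nhds,
    hpsi'.eventually_nhds, hgamma, hr.eventually] with x a b c d e g r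
  rw [gamma_eq a b c d e, div_eq_zero_iff] at g
  have := r.ne'
  have g' := g.resolve_right (mul_ne_zero (by norm_num) r.ne)
  rw [slope]
  field_simp
  linear_combination g'

theorem Adapted.invariant (h : Adapted f T p) (hnull : IsNullTetrad f T p) :
    IsInvariantTetrad f T p := by
  refine ⟨hnull, ?_, ?_, ?_, ?_⟩
  · filter_upwards [h.oriented] with x hx using ⟨hx.l0, hx.l1, hx.l2⟩
  · filter_upwards [h.eventually] with x hx
    rw [psi4_eq hx.hol hx.oriented.self_of_nhds, hx.psi.self_of_nhds]
    norm_num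
  · filter_upwards [h.eventually] with x hx
    rw [gamma_eq hx.hol hx.smooth_m hx.smooth_n hx.oriented hx.psi, hx.n0.self_of_nhds, slope]
    have := hx.regular.ne'
    field_simp
    simp
  · rw [alpha_eq h.hol h.smooth_m h.smooth_n h.oriented h.psi]
    have := h.regular.ne
    have := h.regular.ne'
    have := h.oriented.self_of_nhds.m1_ne
    simp [*]

end Components

namespace Adapted

variable {f : ℂ × ℝ → ℂ} {T : Tetrad} {p : Spacetime}

theorem m3 (h : Adapted f T p) : T.m p 3 = T.m p 1 * slope (hess f) p := by
  have ho := h.oriented.self_of_nhds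
  refine mul_left_cancel₀ ho.n2_ne ?_
  rw [← ho.mn, h.n0.self_of_nhds]
  ring

theorem alpha_eq (h : Adapted f T p) :
    alpha f T p = conj (T.m p 1) * pd 0 (hess f) p / (4 * hess f p) :=
  PPWave.alpha_eq h.hol h.smooth_m h.smooth_n h.oriented h.psi

theorem hasPd_m (h : Adapted f T p) : HasPd (fun y => conj (T.m y 1))
    ![-conj (T.m p 1) * (pd 0 (hess f) p / hess f p) / 4,
      conj (T.m p 1) * conj (pd 0 (hess f) p / hess f p) / 4,
      conj (T.m p 1) * (conj (pd 2 (hess f) p / hess f p) - pd 2 (hess f) p / hess f p) / 4, 0] p :=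
  (hasPd_tetrad h.hol h.smooth_m h.smooth_n h.oriented h.psi).1

theorem hasPd_n (h : Adapted f T p) : HasPd (fun y => T.n y 2)
    ![-T.n p 2 * (pd 0 (hess f) p / hess f p) / 4,
      -T.n p 2 * conj (pd 0 (hess f) p / hess f p) / 4,
      -T.n p 2 * (conj (pd 2 (hess f) p / hess f p) + pd 2 (hess f) p / hess f p) / 4, 0] p :=
  (hasPd_tetrad h.hol h.smooth_m h.smooth_n h.oriented h.psi).2

theorem hasPd_l (h : Adapted f T p) : HasPd (fun y => T.l y 3)
    ![T.l p 3 * (pd 0 (hess f) p / hess f p) / 4,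
      T.l p 3 * conj (pd 0 (hess f) p / hess f p) / 4,
      T.l p 3 * (conj (pd 2 (hess f) p / hess f p) + pd 2 (hess f) p / hess f p) / 4, 0] p :=
  PPWave.hasPd_l h.hol h.smooth_m h.smooth_n h.oriented h.psi

/-- The derivatives are arranged through A, M and q. The ∂_ζ̄-entry comes from the phase of δ alone,
because φ_ζ/φ is holomorphic in ζ. -/
theorem hasPd_alpha (h : Adapted f T p) : HasPd (alpha f T)
    ![alpha f T p * modulus (hess f) p * (pd 0 (hess f) p / hess f p) / 4,
      alpha f T p * conj (pd 0 (hess f) p / hess f p) / 4,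
      -alpha f T p * (shear (hess f) p + slope (hess f) p * modulus (hess f) p
        * (pd 0 (hess f) p / hess f p) / 4 + conj (slope (hess f) p)
        * conj (pd 0 (hess f) p / hess f p) / 4), 0] p := by
  have hr := h.regular
  have h1 := (h.hasPd_m.mul (hr.hol.pd 0).hasPd).div ((HasPd.const 4 p).mul hr.hol.hasPd)
    (mul_ne_zero (by norm_num) hr.ne)
  have h2 := h1.congr (ψ := alpha f T) (by
    filter_upwards [h.eventually] with x hx using hx.alpha_eq.symm)
  refine ⟨h2.1, fun i => (h2.2 i).trans ?_⟩
  have n1 := hr.ne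
  have n2 := hr.ne'
  have n3 : conj (hess f p) ≠ 0 := by simpa using n1
  have n4 : conj (pd 0 (hess f) p) ≠ 0 := by simpa using n2
  rw [h.alpha_eq, hr.shear_eq, slope, modulus, pd_comm hr.hol.1 0 2]
  fin_cases i
  · simp; field_simp; ring
  · simp; field_simp
  · simp; field_simp; ring
  · simp

theorem alpha_ne (h : Adapted f T p) : alpha f T p ≠ 0 := by
  rw [h.alpha_eq]
  have := h.regular.ne
  have := h.regular.ne'
  have := h.oriented.self_of_nhds.m1_ne
  simp [*]

theorem invA_eq (h : Adapted f T p) : invA f T p = modulus (hess f) p := by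
  have ho := h.oriented.self_of_nhds
  have hu := ho.unit
  rw [invA, app_of_hasPd _ h.hasPd_alpha, h.alpha_eq]
  have n1 := h.regular.ne
  have n2 := h.regular.ne'
  have n3 : conj (T.m p 1) ≠ 0 := by simpa using ho.m1_ne
  simp [VectorField.bar, ho.m0, ho.m2]
  field_simp

/-- With Δ having ∂_ζ̄-component N q̄ and δ having ∂_v-component Pq, the two terms containing δN
cancel, and only the derivative of q̄ along δ remains. -/
theorem mu_eq (h : Adapted f T p) : mu f T p = T.n p 2 * conj (shear (hess f) p) := by
  have ho := h.oriented.self_of_nhds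
  have hp : pd 3 (profile f) p = 0 := (eventually_pd_profile h.hol).self_of_nhds.1
  have h0 : HasPd (fun y => conj (T.n y 0)) _ p :=
    (h.hasPd_n.mul h.regular.hol_slope.hasPd_conj).congr (by
      filter_upwards [h.eventually] with x hx
      rw [hx.n0.self_of_nhds, map_mul, hx.oriented.self_of_nhds.n_real])
  rw [PPWave.mu_eq hp h.oriented, app_of_hasPd _ h0, app_of_hasPd _ h.hasPd_n, h.m3, ho.m0, ho.m2]
  simp [shear]
  linear_combination (T.n p 2 * conj (pd 0 (slope (hess f)) p)) * ho.unit

theorem app_n_conj (h : Adapted f T p) {g : Spacetime → ℂ} (hg : Hol g p) :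
    T.n.app (fun y => conj (g y)) p = T.n p 2 * conj (flow (hess f) g p) := by
  have ho := h.oriented.self_of_nhds
  rw [app_of_hasPd _ hg.hasPd_conj, ho.n1, h.n0.self_of_nhds, flow]
  simp [ho.n_real]
  ring

theorem flow_quot (h : Adapted f T p) : pd 2 (hess f) p / hess f p =
    - slope (hess f) p * (pd 0 (hess f) p / hess f p) := by
  have := h.regular.ne
  have := h.regular.ne'
  rw [slope]
  field_simp

/-- By the normalization N²|φ| = 2, and Δ annihilates φ and φ̄. Consequently Δ acts on μ and on 1/μ
only through M̄. -/
theorem app_n_n (h : Adapted f T p) : T.n.app (fun y => T.n y 2) p = 0 := by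
  have ho := h.oriented.self_of_nhds
  rw [app_of_hasPd _ h.hasPd_n, ho.n1, h.n0.self_of_nhds, h.flow_quot]
  simp [ho.n_real]
  ring

theorem app_n_l (h : Adapted f T p) : T.n.app (fun y => T.l y 3) p = 0 := by
  have ho := h.oriented.self_of_nhds
  rw [app_of_hasPd _ h.hasPd_l, ho.n1, h.n0.self_of_nhds, h.flow_quot]
  simp [ho.n_real]
  ring

theorem app_mul {Z : VectorField} {φ ψ : Spacetime → ℂ} (hφ : DifferentiableAt ℝ φ p)
    (hψ : DifferentiableAt ℝ ψ p) :
    Z.app (fun y => φ y * ψ y) p = Z.app φ p * ψ p + φ p * Z.app ψ p := by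
  have h := HasPd.mul (x := p) ⟨hφ, fun i => rfl⟩ ⟨hψ, fun i => rfl⟩
  rw [app_of_hasPd _ h]
  simp only [VectorField.app, Fin.sum_univ_four]
  ring

theorem app_mu (h : Adapted f T p) :
    T.n.app (mu f T) p = T.n p 2 ^ 2 * conj (flow (hess f) (shear (hess f)) p) := by
  have e : mu f T =ᶠ[𝓝 p] fun y => T.n y 2 * conj (shear (hess f) y) := by
    filter_upwards [h.eventually] with x hx using hx.mu_eq
  have hs := h.regular.hol_shear
  rw [app_congr _ e, app_mul (h.smooth_n.apply 2).differentiableAt hs.1.conj.differentiableAt,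
    h.app_n_n, h.app_n_conj hs]
  ring

theorem app_inv_mu (h : Adapted f T p) (hM : shear (hess f) p ≠ 0) :
    T.n.app (fun y => 1 / mu f T y) p =
      conj (flow (hess f) (fun y => (shear (hess f) y)⁻¹) p) := by
  have e : (fun y => 1 / mu f T y) =ᶠ[𝓝 p] fun y => T.l y 3 * conj ((shear (hess f) y)⁻¹) := by
    filter_upwards [h.eventually] with x hx
    rw [hx.mu_eq, one_div, mul_inv,
      inv_eq_of_mul_eq_one_right hx.oriented.self_of_nhds.nl, map_inv₀]
  have hs := h.regular.hol_shear.inv hM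
  rw [app_congr _ e, app_mul (h.smooth_l.apply 3).differentiableAt hs.1.conj.differentiableAt,
    h.app_n_l, h.app_n_conj hs]
  linear_combination conj (flow (hess f) (fun y => (shear (hess f) y)⁻¹) p)
    * h.oriented.self_of_nhds.nl

theorem app_app_inv_mu (h : Adapted f T p) (hM : shear (hess f) p ≠ 0) :
    T.n.app (T.n.app (fun y => 1 / mu f T y)) p =
      T.n p 2 * conj (flow (hess f) (flow (hess f) fun y => (shear (hess f) y)⁻¹) p) := by
  have e : T.n.app (fun y => 1 / mu f T y) =ᶠ[𝓝 p]
      fun y => conj (flow (hess f) (fun y => (shear (hess f) y)⁻¹) y) := by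
    filter_upwards [h.eventually, h.regular.hol_shear.smooth.continuousAt.eventually_ne hM]
      with x hx hM using hx.app_inv_mu hM
  rw [app_congr _ e, h.app_n_conj (h.regular.hol_flow (h.regular.hol_shear.inv hM))]

theorem invB_eq (h : Adapted f T p) : invB f T p =
    T.n p 2 * (conj (shear (hess f) p) * modulus (hess f) p - shear (hess f) p) := by
  rw [invB, h.invA_eq, h.mu_eq, map_mul, h.oriented.self_of_nhds.n_real, Complex.conj_conj]
  ring

end Adapted

/-- The invariant condition of a class, expressed by `φ = ∂_ζ² f`. -/
def ReducedCondition (c : SolClass) (φ : Spacetime → ℂ) (p : Spacetime) : Prop :=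
  match c with
  | .BP => (∀ᶠ x in 𝓝 p, shear φ x = modulus φ x * conj (shear φ x)) ∧ shear φ p ≠ 0 ∧
      (∀ᶠ x in 𝓝 p, flow φ (flow φ fun y => (shear φ y)⁻¹) x = 0) ∧
      flow φ (shear φ) p ≠ 0 ∧ modulus φ p ^ 2 ≠ 1
  | .CP => (∀ᶠ x in 𝓝 p, shear φ x = modulus φ x * conj (shear φ x)) ∧
      (∀ᶠ x in 𝓝 p, flow φ (shear φ) x = 0) ∧ shear φ p ≠ 0 ∧ modulus φ p ^ 2 ≠ 1
  | .BE => (∀ᶠ x in 𝓝 p, shear φ x = modulus φ x * conj (shear φ x)) ∧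
      (∀ᶠ x in 𝓝 p, modulus φ x = -1) ∧ shear φ p ≠ 0 ∧
      (∀ᶠ x in 𝓝 p, flow φ (flow φ fun y => (shear φ y)⁻¹) x = 0) ∧ flow φ (shear φ) p ≠ 0
  | .CE => (∀ᶠ x in 𝓝 p, shear φ x = modulus φ x * conj (shear φ x)) ∧
      (∀ᶠ x in 𝓝 p, modulus φ x = -1) ∧
      (∀ᶠ x in 𝓝 p, flow φ (shear φ) x = 0) ∧ shear φ p ≠ 0
  | .L => (∀ᶠ x in 𝓝 p, shear φ x = modulus φ x * conj (shear φ x)) ∧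
      (∀ᶠ x in 𝓝 p, modulus φ x = 1)
  | .BL => (∀ᶠ x in 𝓝 p, shear φ x = modulus φ x * conj (shear φ x)) ∧
      (∀ᶠ x in 𝓝 p, modulus φ x = 1) ∧
      (∀ᶠ x in 𝓝 p, flow φ (shear φ) x = shear φ x ^ 2) ∧ shear φ p ≠ 0
  | .AP => (∀ᶠ x in 𝓝 p, shear φ x = 0) ∧
      (∀ᶠ x in 𝓝 p, modulus φ x * conj (modulus φ x) = 1) ∧ modulus φ p ^ 2 ≠ 1
  | .AE => (∀ᶠ x in 𝓝 p, shear φ x = 0) ∧ (∀ᶠ x in 𝓝 p, modulus φ x = -1)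
  | .AL => (∀ᶠ x in 𝓝 p, shear φ x = 0) ∧ (∀ᶠ x in 𝓝 p, modulus φ x = 1)

/-- Each invariant is a power of the nonvanishing real function N times an expression in A and M or
its conjugate, and each condition is homogeneous in N. -/
theorem Adapted.invariantCondition_iff {f : ℂ × ℝ → ℂ} {T : Tetrad} {p : Spacetime}
    (h : Adapted f T p) (c : SolClass) :
    InvariantCondition c f T p ↔ ReducedCondition c (hess f) p := by
  have hN : ∀ᶠ x in 𝓝 p, T.n x 2 ≠ 0 := by
    filter_upwards [h.oriented] with x hx using hx.n2_ne
  have hN0 := hN.self_of_nhds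
  have hA : ∀ z, (∀ᶠ x in 𝓝 p, invA f T x = z) ↔ ∀ᶠ x in 𝓝 p, modulus (hess f) x = z :=
    fun z => eventually_congr (h.eventually.mono fun x hx => by rw [hx.invA_eq])
  have hA1 : (∀ᶠ x in 𝓝 p, invA f T x * conj (invA f T x) = 1) ↔
      ∀ᶠ x in 𝓝 p, modulus (hess f) x * conj (modulus (hess f) x) = 1 :=
    eventually_congr (h.eventually.mono fun x hx => by rw [hx.invA_eq])
  have hB : (∀ᶠ x in 𝓝 p, invB f T x = 0) ↔
      ∀ᶠ x in 𝓝 p, shear (hess f) x = modulus (hess f) x * conj (shear (hess f) x) := by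
    refine eventually_congr ((h.eventually.and hN).mono fun x hx => ?_)
    rw [hx.1.invB_eq, mul_eq_zero, or_iff_right hx.2, sub_eq_zero, mul_comm, eq_comm]
  have hmu : (∀ᶠ x in 𝓝 p, mu f T x = 0) ↔ ∀ᶠ x in 𝓝 p, shear (hess f) x = 0 := by
    refine eventually_congr ((h.eventually.and hN).mono fun x hx => ?_)
    rw [hx.1.mu_eq, mul_eq_zero, or_iff_right hx.2, map_eq_zero]
  have hmu0 : mu f T p = 0 ↔ shear (hess f) p = 0 := by
    rw [h.mu_eq, mul_eq_zero, or_iff_right hN0, map_eq_zero]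
  have hD : (∀ᶠ x in 𝓝 p, T.n.app (mu f T) x = 0) ↔
      ∀ᶠ x in 𝓝 p, flow (hess f) (shear (hess f)) x = 0 := by
    refine eventually_congr ((h.eventually.and hN).mono fun x hx => ?_)
    rw [hx.1.app_mu, mul_eq_zero, or_iff_right (pow_ne_zero 2 hx.2), map_eq_zero]
  have hD0 : T.n.app (mu f T) p = 0 ↔ flow (hess f) (shear (hess f)) p = 0 := by
    rw [h.app_mu, mul_eq_zero, or_iff_right (pow_ne_zero 2 hN0), map_eq_zero]
  have hDsq : (∀ᶠ x in 𝓝 p, T.n.app (mu f T) x = mu f T x ^ 2) ↔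
      ∀ᶠ x in 𝓝 p, flow (hess f) (shear (hess f)) x = shear (hess f) x ^ 2 := by
    refine eventually_congr ((h.eventually.and hN).mono fun x hx => ?_)
    rw [hx.1.app_mu, hx.1.mu_eq, mul_pow, mul_right_inj' (pow_ne_zero 2 hx.2), ← map_pow]
    exact (starRingEnd ℂ).injective.eq_iff
  -- The formula for 1/μ needs M to be nonzero; in the conditions of BP and BE the clause μ ≠ 0
  -- comes earlier and supplies this.
  have hDD : shear (hess f) p ≠ 0 →
      ((∀ᶠ x in 𝓝 p, T.n.app (T.n.app (fun y => 1 / mu f T y)) x = 0) ↔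
        ∀ᶠ x in 𝓝 p, flow (hess f) (flow (hess f) fun y => (shear (hess f) y)⁻¹) x = 0) := by
    intro hM
    refine eventually_congr ((h.eventually.and (hN.and
      (h.regular.hol_shear.smooth.continuousAt.eventually_ne hM))).mono fun x hx => ?_)
    rw [hx.1.app_app_inv_mu hx.2.2, mul_eq_zero, or_iff_right hx.2.1, map_eq_zero]
  cases c <;> simp only [InvariantCondition, ReducedCondition, ne_eq, hA, hA1, hB, hmu, hmu0, hD,
    hD0, hDsq, h.invA_eq]
  · exact and_congr_right fun _ => and_congr_right fun hM => by rw [hDD hM]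
  · exact and_congr_right fun _ => and_congr_right fun _ => and_congr_right fun hM => by rw [hDD hM]

/-- The type `(0,1)` condition, expressed by `φ = ∂_ζ² f`. -/
def ReducedType01 (φ : Spacetime → ℂ) (p : Spacetime) : Prop :=
  ∀ᶠ x in 𝓝 p, modulus φ x * conj (modulus φ x) = 1 ∧
    shear φ x = modulus φ x * conj (shear φ x)

/-- The (ζ, ζ̄)-component of dα ∧ dα* gives |A| = 1, and the (ζ, u)-component then gives M = A M̄.
Conversely, these two relations make dα* equal to (α*/α)A* dα. -/
theorem Adapted.isType01_iff {f : ℂ × ℝ → ℂ} {T : Tetrad} {p : Spacetime} (h : Adapted f T p) :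
    IsType01 f T p ↔ ReducedType01 (hess f) p := by
  refine eventually_congr (h.eventually.mono fun x hx => ?_)
  have ha := hx.hasPd_alpha.2
  have hac := hx.hasPd_alpha.conj.2
  have n0 := hx.alpha_ne
  have n1 := hx.regular.ne
  have n2 := hx.regular.ne'
  have n0' : conj (alpha f T x) ≠ 0 := by simpa using n0
  have ne : pd 0 (hess f) x / hess f x ≠ 0 := div_ne_zero n2 n1
  have ne' : conj (pd 0 (hess f) x / hess f x) ≠ 0 := by simpa using ne
  simp only [ha, hac]
  generalize pd 0 (hess f) x / hess f x = η at *
  generalize alpha f T x = a at *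
  generalize modulus (hess f) x = A
  generalize shear (hess f) x = M
  generalize slope (hess f) x = q
  constructor
  · intro H
    have h01 := H 0 1
    have h02 := H 0 2
    simp [Equiv.swap_apply_def, map_ofNat] at h01 h02
    have hA : A * conj A = 1 := by
      have : a * conj a * (η * conj η) * (A * conj A - 1) = 0 := by
        linear_combination 16 * h01
      have := (mul_eq_zero.1 this).resolve_left
        (mul_ne_zero (mul_ne_zero n0 n0') (mul_ne_zero ne ne'))
      linear_combination this
    refine ⟨hA, ?_⟩
    have : a * conj a * η * (M - A * conj M) = 0 := by
      linear_combination (-4) * h02 + (a * conj a * η * conj q * conj η / 4) * hA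
    have := (mul_eq_zero.1 this).resolve_left (mul_ne_zero (mul_ne_zero n0 n0') ne)
    linear_combination this
  · rintro ⟨hA, hM⟩ i j
    have hM' : conj M = conj A * M := by
      simpa using congrArg (starRingEnd ℂ) hM
    have key : ∀ i : Fin 4, conj (![a * A * η / 4, a * conj η / 4,
        -a * (M + q * A * η / 4 + conj q * conj η / 4), 0] (Equiv.swap 0 1 i)) =
        conj a / a * conj A * ![a * A * η / 4, a * conj η / 4,
        -a * (M + q * A * η / 4 + conj q * conj η / 4), 0] i := by
      intro i
      fin_cases i <;> simp [Equiv.swap_apply_def, map_ofNat] <;> field_simp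
      · linear_combination -hA
      · linear_combination 4 * hM' - (q * η) * hA
    rw [key, key]
    ring

/-! ### Existence and orientation of invariant tetrads -/

/-- With φ = exp L, the choices P = exp(i Im L/2) and N = √2 exp(-Re L/2) solve N²P̄²φ = 2.
Orthogonality of δ and Δ then fixes the ∂_v-component of δ, and nullity of Δ fixes that of Δ. -/
theorem exists_adapted {f : ℂ × ℝ → ℂ} {p : Spacetime} (hf : Hol (lift f) p)
    (hr : Regular (hess f) p) : ∃ T, Adapted f T p ∧ IsInvariantTetrad f T p := by
  obtain ⟨L, hL, hexp⟩ := hr.hol.smooth.exists_log hr.ne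
  set Q : Spacetime → ℂ := fun x => Complex.exp (((L x).im : ℂ) * Complex.I / 2) with hQ
  set N : Spacetime → ℂ := fun x => (Real.sqrt 2 * Real.exp (-(L x).re / 2) : ℝ) with hN
  set l : Spacetime → ℂ := fun x => ((Real.sqrt 2)⁻¹ * Real.exp ((L x).re / 2) : ℝ) with hl
  set q := slope (hess f) with hq
  have sQ : SmoothNear Q p := by
    simp only [hQ, mul_div_assoc]
    exact (hL.im.ofReal.mul (SmoothNear.const _ _)).cexp
  have sN : SmoothNear N p := by
    have : N = fun x => (Real.sqrt 2 : ℂ) * Complex.exp (((L x).re : ℂ) * (-1 / 2)) := by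
      funext x
      simp only [hN]
      push_cast
      congr 2
      ring
    rw [this]
    exact (SmoothNear.const _ _).mul (hL.re.ofReal.mul (SmoothNear.const _ _)).cexp
  have sl : SmoothNear l p := by
    have : l = fun x => (Real.sqrt 2 : ℂ)⁻¹ * Complex.exp (((L x).re : ℂ) * (1 / 2)) := by
      funext x
      simp only [hl]
      push_cast
      congr 2
      ring
    rw [this]
    exact (SmoothNear.const _ _).mul (hL.re.ofReal.mul (SmoothNear.const _ _)).cexp
  have sq : SmoothNear q p := hr.hol_slope.smooth
  have sH : SmoothNear (profile f) p := hf.smooth.add hf.smooth.conj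
  have hNr : ∀ x, conj (N x) = N x := fun x => Complex.conj_ofReal _
  have hlr : ∀ x, conj (l x) = l x := fun x => Complex.conj_ofReal _
  have hHr : ∀ x, conj (profile f x) = profile f x := fun x => by
    simp [profile, add_comm]
  have hNl : ∀ x, N x * l x = 1 := fun x => by
    simp only [hN, hl, ← Complex.ofReal_mul]
    rw [Complex.ofReal_eq_one]
    have h2 : Real.sqrt 2 ≠ 0 := by positivity
    have he : Real.exp (-(L x).re / 2) * Real.exp ((L x).re / 2) = 1 := by
      rw [← Real.exp_add]; simp [neg_div]
    field_simp
    rwa [neg_div] at he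
  have hQu : ∀ x, Q x * conj (Q x) = 1 := fun x => by
    simp only [hQ]
    rw [← Complex.exp_conj, ← Complex.exp_add]
    simp [map_ofNat, neg_div]
  let T : Tetrad :=
    { m := fun x => ![0, Q x, 0, Q x * q x]
      n := fun x => ![N x * q x, N x * conj (q x), N x,
        N x * (q x * conj (q x)) - profile f x * N x * (1 / 2)]
      l := fun x => ![0, 0, 0, l x] }
  have sm : SmoothNear T.m p := SmoothNear.pi fun i => by
    fin_cases i
    exacts [SmoothNear.const _ _, sQ, SmoothNear.const _ _, sQ.mul sq]
  have sn : SmoothNear T.n p := SmoothNear.pi fun i => by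
    fin_cases i
    exacts [sN.mul sq, sN.mul sq.conj, sN, (sN.mul (sq.mul sq.conj)).sub
      ((sH.mul sN).mul (SmoothNear.const _ _))]
  have sll : SmoothNear T.l p := SmoothNear.pi fun i => by
    fin_cases i
    exacts [SmoothNear.const _ _, SmoothNear.const _ _, SmoothNear.const _ _, sl]
  have ho : ∀ x, Oriented T x := fun x =>
    { m0 := rfl
      m2 := rfl
      l0 := rfl
      l1 := rfl
      l2 := rfl
      unit := hQu x
      n1 := by simp [T, hNr]
      n_real := hNr x
      l_real := hlr x
      nl := hNl x
      mn := by simp [T]; ring }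
  have hA : Adapted f T p :=
    { hol := hf
      smooth_m := sm
      smooth_n := sn
      smooth_l := sll
      oriented := Eventually.of_forall ho
      psi := by
        filter_upwards [hexp] with x hx
        simp only [T, hQ, hN]
        simp only [Matrix.cons_val, Matrix.cons_val_one]
        rw [← hx, ← Complex.exp_conj]
        push_cast
        have h2 : ((Real.sqrt 2 : ℝ) : ℂ) ^ 2 = 2 := by
          rw [← Complex.ofReal_pow, Real.sq_sqrt (by norm_num)]; norm_num
        rw [mul_pow, h2, ← Complex.exp_nat_mul, ← Complex.exp_nat_mul, mul_assoc, mul_assoc,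
          ← Complex.exp_add, ← Complex.exp_add]
        simp [map_ofNat]
        conv_rhs => rw [← Complex.exp_zero]
        congr 1
        linear_combination -Complex.re_add_im (L x)
      n0 := Eventually.of_forall fun x => rfl
      regular := hr }
  refine ⟨T, hA, hA.invariant ⟨sm, sn, sll, Eventually.of_forall fun x => ?_⟩⟩
  have hu := hQu x
  have hnl := hNl x
  refine ⟨?_, ?_, ?_, ?_, ?_, ?_, ?_, ?_, ?_⟩
  · funext i
    fin_cases i <;> simp [T, VectorField.bar, hNr, hHr, map_ofNat]
    exact Or.inl (mul_comm _ _)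
  · funext i
    fin_cases i <;> simp [T, VectorField.bar, hlr]
  · simp [ip_eq, T]
  · simp [ip_eq, T, VectorField.bar, hu]
  · simp [ip_eq, T]; ring
  · simp [ip_eq, T]
  · simp [ip_eq, T]; ring
  · simp [ip_eq, T]
  · simp [ip_eq, T]; exact hnl

/-! ### Interchanging δ and δ* -/

section Flip

variable {f : ℂ × ℝ → ℂ} {T : Tetrad} {p : Spacetime}

/-- Only the middle field is differentiated, so it alone has to agree on a neighbourhood. -/
theorem conn_congr {a a' b b' Z Z' : VectorField} {x : Spacetime} (ha : a x = a' x)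
    (hb : b =ᶠ[𝓝 x] b') (hZ : Z x = Z' x) : conn f a b Z x = conn f a' b' Z' x := by
  have hn : nabla f Z b x = nabla f Z' b' x := by
    funext k
    simp only [nabla, hZ, hb.eq_of_nhds]
    refine Finset.sum_congr rfl fun i _ => ?_
    rw [pd_congr i (φ := fun y => b y k) (ψ := fun y => b' y k)]
    filter_upwards [hb] with y hy
    rw [hy]
  rw [conn, conn, ip_eq, ip_eq, ha, hn]

/-- The frame vectors `Δ` and `D` are real near `p`. -/
def RealFrame (T : Tetrad) (p : Spacetime) : Prop :=
  ∀ᶠ x in 𝓝 p, T.n.bar x = T.n x ∧ T.l.bar x = T.l x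

theorem RealFrame.eventually (h : RealFrame T p) : ∀ᶠ x in 𝓝 p, RealFrame T x :=
  eventually_eventually_nhds.2 h

/-- Conjugating a connection component conjugates all its arguments; as Δ and D are real, the effect
is to exchange δ and δ*. -/
theorem alpha_flip (h : RealFrame T p) : alpha f T.flip p = conj (alpha f T p) := by
  simp only [alpha, Tetrad.flip, map_div₀, map_neg, map_add, map_ofNat, conn_conj]
  rw [conn_congr (a := T.n.bar) h.self_of_nhds.1 (h.mono fun _ h => h.2) rfl]

theorem gamma_flip (h : RealFrame T p) : gamma f T.flip p = conj (gamma f T p) := by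
  simp only [gamma, Tetrad.flip, map_div₀, map_neg, map_add, map_ofNat, conn_conj]
  rw [conn_congr (a := T.n.bar) h.self_of_nhds.1 (h.mono fun _ h => h.2) h.self_of_nhds.1,
    conn_congr (Z := T.n.bar) rfl (EventuallyEq.refl _ _) h.self_of_nhds.1]

theorem mu_flip (h : RealFrame T p) : mu f T.flip p = conj (mu f T p) := by
  simp only [mu, Tetrad.flip, conn_conj]
  rw [conn_congr (b := T.n.bar) rfl (h.mono fun _ h => h.1) rfl]

theorem invA_flip (h : RealFrame T p) : invA f T.flip p = conj (invA f T p) := by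
  simp only [invA, map_div₀, map_pow, app_conj, alpha_flip h]
  rw [app_congr _ (h.eventually.mono fun x hx => alpha_flip hx)]
  rfl

theorem app_n_conj_flip (h : T.n.bar p = T.n p) (φ : Spacetime → ℂ) :
    T.n.app (fun y => conj (φ y)) p = conj (T.n.app φ p) := by
  rw [app_conj]
  simp only [VectorField.app, h]

/-- The flip conjugates every invariant, and Δ commutes with conjugation. The special values in the
conditions are 0, 1 and -1, all real. -/
theorem invariantCondition_flip (h : RealFrame T p) (c : SolClass) :
    InvariantCondition c f T.flip p ↔ InvariantCondition c f T p := by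
  have hA : ∀ z : ℂ, conj z = z →
      ((∀ᶠ x in 𝓝 p, invA f T.flip x = z) ↔ ∀ᶠ x in 𝓝 p, invA f T x = z) := by
    refine fun z hz => eventually_congr (h.eventually.mono fun x hx => ?_)
    rw [invA_flip hx, ← (starRingEnd ℂ).injective.eq_iff, Complex.conj_conj, hz]
  have hA1 : (∀ᶠ x in 𝓝 p, invA f T.flip x * conj (invA f T.flip x) = 1) ↔
      ∀ᶠ x in 𝓝 p, invA f T x * conj (invA f T x) = 1 :=
    eventually_congr (h.eventually.mono fun x hx => by
      rw [invA_flip hx, Complex.conj_conj, mul_comm])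
  have hA2 : invA f T.flip p ^ 2 = 1 ↔ invA f T p ^ 2 = 1 := by
    rw [invA_flip h, ← map_pow, map_eq_one_iff _ (starRingEnd ℂ).injective]
  have hB : (∀ᶠ x in 𝓝 p, invB f T.flip x = 0) ↔ ∀ᶠ x in 𝓝 p, invB f T x = 0 := by
    refine eventually_congr (h.eventually.mono fun x hx => ?_)
    have : invB f T.flip x = conj (invB f T x) := by
      simp only [invB, invA_flip hx, mu_flip hx, map_sub, map_mul]
    rw [this, map_eq_zero]
  have hmu : (∀ᶠ x in 𝓝 p, mu f T.flip x = 0) ↔ ∀ᶠ x in 𝓝 p, mu f T x = 0 :=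
    eventually_congr (h.eventually.mono fun x hx => by rw [mu_flip hx, map_eq_zero])
  have hmu0 : mu f T.flip p = 0 ↔ mu f T p = 0 := by rw [mu_flip h, map_eq_zero]
  have hn : T.flip.n = T.n := rfl
  have D : ∀ x, RealFrame T x → T.n.app (mu f T.flip) x = conj (T.n.app (mu f T) x) := by
    intro x hx
    rw [app_congr _ (hx.eventually.mono fun y hy => mu_flip hy),
      app_n_conj_flip hx.self_of_nhds.1]
  have hD : (∀ᶠ x in 𝓝 p, T.n.app (mu f T.flip) x = 0) ↔
      ∀ᶠ x in 𝓝 p, T.n.app (mu f T) x = 0 :=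
    eventually_congr (h.eventually.mono fun x hx => by rw [D x hx, map_eq_zero])
  have hD0 : T.n.app (mu f T.flip) p = 0 ↔ T.n.app (mu f T) p = 0 := by
    rw [D p h, map_eq_zero]
  have hDsq : (∀ᶠ x in 𝓝 p, T.n.app (mu f T.flip) x = mu f T.flip x ^ 2) ↔
      ∀ᶠ x in 𝓝 p, T.n.app (mu f T) x = mu f T x ^ 2 :=
    eventually_congr (h.eventually.mono fun x hx => by
      rw [D x hx, mu_flip hx, ← map_pow, (starRingEnd ℂ).injective.eq_iff])
  have hDD : (∀ᶠ x in 𝓝 p, T.n.app (T.n.app (fun y => 1 / mu f T.flip y)) x = 0) ↔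
      ∀ᶠ x in 𝓝 p, T.n.app (T.n.app (fun y => 1 / mu f T y)) x = 0 := by
    refine eventually_congr (h.eventually.mono fun x hx => ?_)
    have e : T.n.app (fun y => 1 / mu f T.flip y) =ᶠ[𝓝 x]
        fun y => conj (T.n.app (fun y => 1 / mu f T y) y) := by
      filter_upwards [hx.eventually] with y hy
      rw [app_congr _ (ψ := fun y => conj (1 / mu f T y))
        (hy.eventually.mono fun z hz => by simp [mu_flip hz]), app_n_conj_flip hy.self_of_nhds.1]
    rw [app_congr _ e, app_n_conj_flip hx.self_of_nhds.1, map_eq_zero]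
  cases c <;> simp only [InvariantCondition, ne_eq, hn, hA _ (map_one _), hA1, hA2, hB, hmu, hmu0,
    hD, hD0, hDsq, hDD, hA (-1) (by simp)]

theorem isType01_flip (h : RealFrame T p) : IsType01 f T.flip p ↔ IsType01 f T p := by
  refine eventually_congr (h.eventually.mono fun x hx => ?_)
  have e1 : ∀ i, pd i (alpha f T.flip) x = pd i (fun y => conj (alpha f T y)) x := fun i =>
    pd_congr i (hx.eventually.mono fun y hy => alpha_flip hy)
  have e2 : ∀ i, pd i (fun y => conj (alpha f T.flip y)) x = pd i (alpha f T) x := fun i =>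
    pd_congr i (hx.eventually.mono fun y hy => by simp only [alpha_flip hy, Complex.conj_conj])
  simp only [e1, e2]
  constructor <;> intro H i j <;> linear_combination -H i j

theorem lower_conj (X : VectorField) (x : Spacetime) (i : Fin 4) :
    conj (lower f X x (Equiv.swap 0 1 i)) = lower f X.bar x i := by
  simp only [lower_eq]
  fin_cases i <;> simp [Equiv.swap_apply_def, VectorField.bar, profile, add_comm]

theorem lieCovector_congr {V V' : VectorField} {θ θ' : Spacetime → Fin 4 → ℂ} {x : Spacetime}
    (hV : V =ᶠ[𝓝 x] V') (hθ : θ =ᶠ[𝓝 x] θ') (i : Fin 4) :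
    lieCovector V θ x i = lieCovector V' θ' x i := by
  simp only [lieCovector, hV.eq_of_nhds, hθ.eq_of_nhds]
  refine Finset.sum_congr rfl fun j _ => ?_
  rw [pd_congr j (φ := fun y => θ y i) (ψ := fun y => θ' y i) (hθ.mono fun y hy => by simp only [hy]),
    pd_congr i (φ := fun y => V y j) (ψ := fun y => V' y j) (hV.mono fun y hy => by simp only [hy])]

/-- The same real field V works, with V¹ conjugated: the flip conjugates ω¹ and leaves the real form
ω³ unchanged. -/
theorem isPrecursor_flip (h : RealFrame T p) (hT : IsPrecursor f T p) :
    IsPrecursor f T.flip p := by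
  obtain ⟨V1, V3, V4, V, s1, s3, s4, hV, hL, hne⟩ := hT
  refine ⟨fun x => conj (V1 x), V3, V4, V, s1.conj, s3, s4, fun x i => ?_, ?_, ?_⟩
  · simp only [hV, Tetrad.flip, VectorField.bar_bar, Complex.conj_conj]
    ring
  · have hVr : ∀ x, T.n.bar x = T.n x ∧ T.l.bar x = T.l x → V.bar x = V x := by
      rintro x ⟨hn, hl⟩
      funext i
      have e1 := congrFun hn i
      have e2 := congrFun hl i
      rw [VectorField.bar_apply] at e1 e2 ⊢
      rw [hV, hV]
      simp only [map_add, map_mul, e1, e2, Complex.conj_conj, VectorField.bar_apply,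
        Complex.conj_ofReal, Equiv.swap_apply_self]
      ring
    have key : ∀ x, RealFrame T x → ∀ X : VectorField, ∀ θ θ' : Spacetime → Fin 4 → ℂ,
        (∀ y i, θ' y i = conj (θ y (Equiv.swap 0 1 i))) → ∀ i,
        lieCovector V θ' x i = conj (lieCovector V θ x (Equiv.swap 0 1 i)) := by
      intro x hx X θ θ' hθ i
      rw [lieCovector_conj, Equiv.swap_apply_self]
      refine lieCovector_congr ?_ ?_ i
      · filter_upwards [hx] with y hy using (hVr y hy).symm
      · exact Eventually.of_forall fun y => funext fun i => hθ y i
    filter_upwards [hL, h.eventually, h.eventually_nhds] with x hx hr hr' i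
    constructor
    · rw [key x hr T.m (omega1 f T) (omega1 f T.flip)
        (fun y i => by rw [omega1, omega1, lower_conj]; rfl), (hx _).1, map_zero]
    · have e : omega3 f T.flip =ᶠ[𝓝 x] fun y i => conj (omega3 f T y (Equiv.swap 0 1 i)) := by
        filter_upwards [hr'] with y hy
        funext i
        simp only [omega3, map_neg, lower_conj]
        simp only [Tetrad.flip, lower, hy.2]
      rw [lieCovector_congr (EventuallyEq.refl _ V) e, key x hr T.m (omega3 f T) _
        (fun y i => rfl), (hx _).2, map_zero]
  · refine hne.mono fun x hx => ?_
    simpa using hx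

theorem IsNullTetrad.realFrame (h : IsNullTetrad f T p) : RealFrame T p :=
  h.2.2.2.mono fun _ h => ⟨h.1, h.2.1⟩

theorem smoothNear_bar {X : VectorField} (h : SmoothNear X p) : SmoothNear X.bar p :=
  SmoothNear.pi fun i => by
    simp only [VectorField.bar_apply]
    exact (h.apply _).conj

theorem ip_congr {X Y X' Y' : VectorField} {x : Spacetime} (hX : X x = X' x) (hY : Y x = Y' x) :
    ip f X Y x = ip f X' Y' x := by
  rw [ip_eq, ip_eq, hX, hY]

theorem isInvariantTetrad_flip (hf : Hol (lift f) p) (hT : IsInvariantTetrad f T p) :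
    IsInvariantTetrad f T.flip p := by
  have hr := hT.1.realFrame
  obtain ⟨⟨sm, sn, sl, hnull⟩, hl, hpsi, hgamma, halpha⟩ := hT
  refine ⟨⟨smoothNear_bar sm, sn, sl, ?_⟩, hl, ?_, ?_, ?_⟩
  · filter_upwards [hnull] with x ⟨h1, h2, h3, h4, h5, h6, h7, h8, h9⟩
    refine ⟨h1, h2, ?_, ?_, ?_, ?_, h7, h8, h9⟩
    · rw [Tetrad.flip, ← ip_conj, h3, map_zero]
    · rw [Tetrad.flip, ← ip_conj, h4, map_one]
    · rw [Tetrad.flip, ip_congr (X := T.m.bar) (Y := T.n) rfl h1.symm, ← ip_conj, h5, map_zero]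
    · rw [Tetrad.flip, ip_congr (X := T.m.bar) (Y := T.l) rfl h2.symm, ← ip_conj, h6, map_zero]
  · filter_upwards [hpsi, hnull, hl, hf.eventually] with x hp ⟨h1, h2, h3, h4, h5, h6, h7, h8, h9⟩ hl hf
    -- The relation g(δ, D) = 0 removes the ∂_u-component of δ. The explicit curvature formula then
    -- applies to δ and δ* alike and shows that the flip conjugates Ψ₄.
    have hm2 : T.m x 2 = 0 := by
      rw [ip_eq, hl.1, hl.2.1, hl.2.2] at h6 h9
      have : T.l x 3 ≠ 0 := by
        intro h
        simp [h] at h9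
      simpa [this] using h6
    have e1 := riemannLow_eq_hess hf T.m.bar T.n (by simp [VectorField.bar, hm2])
    have e2 := riemannLow_eq_hess hf T.m T.n hm2
    have hn2 : conj (T.n x 2) = T.n x 2 := by
      simpa [VectorField.bar] using congrFun h1 2
    rw [psi4, e1] at hp
    have := congrArg (starRingEnd ℂ) hp
    simp only [psi4, Tetrad.flip, VectorField.bar_bar, e2]
    simp [VectorField.bar, map_ofNat, hn2] at this
    rw [← this]
    ring
  · filter_upwards [hgamma, hr.eventually] with x hx hr
    rw [gamma_flip hr, hx, map_zero]
  · rwa [alpha_flip hr, ne_eq, map_eq_zero]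

/-- As δ has no ∂_u-component, g(δ, δ) = 0 says that the product of its ∂_ζ- and ∂_ζ̄-components
vanishes, and g(δ, δ*) = 1 that they are not both zero. The one that is nonzero at p stays nonzero
nearby, so a single alternative holds on a neighbourhood. -/
theorem oriented_or_flip (hT : IsInvariantTetrad f T p) :
    (∀ᶠ x in 𝓝 p, Oriented T x) ∨ ∀ᶠ x in 𝓝 p, Oriented T.flip x := by
  obtain ⟨⟨sm, sn, sl, hnull⟩, hl, -⟩ := hT
  have key : ∀ᶠ x in 𝓝 p, T.m x 0 * T.m x 1 = 0 ∧
      T.m x 0 * conj (T.m x 0) + T.m x 1 * conj (T.m x 1) = 1 ∧ (T.m x 0 = 0 → Oriented T x) ∧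
      (T.m x 1 = 0 → Oriented T.flip x) := by
    filter_upwards [hnull, hl] with x ⟨h1, h2, h3, h4, h5, h6, h7, h8, h9⟩ ⟨l0, l1, l2⟩
    have n1 : conj (T.n x 0) = T.n x 1 := by simpa [VectorField.bar] using congrFun h1 1
    have n2 : conj (T.n x 2) = T.n x 2 := by simpa [VectorField.bar] using congrFun h1 2
    have l3 : conj (T.l x 3) = T.l x 3 := by simpa [VectorField.bar] using congrFun h2 3
    rw [ip_eq, l0, l1, l2] at h6 h9
    have hl3 : T.l x 3 ≠ 0 := by
      intro h
      simp [h] at h9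
    have m2 : T.m x 2 = 0 := by simpa [hl3] using h6
    have hnl : T.n x 2 * T.l x 3 = 1 := by linear_combination -h9
    rw [ip_eq, m2] at h3 h4 h5
    simp [VectorField.bar, m2] at h3 h4 h5
    have hmn : T.m x 0 * T.n x 1 + T.m x 1 * T.n x 0 = T.n x 2 * T.m x 3 := by
      linear_combination h5
    refine ⟨by linear_combination h3 / 2, h4, fun hm => ?_, fun hm => ?_⟩
    · rw [hm] at h4 hmn
      exact ⟨hm, m2, l0, l1, l2, by linear_combination h4, n1.symm, n2, l3, hnl,
        by linear_combination hmn⟩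
    · rw [hm] at h4 hmn
      refine ⟨by simp [Tetrad.flip, VectorField.bar, hm],
        by simp [Tetrad.flip, VectorField.bar, m2], l0, l1, l2, ?_, n1.symm, n2, l3, hnl, ?_⟩
      · simp only [Tetrad.flip, VectorField.bar, Matrix.cons_val_one, Matrix.cons_val_zero,
          Complex.conj_conj]
        linear_combination h4
      · have := congrArg (starRingEnd ℂ) hmn
        simp only [map_mul, n2, ← n1, Complex.conj_conj, zero_mul, add_zero] at this
        simpa [Tetrad.flip, VectorField.bar] using this
  rcases eq_or_ne (T.m p 0) 0 with h0 | h0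
  · have h1 : T.m p 1 ≠ 0 := by
      intro h1
      simpa [h0, h1] using key.self_of_nhds.2.1
    left
    filter_upwards [key, (sm.apply 1).continuousAt.eventually_ne h1] with x hx h
    exact hx.2.2.1 ((mul_eq_zero.1 hx.1).resolve_right h)
  · right
    filter_upwards [key, (sm.apply 0).continuousAt.eventually_ne h0] with x hx h
    exact hx.2.2.2 ((mul_eq_zero.1 hx.1).resolve_left h)

/-- Either an invariant tetrad or its flip is adapted, with the same invariant properties. -/
theorem exists_adapted_of_invariant (hf : Hol (lift f) p) (hT : IsInvariantTetrad f T p) :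
    ∃ T', Adapted f T' p ∧ (∀ c, InvariantCondition c f T p ↔ InvariantCondition c f T' p) ∧
      (IsType01 f T p → IsType01 f T' p) ∧ (IsPrecursor f T p → IsPrecursor f T' p) := by
  rcases oriented_or_flip hT with ho | ho
  · exact ⟨T, adapted_of_invariant hf hT ho, fun _ => Iff.rfl, id, id⟩
  · exact ⟨T.flip, adapted_of_invariant hf (isInvariantTetrad_flip hf hT) ho,
      fun c => (invariantCondition_flip hT.1.realFrame c).symm,
      (isType01_flip hT.1.realFrame).2, isPrecursor_flip hT.1.realFrame⟩

end Flip

/-! ### Vector fields preserving `ω¹` and `ω³` -/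

/-- The equations at `x` for a vector field `X ∂_ζ + X̄ ∂_ζ̄ + Y ∂_u + V ∂_v`, with `Y` real, to
preserve `ω¹` and `ω³`. -/
structure Preserves (φ X Y : Spacetime → ℂ) (x : Spacetime) : Prop where
  Y0 : pd 0 Y x = 0
  Y1 : pd 1 Y x = 0
  Y3 : pd 3 Y x = 0
  X1 : pd 1 X x = 0
  X3 : pd 3 X x = 0
  imag : pd 0 X x + conj (pd 0 X x) = 0
  scale : (X x - slope φ x * Y x) * pd 0 φ x = -2 * (pd 2 Y x + pd 0 X x) * φ x
  shift : pd 2 X x + pd 0 X x * slope φ x =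
    X x * shear φ x + Y x * pd 2 (slope φ) x + slope φ x * pd 2 Y x

theorem lieCovector_eq (V : VectorField) (θ : Spacetime → Fin 4 → ℂ) (x : Spacetime) (i : Fin 4) :
    lieCovector V θ x i = V.app (fun y => θ y i) x + ∑ j, θ x j * pd i (fun y => V y j) x := by
  rw [lieCovector, Finset.sum_add_distrib, VectorField.app]

theorem omega1_eq {f : ℂ × ℝ → ℂ} {T : Tetrad} {p : Spacetime} (h : Adapted f T p) :
    omega1 f T p = ![0, conj (T.m p 1), -(conj (T.m p 1) * conj (slope (hess f) p)), 0] := by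
  have ho := h.oriented.self_of_nhds
  rw [omega1, lower_eq]
  simp [VectorField.bar, ho.m0, ho.m2, h.m3]

theorem omega3_eq {f : ℂ × ℝ → ℂ} {T : Tetrad} {p : Spacetime} (h : Oriented T p) :
    omega3 f T p = ![0, 0, T.l p 3, 0] := by
  funext i
  rw [omega3, lower_eq]
  fin_cases i <;> simp [h.l0, h.l1, h.l2]

/-- The ∂_v-component of V plays no role, since ω¹ and ω³ have no dv-part and do not depend on v.
With s = (X - qY)φ_ζ/φ, the du-part of L_Vω³ gives Re s = -2Y_u and the dζ̄-part of L_Vω¹ gives X_ζ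
= -i Im s/2. Together they are `imag` and `scale`; `shift` comes from the du-part of L_Vω¹. -/
theorem lie_iff_preserves {f : ℂ × ℝ → ℂ} {T : Tetrad} {p : Spacetime} (h : Adapted f T p)
    {V : VectorField} {X Y : Spacetime → ℂ}
    (e0 : ∀ᶠ x in 𝓝 p, V x 0 = X x) (e1 : ∀ᶠ x in 𝓝 p, V x 1 = conj (X x))
    (e2 : ∀ᶠ x in 𝓝 p, V x 2 = Y x) (hYr : ∀ᶠ x in 𝓝 p, conj (Y x) = Y x) :
    (∀ i, lieCovector V (omega1 f T) p i = 0 ∧ lieCovector V (omega3 f T) p i = 0) ↔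
      Preserves (hess f) X Y p := by
  have ho := h.oriented.self_of_nhds
  have hr := h.regular
  have hw1 : omega1 f T =ᶠ[𝓝 p] fun y =>
      ![0, conj (T.m y 1), -(conj (T.m y 1) * conj (slope (hess f) y)), 0] :=
    h.eventually.mono fun x hx => omega1_eq hx
  have hw3 : omega3 f T =ᶠ[𝓝 p] fun y => ![0, 0, T.l y 3, 0] :=
    h.oriented.mono fun x hx => omega3_eq hx
  have hV : ∀ i j, pd i (fun y => V y j) p =
      ![pd i X p, conj (pd (Equiv.swap 0 1 i) X p), pd i Y p, pd i (fun y => V y 3) p] j := by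
    intro i j
    fin_cases j
    · exact pd_congr i e0
    · exact (pd_congr i e1).trans (pd_conj i X p)
    · exact pd_congr i e2
    · rfl
  have hY : ∀ i, conj (pd (Equiv.swap 0 1 i) Y p) = pd i Y p := fun i =>
    (pd_conj i Y p).symm.trans (pd_congr i hYr)
  have hY1 : pd 1 Y p = conj (pd 0 Y p) := (hY 1).symm.trans (by simp)
  have hY2 : conj (pd 2 Y p) = pd 2 Y p := by simpa [Equiv.swap_apply_def] using hY 2
  have v0 := e0.self_of_nhds
  have v1 := e1.self_of_nhds
  have v2 := e2.self_of_nhds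
  have yr := hYr.self_of_nhds
  have hdm := h.hasPd_m
  have hdl := h.hasPd_l
  have hdq := (hdm.mul hr.hol_slope.hasPd_conj).neg
  have hl : T.l p 3 ≠ 0 := right_ne_zero_of_mul_eq_one ho.nl
  have hm : conj (T.m p 1) ≠ 0 := by simpa using ho.m1_ne
  have hm' := ho.m1_ne
  have w3 : ∀ i, lieCovector V (omega3 f T) p i =
      ![T.l p 3 * pd 0 Y p, T.l p 3 * pd 1 Y p, T.l p 3 *
        ((X p - slope (hess f) p * Y p) * (pd 0 (hess f) p / hess f p) / 4
        + conj ((X p - slope (hess f) p * Y p) * (pd 0 (hess f) p / hess f p)) / 4 + pd 2 Y p),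
        T.l p 3 * pd 3 Y p] i := by
    intro i
    rw [lieCovector_congr (EventuallyEq.refl _ V) hw3, lieCovector_eq]
    simp only [Fin.sum_univ_four, hV i 0, hV i 1, hV i 2]
    fin_cases i
    · simp [app_const]
    · simp [app_const]
    · simp only [Fin.reduceFinMk, Matrix.cons_val]
      rw [app_of_hasPd V hdl, v0, v1, v2, h.flow_quot]
      simp [yr]
      ring
    · simp [app_const]
  have w1 : ∀ i, lieCovector V (omega1 f T) p i =
      ![conj (T.m p 1) * (conj (pd 1 X p) - conj (slope (hess f) p) * pd 0 Y p),
        conj (T.m p 1) * (-((X p - slope (hess f) p * Y p) * (pd 0 (hess f) p / hess f p) / 4)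
        + conj ((X p - slope (hess f) p * Y p) * (pd 0 (hess f) p / hess f p)) / 4
        + conj (pd 0 X p) - conj (slope (hess f) p) * pd 1 Y p),
        conj (T.m p 1) * (
          ((X p - slope (hess f) p * Y p) * (pd 0 (hess f) p / hess f p) / 4
            - conj ((X p - slope (hess f) p * Y p) * (pd 0 (hess f) p / hess f p)) / 4) *
            conj (slope (hess f) p) - conj (X p * shear (hess f) p + Y p * pd 2 (slope (hess f)) p)
            + conj (pd 2 X p) - conj (slope (hess f) p) * pd 2 Y p),
        conj (T.m p 1) * (conj (pd 3 X p) - conj (slope (hess f) p) * pd 3 Y p)] i := by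
    intro i
    rw [lieCovector_congr (EventuallyEq.refl _ V) hw1, lieCovector_eq]
    simp only [Fin.sum_univ_four, hV i 0, hV i 1, hV i 2]
    fin_cases i
    · simp [app_const]
      ring
    · simp only [Fin.mk_one, Matrix.cons_val_one, Matrix.cons_val]
      rw [app_of_hasPd V hdm, v0, v1, v2, h.flow_quot]
      simp [yr]
      ring
    · simp only [Fin.reduceFinMk, Matrix.cons_val]
      rw [app_of_hasPd V hdq, v0, v1, v2, h.flow_quot]
      simp [yr, shear, Equiv.swap_apply_def]
      ring
    · simp [app_const, Equiv.swap_apply_def]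
      ring
  have hφ := hr.ne
  have hs : (X p - slope (hess f) p * Y p) * pd 0 (hess f) p
      = (X p - slope (hess f) p * Y p) * (pd 0 (hess f) p / hess f p) * hess f p := by
    field_simp
  generalize (X p - slope (hess f) p * Y p) * (pd 0 (hess f) p / hess f p) = s at *
  constructor
  · intro H
    have a0 := (H 0).2
    have a1 := (H 1).2
    have a2 := (H 2).2
    have a3 := (H 3).2
    have b0 := (H 0).1
    have b1 := (H 1).1
    have b2 := (H 2).1
    have b3 := (H 3).1
    simp only [w1, w3, Matrix.cons_val_zero, Matrix.cons_val_one, Matrix.cons_val, mul_eq_zero, hl,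
      hm, false_or] at a0 a1 a2 a3 b0 b1 b2 b3
    have b1' := congrArg (starRingEnd ℂ) b1
    have b2' := congrArg (starRingEnd ℂ) b2
    rw [a1] at b1 b1'
    simp only [map_add, map_sub, map_neg, map_mul, map_div₀, Complex.conj_conj, map_zero,
      map_ofNat, mul_zero, sub_zero, hY2] at b1 b1' b2'
    have im : pd 0 X p + conj (pd 0 X p) = 0 := by linear_combination b1 + b1'
    refine ⟨a0, a1, a3, ?_, ?_, im, ?_, ?_⟩
    · simpa [a0] using b0
    · simpa [a3] using b3
    · rw [hs]
      linear_combination (2 * hess f p) * (a2 - b1) + (2 * hess f p) * im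
    · linear_combination b2' + slope (hess f) p * b1'
  · intro H i
    have sc : s = -2 * (pd 2 Y p + pd 0 X p) := mul_right_cancel₀ hφ (hs.symm.trans H.scale)
    have im := H.imag
    have sh := congrArg (starRingEnd ℂ) H.shift
    rw [w1, w3, sc]
    simp only [map_add, map_mul, hY2] at sh
    fin_cases i <;> simp [H.Y0, H.Y1, H.Y3, H.X1, H.X3, map_ofNat, hY2]
    · exact Or.inr (by linear_combination (1 / 2) * im)
    · refine ⟨Or.inr ?_, Or.inr ?_⟩
      · linear_combination sh - conj (slope (hess f) p) / 2 * im
      · linear_combination (-1 / 2) * im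

/-- The existence of a vector field preserving `ω¹` and `ω³`, expressed by `φ = ∂_ζ² f`. -/
def ReducedPrecursor (φ : Spacetime → ℂ) (p : Spacetime) : Prop :=
  ∃ y₀ y₁ c : ℝ, (y₀ ≠ 0 ∨ y₁ ≠ 0 ∨ c ≠ 0) ∧ ∀ᶠ x in 𝓝 p,
    Complex.I * c = shear φ x * (y₀ + y₁ * x.2.1) + (y₁ + Complex.I * c) * (modulus φ x + 1) / 2

theorem hasPd_affine (y₀ y₁ : ℂ) (x : Spacetime) :
    HasPd (fun y => y₀ + y₁ * (y.2.1 : ℂ)) ![0, 0, y₁, 0] x := by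
  have h : HasDerivAt (fun u : ℝ => y₀ + y₁ * (u : ℂ)) y₁ x.2.1 := by
    simpa using ((Complex.ofRealCLM.hasDerivAt (x := x.2.1)).const_mul y₁).const_add y₀
  exact HasPd.comp_u h

theorem smoothNear_affine (y₀ y₁ : ℂ) (p : Spacetime) :
    SmoothNear (fun y : Spacetime => y₀ + y₁ * (y.2.1 : ℂ)) p :=
  (SmoothNear.const _ _).add ((SmoothNear.const _ _).mul (smoothNear_u p).ofReal)

theorem hol_affine (y₀ y₁ : ℂ) (p : Spacetime) :
    Hol (fun y => y₀ + y₁ * (y.2.1 : ℂ)) p :=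
  Hol.of_hasPd (smoothNear_affine _ _ _) (Eventually.of_forall fun x => ⟨_, _, hasPd_affine y₀ y₁ x⟩)

section

variable {φ X Y : Spacetime → ℂ} {p : Spacetime}

/-- Let D = Y_u + X_ζ and ψ = φ/φ_ζ, so that `scale` reads X = qY - 2Dψ. The holomorphic function
X_ζ is imaginary, hence independent of ζ, and so is D. Comparing the derivatives of this formula
with `shift` and with the identity for ψ gives ψ D_u = 0. So D is constant, with real part Y_u and
imaginary part X_ζ/i; the ζ-derivative of the formula for X is the equation that remains. -/
theorem exists_constants_of_preserves (hr : Regular φ p) (sX : SmoothNear X p)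
    (sY : SmoothNear Y p) (hYr : ∀ᶠ x in 𝓝 p, conj (Y x) = Y x)
    (H : ∀ᶠ x in 𝓝 p, Preserves φ X Y x) : ∃ y₀ y₁ c : ℝ, ∀ᶠ x in 𝓝 p,
      Y x = y₀ + y₁ * x.2.1 ∧ X x = slope φ x * Y x - 2 * (y₁ + Complex.I * c) * ratio φ x ∧
      Complex.I * c = shear φ x * (y₀ + y₁ * x.2.1)
        + (y₁ + Complex.I * c) * (modulus φ x + 1) / 2 := by
  have hX : Hol X p := ⟨sX, H.mono fun x h => ⟨h.X1, h.X3⟩⟩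
  have hY : Hol Y p := ⟨sY, H.mono fun x h => ⟨h.Y1, h.Y3⟩⟩
  set D : Spacetime → ℂ := fun x => pd 2 Y x + pd 0 X x with hD
  have hDh : Hol D p := (hY.pd 2).add (hX.pd 0)
  have hY2 : ∀ᶠ x in 𝓝 p, conj (pd 2 Y x) = pd 2 Y x := by
    filter_upwards [hYr.eventually_nhds] with x hx
    simpa [pd_conj, Equiv.swap_apply_def] using pd_congr 2 hx
  have hX_eq : ∀ᶠ x in 𝓝 p, X x = slope φ x * Y x - 2 * D x * ratio φ x := by
    filter_upwards [H, hr.eventually] with x hx hrx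
    have := hrx.ne'
    have hs := hx.scale
    rw [ratio]
    field_simp
    simp only [hD]
    linear_combination hs
  have hD0 : ∀ᶠ x in 𝓝 p, pd 0 D x = 0 := by
    filter_upwards [hX.eventually, hY.eventually, H.eventually_nhds] with x hXx hYx hx
    have e1 : pd 0 (pd 0 X) x = 0 := by
      rw [pd_congr 0 (ψ := fun y => -conj (pd 0 X y))
        (hx.mono fun y hy => by linear_combination hy.imag), pd_neg, pd_conj]
      simp [(hXx.pd 0).pd_one]
    have e2 : pd 0 (pd 2 Y) x = 0 := by
      rw [pd_comm hYx.1, pd_congr 2 (ψ := fun _ => 0) (hx.mono fun y hy => hy.Y0), pd_const]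
    have := ((hYx.pd 2).1.hasPd.add (hXx.pd 0).1.hasPd).2 0
    simp only [e1, e2, add_zero] at this
    exact this
  have hX_pd : ∀ᶠ x in 𝓝 p, ∀ i, pd i X x = pd i (slope φ) x * Y x + slope φ x * pd i Y x
      - 2 * (pd i D x * ratio φ x + D x * pd i (ratio φ) x) := by
    filter_upwards [hX_eq.eventually_nhds, hr.eventually, hDh.eventually, hY.eventually]
      with x hx hrx hDx hYx i
    rw [pd_congr i hx]
    have := ((hrx.hol_slope.1.hasPd.mul hYx.1.hasPd).sub
      (((HasPd.const 2 x).mul hDx.1.hasPd).mul hrx.hol_ratio.1.hasPd)).2 i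
    rw [this]
    ring
  have hD2 : ∀ᶠ x in 𝓝 p, pd 2 D x = 0 := by
    filter_upwards [hX_pd, hX_eq, hD0, H, hr.eventually] with x h1 h2 h3 h4 hrx
    have a0 := h1 0
    have a2 := h1 2
    have hf := hrx.flow_ratio
    have hs := h4.shift
    rw [flow] at hf
    rw [h4.Y0, h3] at a0
    have hψ : ratio φ x ≠ 0 := div_ne_zero hrx.ne hrx.ne'
    refine (mul_eq_zero.1 (?_ : ratio φ x * pd 2 D x = 0)).resolve_left hψ
    have e : pd 0 (slope φ) x = shear φ x := rfl
    rw [e] at a0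
    linear_combination (1 / 2) * a2 + (slope φ x / 2) * a0 - (1 / 2) * hs - D x * hf
      - (shear φ x / 2) * h2
  have hDc := hDh.eventually_eq_const (hD0.and hD2)
  set y₁ : ℝ := (D p).re
  set c : ℝ := (D p).im
  have hDp : D p = y₁ + Complex.I * c := by
    rw [mul_comm]; exact (Complex.re_add_im _).symm
  have hder : ∀ᶠ x in 𝓝 p, pd 2 Y x = y₁ ∧ pd 0 X x = Complex.I * c := by
    filter_upwards [hDc, hY2, H] with x h1 h2 h3
    have e : pd 2 Y x + pd 0 X x = y₁ + Complex.I * c := by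
      rw [← hDp, ← h1]
    have e' := congrArg (starRingEnd ℂ) e
    simp only [map_add, map_mul, h2, Complex.conj_ofReal, Complex.conj_I] at e'
    have hi := h3.imag
    constructor
    · linear_combination (e + e' - hi) / 2
    · linear_combination (e - e' + hi) / 2
  have hYc : ∀ᶠ x in 𝓝 p, Y x - (0 + (y₁ : ℂ) * (x.2.1 : ℂ))
      = Y p - (0 + (y₁ : ℂ) * (p.2.1 : ℂ)) := by
    refine (hY.sub (hol_affine 0 y₁ p)).eventually_eq_const ?_
    filter_upwards [hY.eventually, hder, H] with x hYx hx h
    have := (hYx.1.hasPd.sub (hasPd_affine 0 y₁ x)).2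
    exact ⟨(this 0).trans (by simp [h.Y0]), (this 2).trans (by simp [hx.1])⟩
  refine ⟨(Y p).re - y₁ * p.2.1, y₁, c, ?_⟩
  have hYp : Y p = (Y p).re := (Complex.conj_eq_iff_re.1 hYr.self_of_nhds).symm
  filter_upwards [hYc, hDc, hX_eq, hX_pd, hder, H, hD0, hr.eventually]
    with x h1 h2 h3 h4 h5 h6 h7 hrx
  have hYx : Y x = ((Y p).re - y₁ * p.2.1 : ℝ) + y₁ * x.2.1 := by
    push_cast
    rw [← hYp]
    linear_combination h1
  refine ⟨hYx, by rw [h3, h2, hDp], ?_⟩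
  have a0 := h4 0
  rw [h5.2, h6.Y0, h7, h2, hDp, hYx] at a0
  have e : pd 0 (slope φ) x = shear φ x := rfl
  rw [e] at a0
  rw [hrx.modulus_eq]
  linear_combination a0

/-- The equation `hc` amounts to X_ζ = ic, which yields `imag` and `scale`; `shift` reduces to the
identity for φ/φ_ζ. -/
theorem preserves_of_constants (hr : Regular φ p) {y₀ y₁ c : ℝ}
    (hX : ∀ᶠ x in 𝓝 p, X x = slope φ x * (y₀ + y₁ * x.2.1)
      - 2 * (y₁ + Complex.I * c) * ratio φ x)
    (hc : Complex.I * c = shear φ p * (y₀ + y₁ * p.2.1)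
        + (y₁ + Complex.I * c) * (modulus φ p + 1) / 2) :
    Preserves φ X (fun x => y₀ + y₁ * x.2.1) p := by
  have hY := (hasPd_affine y₀ y₁ p).2
  have hXe := ((hr.hol_slope.hasPd.mul (hasPd_affine y₀ y₁ p)).sub
    ((HasPd.const (2 * (y₁ + Complex.I * c)) p).mul hr.hol_ratio.hasPd)).2
  have hXp : ∀ i, pd i X p = _ := fun i => (pd_congr i hX).trans (hXe i)
  have e0 : pd 0 X p = Complex.I * c := by
    rw [hr.modulus_eq] at hc
    have e : pd 0 (slope φ) p = shear φ p := rfl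
    rw [hXp]
    simp [e]
    linear_combination -hc
  have hf := hr.flow_ratio
  rw [flow] at hf
  have hX0 := hX.self_of_nhds
  have hn := hr.ne'
  refine ⟨by simp [hY], by simp [hY], by simp [hY], by simp [hXp], by simp [hXp], ?_, ?_, ?_⟩
  · simp [e0]
  · rw [e0, hX0, hY, ratio]
    simp
    field_simp
  · have e2 := hXp 2
    have e0' := hXp 0
    simp at e2 e0'
    have e : pd 0 (slope φ) p = shear φ p := rfl
    rw [e] at e0'
    rw [hX0, e2, e0', hY]
    simp
    linear_combination (-2 * (y₁ + Complex.I * c)) * hf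

end

theorem Adapted.reducedPrecursor {f : ℂ × ℝ → ℂ} {T : Tetrad} {p : Spacetime}
    (h : Adapted f T p) (hT : IsPrecursor f T p) : ReducedPrecursor (hess f) p := by
  obtain ⟨V1, V3, V4, V, s1, s3, s4, hV, hL, hne⟩ := hT
  set X : Spacetime → ℂ := fun x => conj (V1 x) * conj (T.m x 1) + V3 x * T.n x 0
  set Y : Spacetime → ℂ := fun x => V3 x * T.n x 2
  have sX : SmoothNear X p :=
    (s1.conj.mul (h.smooth_m.apply 1).conj).add (s3.ofReal.mul (h.smooth_n.apply 0))
  have sY : SmoothNear Y p := s3.ofReal.mul (h.smooth_n.apply 2)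
  have e0 : ∀ᶠ x in 𝓝 p, V x 0 = X x := by
    filter_upwards [h.oriented] with x hx
    simp [hV, X, hx.m0, hx.l0, VectorField.bar]
  have e1 : ∀ᶠ x in 𝓝 p, V x 1 = conj (X x) := by
    filter_upwards [h.oriented] with x hx
    simp [hV, X, hx.m0, hx.l1, VectorField.bar, hx.n1]
  have e2 : ∀ᶠ x in 𝓝 p, V x 2 = Y x := by
    filter_upwards [h.oriented] with x hx
    simp [hV, Y, hx.m2, hx.l2, VectorField.bar]
  have hYr : ∀ᶠ x in 𝓝 p, conj (Y x) = Y x := by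
    filter_upwards [h.oriented] with x hx
    simp [Y, hx.n_real]
  have H : ∀ᶠ x in 𝓝 p, Preserves (hess f) X Y x := by
    filter_upwards [h.eventually, e0.eventually_nhds, e1.eventually_nhds, e2.eventually_nhds,
      hYr.eventually_nhds, hL] with x hx a b c d hl
    exact (lie_iff_preserves hx a b c d).1 hl
  obtain ⟨y₀, y₁, c, hc⟩ := exists_constants_of_preserves h.regular sX sY hYr H
  refine ⟨y₀, y₁, c, ?_, hc.mono fun x hx => hx.2.2⟩
  -- If all three constants vanished, then Y = 0 and X = 0, hence V¹ = V³ = 0 near p, which is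
  -- excluded.
  by_contra! h0
  obtain ⟨rfl, rfl, rfl⟩ := h0
  refine hne ?_
  filter_upwards [hc, h.oriented] with x ⟨hY, hX, _⟩ hx
  have hY0 : Y x = 0 := by simpa using hY
  rw [hY0] at hX
  have h3 : V3 x = 0 := by simpa [Y, hx.n2_ne] using hY0
  have h1 : V1 x = 0 := by simpa [X, h3, hx.m1_ne] using hX
  simp [h1, h3]

theorem Adapted.isPrecursor {f : ℂ × ℝ → ℂ} {T : Tetrad} {p : Spacetime}
    (h : Adapted f T p) (hP : ReducedPrecursor (hess f) p) : IsPrecursor f T p := by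
  obtain ⟨y₀, y₁, c, hne, hc⟩ := hP
  set D : ℂ := y₁ + Complex.I * c with hD
  -- The components of V satisfy Y = N V³ and X = P̄ (V¹)* + q Y; these are solved for V¹ and V³
  -- with X = qY - 2Dψ. The component V⁴ is free and taken to be 0.
  set V1 : Spacetime → ℂ := fun x => conj (T.m x 1 * (-2 * D * ratio (hess f) x)) with hV1
  set V3 : Spacetime → ℝ := fun x => (T.l x 3 * (y₀ + y₁ * x.2.1)).re with hV3
  have s1 : SmoothNear V1 p :=
    ((h.smooth_m.apply 1).mul ((SmoothNear.const _ _).mul h.regular.hol_ratio.1)).conj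
  have s3 : SmoothNear V3 p := ((h.smooth_l.apply 3).mul (smoothNear_affine _ _ _)).re
  have h3 : ∀ᶠ x in 𝓝 p, (V3 x : ℂ) = T.l x 3 * (y₀ + y₁ * x.2.1) := by
    filter_upwards [h.oriented] with x hx
    refine Complex.conj_eq_iff_re.1 ?_
    simp [hx.l_real]
  refine ⟨V1, V3, fun _ => 0, fun x i => V1 x * T.m x i + conj (V1 x) * T.m.bar x i
      + (V3 x : ℂ) * T.n x i + ((0 : ℝ) : ℂ) * T.l x i, s1, s3, SmoothNear.const _ _,
      fun _ _ => rfl, ?_, ?_⟩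
  · have e0 : ∀ᶠ x in 𝓝 p, V1 x * T.m x 0 + conj (V1 x) * T.m.bar x 0
        + (V3 x : ℂ) * T.n x 0 + ((0 : ℝ) : ℂ) * T.l x 0 =
        slope (hess f) x * (y₀ + y₁ * x.2.1) - 2 * D * ratio (hess f) x := by
      filter_upwards [h.eventually, h3] with x hx h3
      have ho := hx.oriented.self_of_nhds
      simp only [h3, ho.m0, ho.l0, hx.n0.self_of_nhds, hV1, Complex.conj_conj, VectorField.bar,
        Matrix.cons_val_zero]
      linear_combination (-2 * D * ratio (hess f) x) * ho.unit
        + slope (hess f) x * (y₀ + y₁ * x.2.1) * ho.nl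
    have e1 : ∀ᶠ x in 𝓝 p, V1 x * T.m x 1 + conj (V1 x) * T.m.bar x 1
        + (V3 x : ℂ) * T.n x 1 + ((0 : ℝ) : ℂ) * T.l x 1 =
        conj (slope (hess f) x * (y₀ + y₁ * x.2.1) - 2 * D * ratio (hess f) x) := by
      filter_upwards [e0, h.oriented] with x hx ho
      rw [← hx]
      simp [VectorField.bar, ho.m0, ho.l0, ho.l1, ho.n1]
    have e2 : ∀ᶠ x in 𝓝 p, V1 x * T.m x 2 + conj (V1 x) * T.m.bar x 2
        + (V3 x : ℂ) * T.n x 2 + ((0 : ℝ) : ℂ) * T.l x 2 = y₀ + y₁ * x.2.1 := by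
      filter_upwards [h.oriented, h3] with x ho h3
      simp only [h3, ho.m2, ho.l2, VectorField.bar, Matrix.cons_val, map_zero]
      linear_combination ((y₀ : ℂ) + y₁ * x.2.1) * ho.nl
    filter_upwards [h.eventually, e0.eventually_nhds, e1.eventually_nhds, e2.eventually_nhds, hc]
      with x hx a b d hcx
    refine (lie_iff_preserves hx a b d (Eventually.of_forall fun y => by simp)).2 ?_
    exact preserves_of_constants hx.regular (Eventually.of_forall fun y => rfl) hcx
  -- If V¹ and V³ vanish near p, then D = 0 gives y₁ = c = 0, and Y = 0 leaves y₀ = 0.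
  · by_contra hcon
    rw [not_frequently] at hcon
    have hz : ∀ᶠ x in 𝓝 p, (y₀ : ℂ) + y₁ * x.2.1 = 0 ∧ D = 0 := by
      filter_upwards [hcon, h3, h.eventually] with x hx h3 had
      have ho := had.oriented.self_of_nhds
      have hr := had.regular
      push Not at hx
      have hl : T.l x 3 ≠ 0 := right_ne_zero_of_mul_eq_one ho.nl
      constructor
      · rw [hx.2] at h3
        simpa [hl] using h3.symm
      · have hψ : ratio (hess f) x ≠ 0 := div_ne_zero hr.ne hr.ne'
        have := hx.1
        simpa [hV1, ho.m1_ne, hψ] using this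
    have hz0 := hz.self_of_nhds
    have hDre := congrArg Complex.re hz0.2
    have hDim := congrArg Complex.im hz0.2
    simp [hD] at hDre hDim
    have := hz0.1
    simp [hDre] at this
    tauto

/-! ### Normal forms of the invariants -/

/-- The invariant `A` is the unimodular constant `A₀`, and `∂_ζ q` is the function `M₁` of `u`, with
`M₁ = A₀ M̄₁`. -/
structure ConstantModulus (φ : Spacetime → ℂ) (p : Spacetime) (A₀ : ℂ) (M₁ : ℝ → ℂ) : Prop where
  unit : A₀ * conj A₀ = 1
  smooth : SmoothNear M₁ p.2.1
  modulus : ∀ᶠ x in 𝓝 p, modulus φ x = A₀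
  shear : ∀ᶠ x in 𝓝 p, shear φ x = M₁ x.2.1
  real : ∀ᶠ u in 𝓝 p.2.1, M₁ u = A₀ * conj (M₁ u)

/-- Applying ∂_ζ to A Ā = 1 gives A_ζ = 0, and then M = A M̄ gives M_ζ = 0. The ζ-derivative of the
identity for ψ = φ/φ_ζ becomes ∂_uψ_ζ + Mψ_ζ = Mψ_ζ, whence A_u = 0. -/
theorem ReducedType01.exists_constantModulus {φ : Spacetime → ℂ} {p : Spacetime}
    (hr : Regular φ p) (h : ReducedType01 φ p) : ∃ A₀ M₁, ConstantModulus φ p A₀ M₁ := by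
  have hA0 : ∀ᶠ x in 𝓝 p, pd 0 (modulus φ) x = 0 := by
    filter_upwards [h.eventually_nhds, hr.eventually] with x hx hrx
    have h1 := (hrx.hol_modulus.hasPd.mul hrx.hol_modulus.hasPd_conj).2 0
    rw [pd_congr 0 (ψ := fun _ => 1) (hx.mono fun y hy => hy.1), pd_const] at h1
    have h2 := right_ne_zero_of_mul_eq_one hx.self_of_nhds.1
    simpa [h2, eq_comm] using h1
  have hM0 : ∀ᶠ x in 𝓝 p, pd 0 (shear φ) x = 0 := by
    filter_upwards [h.eventually_nhds, hr.eventually, hA0] with x hx hrx h0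
    have h1 := (hrx.hol_modulus.hasPd.mul hrx.hol_shear.hasPd_conj).2 0
    rw [pd_congr 0 (hx.mono fun y hy => hy.2), h1]
    simp [h0]
  have hA2 : ∀ᶠ x in 𝓝 p, pd 2 (modulus φ) x = 0 := by
    filter_upwards [hA0, hM0, eventually_eventually_nhds.2 hr.eventually] with x h0 m0 hrx'
    have hrx := hrx'.self_of_nhds
    have hA : ∀ i, pd i (modulus φ) x = -4 * pd i (pd 0 (ratio φ)) x := fun i => by
      rw [pd_congr i (ψ := fun y => -1 - 4 * pd 0 (ratio φ) y)
        (hrx'.mono fun y hy => hy.modulus_eq)]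
      have := ((HasPd.const (-1) x).sub
        ((HasPd.const 4 x).mul (hrx.hol_ratio.1.pd 0).hasPd)).2 i
      rw [this]
      ring
    have e0 := hA 0
    rw [h0] at e0
    have e00 : pd 0 (pd 0 (ratio φ)) x = 0 := by linear_combination (1 / 4) * e0
    have l := ((hrx.hol_ratio.1.pd 2).hasPd.add
      (hrx.hol_slope.1.hasPd.mul (hrx.hol_ratio.1.pd 0).hasPd)).2 0
    have r := (hrx.hol_shear.1.hasPd.mul hrx.hol_ratio.1.hasPd).2 0
    rw [← pd_congr 0 (hrx'.mono fun y hy => hy.flow_ratio)] at r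
    have e : pd 0 (slope φ) x = shear φ x := rfl
    have lr := l.symm.trans r
    simp only [e00, m0, e] at lr
    rw [hA, pd_comm hrx.hol_ratio.1]
    linear_combination (-4) * lr
  obtain ⟨M₁, hs, hM⟩ := hr.hol_shear.exists_eq_comp_u hM0
  have hA := hr.hol_modulus.eventually_eq_const (hA0.and hA2)
  refine ⟨modulus φ p, M₁, h.self_of_nhds.1, hs, hA, hM, ?_⟩
  refine eventually_of_eventually_u ?_
  filter_upwards [hA, hM, h] with x a b c
  rw [← b, ← a]
  exact c.2

/-- The normal form of the invariants `A` and `∂_ζ q` for a class. -/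
def NormalForm (c : SolClass) (φ : Spacetime → ℂ) (p : Spacetime) : Prop :=
  ∃ A₀ M₁, ConstantModulus φ p A₀ M₁ ∧
  match c with
  | .BP => A₀ ^ 2 ≠ 1 ∧ ∃ (κ : ℂ) (d : ℝ), κ ≠ 0 ∧ p.2.1 + d ≠ 0 ∧
      ∀ᶠ u in 𝓝 p.2.1, M₁ u = κ / (u + d)
  | .CP => A₀ ^ 2 ≠ 1 ∧ ∃ κ : ℂ, κ ≠ 0 ∧ ∀ᶠ u in 𝓝 p.2.1, M₁ u = κ
  | .BE => A₀ = -1 ∧ ∃ (κ : ℂ) (d : ℝ), κ ≠ 0 ∧ p.2.1 + d ≠ 0 ∧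
      ∀ᶠ u in 𝓝 p.2.1, M₁ u = κ / (u + d)
  | .CE => A₀ = -1 ∧ ∃ κ : ℂ, κ ≠ 0 ∧ ∀ᶠ u in 𝓝 p.2.1, M₁ u = κ
  | .L => A₀ = 1
  | .BL => A₀ = 1 ∧ ∃ d : ℝ, p.2.1 + d ≠ 0 ∧ ∀ᶠ u in 𝓝 p.2.1, M₁ u = -1 / (u + d)
  | .AP => A₀ ^ 2 ≠ 1 ∧ ∀ᶠ u in 𝓝 p.2.1, M₁ u = 0
  | .AE => A₀ = -1 ∧ ∀ᶠ u in 𝓝 p.2.1, M₁ u = 0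
  | .AL => A₀ = 1 ∧ ∀ᶠ u in 𝓝 p.2.1, M₁ u = 0

/-! ### Functions of u alone -/

section Real

variable {c : ℝ → ℂ} {t : ℝ}

theorem eventually_eq_affine {k : ℂ} (hc : SmoothNear c t) (h : ∀ᶠ u in 𝓝 t, deriv c u = k) :
    ∀ᶠ u in 𝓝 t, c u = c t + k * (u - t) := by
  -- The function of u is regarded as a function on spacetime, so that the constancy criterion
  -- available there applies.
  let p : Spacetime := (0, t, 0)
  have h1 : Hol (fun x : Spacetime => c x.2.1 - (0 + k * (x.2.1 : ℂ))) p :=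
    (Hol.comp_u (p := p) hc).sub (hol_affine 0 k p)
  have h2 := h1.eventually_eq_const (by
    filter_upwards [eventually_u (p := p) h, eventually_u (p := p) hc.eventually] with x hx hcx
    have := ((HasPd.comp_u hcx.differentiableAt.hasDerivAt).sub (hasPd_affine 0 k x)).2
    exact ⟨(this 0).trans (by simp), (this 2).trans (by simp [hx])⟩)
  refine eventually_of_eventually_u (p := p) (h2.mono fun x hx => ?_)
  simp only [p] at hx
  linear_combination hx

theorem hasDerivAt_conj {c' : ℂ} (h : HasDerivAt c c' t) :
    HasDerivAt (fun u => conj (c u)) (conj c') t :=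
  (Complex.conjCLE.toContinuousLinearMap.hasFDerivAt (x := c t)).comp_hasDerivAt t h

theorem hasDerivAt_div_affine (κ : ℂ) {d : ℝ} (h : t + d ≠ 0) :
    HasDerivAt (fun u : ℝ => κ / ((u : ℂ) + d)) (-κ / ((t : ℂ) + d) ^ 2) t := by
  have h1 : HasDerivAt (fun u : ℝ => (u : ℂ) + d) 1 t :=
    (Complex.ofRealCLM.hasDerivAt (x := t)).add_const (d : ℂ)
  have h0 : (t : ℂ) + d ≠ 0 := by exact_mod_cast h
  have := (hasDerivAt_const t κ).div h1 h0
  refine this.congr_deriv ?_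
  simp

theorem continuousAt_add_ne {d : ℝ} (h : t + d ≠ 0) : ∀ᶠ u in 𝓝 t, u + d ≠ 0 :=
  (by fun_prop : ContinuousAt (fun u : ℝ => u + d) t).eventually_ne h

/-- A function whose inverse is affine, and real up to a constant phase. -/
theorem exists_eq_div_affine {M : ℝ → ℂ} {A k : ℂ} (hA : A * conj A = 1) (hM : SmoothNear M t)
    (hM0 : M t ≠ 0) (hreal : ∀ᶠ u in 𝓝 t, M u = A * conj (M u)) (hk : k ≠ 0)
    (h : ∀ᶠ u in 𝓝 t, deriv (fun u => (M u)⁻¹) u = k) :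
    ∃ d : ℝ, t + d ≠ 0 ∧ ∀ᶠ u in 𝓝 t, M u = k⁻¹ / (u + d) := by
  have hs := hM.inv hM0
  have haff := eventually_eq_affine hs h
  have hA0 : A ≠ 0 := left_ne_zero_of_mul_eq_one hA
  have hconj : ∀ᶠ u in 𝓝 t, conj ((M u)⁻¹) = A * (M u)⁻¹ := by
    filter_upwards [hreal] with u hu
    rw [map_inv₀]
    conv_rhs => rw [hu, mul_inv]
    rw [mul_inv_cancel_left₀ hA0]
  have hd : HasDerivAt (fun u => (M u)⁻¹) k t := by
    rw [← h.self_of_nhds]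
    exact hs.differentiableAt.hasDerivAt
  have hkc : conj k = A * k :=
    (hasDerivAt_conj hd).unique ((hd.const_mul A).congr_of_eventuallyEq hconj)
  -- Here 1/M(u) = k(u - t + b). Conjugation multiplies both 1/M and its slope k by A, so b is real,
  -- and d = b - t.
  set b := (M t)⁻¹ / k with hb
  have hbr : conj b = b := by
    rw [hb, map_div₀, hkc, hconj.self_of_nhds, mul_div_mul_left _ _ hA0]
  have hbre : b = b.re := (Complex.conj_eq_iff_re.1 hbr).symm
  have key : ∀ᶠ u in 𝓝 t, (M u)⁻¹ = k * (u + (b.re - t : ℝ)) := by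
    filter_upwards [haff] with u hu
    rw [hu]
    push_cast
    rw [← hbre, hb]
    field_simp
    ring
  refine ⟨b.re - t, ?_, ?_⟩
  · intro h0
    have h1 := key.self_of_nhds
    rw [← Complex.ofReal_add, h0] at h1
    simp [hM0] at h1
  · filter_upwards [key] with u hu
    rw [← inv_inv (M u), hu, mul_inv, div_eq_mul_inv]

end Real

/-! ### Invariant conditions, preserving fields and normal forms -/

section

variable {φ : Spacetime → ℂ} {p : Spacetime}

theorem flow_comp_u {g : Spacetime → ℂ} {c : ℝ → ℂ} (hg : ∀ᶠ x in 𝓝 p, g x = c x.2.1)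
    (hc : DifferentiableAt ℝ c p.2.1) : flow φ g p = deriv c p.2.1 := by
  have := (HasPd.comp_u hc.hasDerivAt).2
  rw [flow, pd_congr 2 hg, pd_congr 0 hg, this, this]
  simp

theorem eventually_flow_comp_u {g : Spacetime → ℂ} {c : ℝ → ℂ}
    (hg : ∀ᶠ x in 𝓝 p, g x = c x.2.1) (hc : SmoothNear c p.2.1) :
    ∀ᶠ x in 𝓝 p, flow φ g x = deriv c x.2.1 := by
  filter_upwards [hg.eventually_nhds, eventually_u hc.eventually] with x hx hcx
  exact flow_comp_u hx hcx.differentiableAt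

namespace ConstantModulus

variable {A₀ : ℂ} {M₁ : ℝ → ℂ}

theorem type01 (h : ConstantModulus φ p A₀ M₁) : ReducedType01 φ p := by
  filter_upwards [h.modulus, h.shear, eventually_u h.real] with x a b c
  rw [a, b]
  exact ⟨h.unit, c⟩

theorem modulus_p (h : ConstantModulus φ p A₀ M₁) : PPWave.modulus φ p = A₀ :=
  h.modulus.self_of_nhds

theorem shear_p (h : ConstantModulus φ p A₀ M₁) : PPWave.shear φ p = M₁ p.2.1 :=
  h.shear.self_of_nhds

theorem flow_shear (h : ConstantModulus φ p A₀ M₁) :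
    ∀ᶠ x in 𝓝 p, flow φ (PPWave.shear φ) x = deriv M₁ x.2.1 :=
  eventually_flow_comp_u h.shear h.smooth

theorem flow_flow_inv (h : ConstantModulus φ p A₀ M₁) (h0 : M₁ p.2.1 ≠ 0) :
    ∀ᶠ x in 𝓝 p, flow φ (flow φ fun y => (PPWave.shear φ y)⁻¹) x =
      deriv (deriv fun u => (M₁ u)⁻¹) x.2.1 := by
  have hs := h.smooth.inv h0
  refine eventually_flow_comp_u ?_ hs.deriv
  exact eventually_flow_comp_u (c := fun u => (M₁ u)⁻¹)
    (h.shear.mono fun x hx => by rw [hx]) hs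

theorem shear_eventually {P : ℂ → Prop} (h : ConstantModulus φ p A₀ M₁) :
    (∀ᶠ x in 𝓝 p, P (PPWave.shear φ x)) ↔ ∀ᶠ u in 𝓝 p.2.1, P (M₁ u) := by
  constructor
  · intro H
    refine eventually_of_eventually_u ?_
    filter_upwards [H, h.shear] with x a b
    rwa [← b]
  · intro H
    filter_upwards [eventually_u H, h.shear] with x a b
    rwa [b]

/-- On functions of u the derivation ∂_u + q∂_ζ is d/du, so the hypotheses say that 1/M is affine
with nonzero slope. -/
theorem exists_div_affine (h : ConstantModulus φ p A₀ M₁) (h0 : PPWave.shear φ p ≠ 0)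
    (h1 : ∀ᶠ x in 𝓝 p, flow φ (flow φ fun y => (PPWave.shear φ y)⁻¹) x = 0)
    (h2 : flow φ (PPWave.shear φ) p ≠ 0) :
    ∃ (κ : ℂ) (d : ℝ), κ ≠ 0 ∧ p.2.1 + d ≠ 0 ∧ ∀ᶠ u in 𝓝 p.2.1, M₁ u = κ / (u + d) := by
  rw [h.shear_p] at h0
  have hs := h.smooth.inv h0
  have hdd : ∀ᶠ u in 𝓝 p.2.1, deriv (deriv fun u => (M₁ u)⁻¹) u = 0 :=
    eventually_of_eventually_u (by
      filter_upwards [h1, h.flow_flow_inv h0] with x a b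
      rw [← b, a])
  have hk := eventually_eq_affine hs.deriv hdd
  simp only [zero_mul, add_zero] at hk
  have hk0 : deriv (fun u => (M₁ u)⁻¹) p.2.1 ≠ 0 := by
    have hd := h.smooth.differentiableAt.hasDerivAt.inv h0
    have e : deriv (fun u => (M₁ u)⁻¹) p.2.1 = _ := hd.deriv
    rw [e]
    rw [h.flow_shear.self_of_nhds] at h2
    exact div_ne_zero (neg_ne_zero.2 h2) (pow_ne_zero 2 h0)
  obtain ⟨d, hd, hM⟩ := exists_eq_div_affine h.unit h.smooth h0 h.real hk0 hk
  exact ⟨_, d, inv_ne_zero hk0, hd, hM⟩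

theorem of_div_affine (h : ConstantModulus φ p A₀ M₁) {κ : ℂ} {d : ℝ} (hκ : κ ≠ 0)
    (hd : p.2.1 + d ≠ 0) (hM : ∀ᶠ u in 𝓝 p.2.1, M₁ u = κ / (u + d)) :
    PPWave.shear φ p ≠ 0 ∧
    (∀ᶠ x in 𝓝 p, flow φ (flow φ fun y => (PPWave.shear φ y)⁻¹) x = 0) ∧
    flow φ (PPWave.shear φ) p ≠ 0 := by
  have hd' : (p.2.1 : ℂ) + d ≠ 0 := by exact_mod_cast hd
  have h0 : M₁ p.2.1 ≠ 0 := by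
    rw [hM.self_of_nhds]
    exact div_ne_zero hκ hd'
  refine ⟨by rwa [h.shear_p], ?_, ?_⟩
  · have hi : ∀ᶠ u in 𝓝 p.2.1, (M₁ u)⁻¹ = κ⁻¹ * ((u : ℂ) + d) := by
      filter_upwards [hM] with u hu
      rw [hu, inv_div, div_eq_inv_mul]
    have hder : ∀ u : ℝ, deriv (fun u : ℝ => κ⁻¹ * ((u : ℂ) + d)) u = κ⁻¹ := by
      intro u
      have h1 : HasDerivAt (fun u : ℝ => (u : ℂ) + d) 1 u :=
        (Complex.ofRealCLM.hasDerivAt (x := u)).add_const (d : ℂ)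
      simpa using (h1.const_mul κ⁻¹).deriv
    have hdd : ∀ᶠ u in 𝓝 p.2.1, deriv (deriv fun u => (M₁ u)⁻¹) u = 0 := by
      filter_upwards [hi.eventually_nhds.eventually_nhds] with u hu
      have : deriv (fun u => (M₁ u)⁻¹) =ᶠ[𝓝 u] fun _ => κ⁻¹ := by
        filter_upwards [hu] with w hw
        rw [EventuallyEq.deriv_eq hw, hder]
      rw [this.deriv_eq, deriv_const]
    filter_upwards [h.flow_flow_inv h0, eventually_u hdd] with x a b
    rw [a, b]
  · rw [h.flow_shear.self_of_nhds, EventuallyEq.deriv_eq hM, (hasDerivAt_div_affine κ hd).deriv]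
    exact div_ne_zero (neg_ne_zero.2 hκ) (pow_ne_zero 2 hd')

theorem of_const (h : ConstantModulus φ p A₀ M₁) {κ : ℂ}
    (hM : ∀ᶠ u in 𝓝 p.2.1, M₁ u = κ) : ∀ᶠ x in 𝓝 p, flow φ (PPWave.shear φ) x = 0 := by
  filter_upwards [h.flow_shear, eventually_u hM.eventually_nhds] with x a b
  rw [a, EventuallyEq.deriv_eq b, deriv_const]

theorem exists_const (h : ConstantModulus φ p A₀ M₁) (h0 : PPWave.shear φ p ≠ 0)
    (h1 : ∀ᶠ x in 𝓝 p, flow φ (PPWave.shear φ) x = 0) :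
    ∃ κ : ℂ, κ ≠ 0 ∧ ∀ᶠ u in 𝓝 p.2.1, M₁ u = κ := by
  refine ⟨M₁ p.2.1, by rwa [← h.shear_p], ?_⟩
  have := eventually_eq_affine (k := 0) h.smooth (eventually_of_eventually_u (by
    filter_upwards [h1, h.flow_shear] with x a b
    rw [← b, a]))
  simpa using this

end ConstantModulus

/-- Inserting the conjugate of M = A M̄ into itself gives M = A Ā M. Thus B = 0 already forces |A| =
1 where μ ≠ 0, and the conditions of BP and CP need not demand it. -/
theorem type01_of_shear_ne (hr : Regular φ p)
    (hB : ∀ᶠ x in 𝓝 p, shear φ x = modulus φ x * conj (shear φ x)) (h0 : shear φ p ≠ 0) :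
    ReducedType01 φ p := by
  filter_upwards [hB, hr.hol_shear.1.continuousAt.eventually_ne h0] with x hx hx0
  refine ⟨?_, hx⟩
  have hc := congrArg (starRingEnd ℂ) hx
  rw [map_mul, Complex.conj_conj] at hc
  refine mul_left_cancel₀ hx0 ?_
  linear_combination -hx - modulus φ x * hc

theorem type01_of_real (hB : ∀ᶠ x in 𝓝 p, shear φ x = modulus φ x * conj (shear φ x)) {a : ℂ}
    (ha : a * conj a = 1) (hA : ∀ᶠ x in 𝓝 p, modulus φ x = a) : ReducedType01 φ p := by
  filter_upwards [hB, hA] with x hx hx'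
  exact ⟨by rw [hx', ha], hx⟩

theorem normalForm_of_reducedCondition (hr : Regular φ p) {c : SolClass}
    (h : ReducedCondition c φ p) : NormalForm c φ p := by
  have hz : (∀ᶠ x in 𝓝 p, shear φ x = 0) →
      ∀ᶠ x in 𝓝 p, shear φ x = modulus φ x * conj (shear φ x) := fun h => by
    filter_upwards [h] with x hx
    simp [hx]
  have h1 : (1 : ℂ) * conj 1 = 1 := by simp
  have h1' : (-1 : ℂ) * conj (-1) = 1 := by simp
  cases c with
  | BP =>
    obtain ⟨hB, h0, h2, h3, h4⟩ := h
    obtain ⟨A₀, M₁, hC⟩ := (type01_of_shear_ne hr hB h0).exists_constantModulus hr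
    exact ⟨A₀, M₁, hC, hC.modulus_p ▸ h4, hC.exists_div_affine h0 h2 h3⟩
  | CP =>
    obtain ⟨hB, h2, h0, h4⟩ := h
    obtain ⟨A₀, M₁, hC⟩ := (type01_of_shear_ne hr hB h0).exists_constantModulus hr
    exact ⟨A₀, M₁, hC, hC.modulus_p ▸ h4, hC.exists_const h0 h2⟩
  | BE =>
    obtain ⟨hB, hA, h0, h2, h3⟩ := h
    obtain ⟨A₀, M₁, hC⟩ := (type01_of_real hB h1' hA).exists_constantModulus hr
    exact ⟨A₀, M₁, hC, hC.modulus_p.symm.trans hA.self_of_nhds, hC.exists_div_affine h0 h2 h3⟩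
  | CE =>
    obtain ⟨hB, hA, h2, h0⟩ := h
    obtain ⟨A₀, M₁, hC⟩ := (type01_of_real hB h1' hA).exists_constantModulus hr
    exact ⟨A₀, M₁, hC, hC.modulus_p.symm.trans hA.self_of_nhds, hC.exists_const h0 h2⟩
  | L =>
    obtain ⟨hB, hA⟩ := h
    obtain ⟨A₀, M₁, hC⟩ := (type01_of_real hB h1 hA).exists_constantModulus hr
    exact ⟨A₀, M₁, hC, hC.modulus_p.symm.trans hA.self_of_nhds⟩
  | BL =>
    obtain ⟨hB, hA, h2, h0⟩ := h
    obtain ⟨A₀, M₁, hC⟩ := (type01_of_real hB h1 hA).exists_constantModulus hr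
    refine ⟨A₀, M₁, hC, hC.modulus_p.symm.trans hA.self_of_nhds, ?_⟩
    rw [hC.shear_p] at h0
    have hd : ∀ᶠ u in 𝓝 p.2.1, deriv M₁ u = M₁ u ^ 2 := eventually_of_eventually_u (by
      filter_upwards [h2, hC.flow_shear, hC.shear] with x a b c
      rw [← b, a, c])
    -- The Riccati equation M' = M² is linear in 1/M.
    have hi : ∀ᶠ u in 𝓝 p.2.1, deriv (fun u => (M₁ u)⁻¹) u = -1 := by
      filter_upwards [hd, hC.smooth.eventually, hC.smooth.continuousAt.eventually_ne h0]
        with u a b c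
      have e : deriv (fun u => (M₁ u)⁻¹) u = _ := (b.differentiableAt.hasDerivAt.inv c).deriv
      rw [e, a]
      field_simp
    obtain ⟨d, hd0, hM⟩ := exists_eq_div_affine hC.unit hC.smooth h0 hC.real (by norm_num) hi
    exact ⟨d, hd0, by simpa [inv_neg] using hM⟩
  | AP =>
    obtain ⟨hM, hA, hA2⟩ := h
    obtain ⟨A₀, M₁, hC⟩ := ReducedType01.exists_constantModulus hr (hA.and (hz hM))
    exact ⟨A₀, M₁, hC, hC.modulus_p ▸ hA2, (hC.shear_eventually (P := fun z => z = 0)).1 hM⟩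
  | AE =>
    obtain ⟨hM, hA⟩ := h
    obtain ⟨A₀, M₁, hC⟩ := (type01_of_real (hz hM) h1' hA).exists_constantModulus hr
    exact ⟨A₀, M₁, hC, hC.modulus_p.symm.trans hA.self_of_nhds,
      (hC.shear_eventually (P := fun z => z = 0)).1 hM⟩
  | AL =>
    obtain ⟨hM, hA⟩ := h
    obtain ⟨A₀, M₁, hC⟩ := (type01_of_real (hz hM) h1 hA).exists_constantModulus hr
    exact ⟨A₀, M₁, hC, hC.modulus_p.symm.trans hA.self_of_nhds,
      (hC.shear_eventually (P := fun z => z = 0)).1 hM⟩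

theorem reducedCondition_of_normalForm {c : SolClass} (h : NormalForm c φ p) :
    ReducedCondition c φ p := by
  obtain ⟨A₀, M₁, hC, h⟩ := h
  have hB : ∀ᶠ x in 𝓝 p, shear φ x = modulus φ x * conj (shear φ x) :=
    hC.type01.mono fun x hx => hx.2
  have hU : ∀ᶠ x in 𝓝 p, modulus φ x * conj (modulus φ x) = 1 := hC.type01.mono fun x hx => hx.1
  have hz := (hC.shear_eventually (P := fun z => z = 0)).2
  have hne : ∀ κ : ℂ, κ ≠ 0 → (∀ᶠ u in 𝓝 p.2.1, M₁ u = κ) → shear φ p ≠ 0 := fun κ hκ h => by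
    rwa [hC.shear_p, h.self_of_nhds]
  cases c with
  | BP =>
    obtain ⟨h2, κ, d, hκ, hd, hM⟩ := h
    obtain ⟨a, b, c⟩ := hC.of_div_affine hκ hd hM
    exact ⟨hB, a, b, c, by rwa [hC.modulus_p]⟩
  | CP =>
    obtain ⟨h2, κ, hκ, hM⟩ := h
    exact ⟨hB, hC.of_const hM, hne κ hκ hM, by rwa [hC.modulus_p]⟩
  | BE =>
    obtain ⟨rfl, κ, d, hκ, hd, hM⟩ := h
    obtain ⟨a, b, c⟩ := hC.of_div_affine hκ hd hM
    exact ⟨hB, hC.modulus, a, b, c⟩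
  | CE =>
    obtain ⟨rfl, κ, hκ, hM⟩ := h
    exact ⟨hB, hC.modulus, hC.of_const hM, hne κ hκ hM⟩
  | L =>
    obtain rfl : A₀ = 1 := h
    exact ⟨hB, hC.modulus⟩
  | BL =>
    obtain ⟨rfl, d, hd, hM⟩ := h
    refine ⟨hB, hC.modulus, ?_, (hC.of_div_affine (neg_ne_zero.2 one_ne_zero) hd hM).1⟩
    filter_upwards [hC.flow_shear, hC.shear, eventually_u hM.eventually_nhds,
      eventually_u (continuousAt_add_ne hd)] with x a b c e
    rw [a, b, EventuallyEq.deriv_eq c, c.self_of_nhds, (hasDerivAt_div_affine _ e).deriv, div_pow]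
    norm_num
  | AP => exact ⟨hz h.2, hU, by rw [hC.modulus_p]; exact h.1⟩
  | AE =>
    obtain ⟨rfl, hM⟩ := h
    exact ⟨hz hM, hC.modulus⟩
  | AL =>
    obtain ⟨rfl, hM⟩ := h
    exact ⟨hz hM, hC.modulus⟩

/-- The constant of the vector field preserving `ω¹` and `ω³`. -/
theorem exists_rotation_rate {A z : ℂ} (hA : A * conj A = 1) (hA1 : A ≠ 1)
    (hz : z = A * conj z) : ∃ c : ℝ, Complex.I * c * (1 - A) / 2 = z := by
  have h1 : 1 - A ≠ 0 := sub_ne_zero.2 (Ne.symm hA1)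
  have h1' : 1 - conj A ≠ 0 := by
    have := (map_ne_zero (starRingEnd ℂ)).2 h1
    simpa using this
  -- This is the equation solved for c. The quotient is real because z and i(1 - A) both satisfy x =
  -- A x̄.
  set w := 2 * z / (Complex.I * (1 - A)) with hw
  have hwr : conj w = w := by
    rw [hw]
    simp only [map_div₀, map_mul, map_sub, map_one, Complex.conj_I, map_ofNat]
    rw [div_eq_div_iff (mul_ne_zero (neg_ne_zero.2 Complex.I_ne_zero) h1')
      (mul_ne_zero Complex.I_ne_zero h1)]
    have hzc : conj z = conj A * z := by
      conv_lhs => rw [hz]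
      simp
    rw [hzc]
    linear_combination (-2 * Complex.I * z) * hA
  refine ⟨w.re, ?_⟩
  rw [Complex.conj_eq_iff_re.1 hwr, hw]
  field_simp

/-- Explicit constants solve the equation. For A = 1 take c alone, for M = 0 take y₀ alone. For M =
κ take y₀ = 1 and ic(1 - A)/2 = κ; for M = κ/(u + d) take y₀ = d, y₁ = 1 and ic(1 - A)/2 = κ + (A +
1)/2. A real c exists because both right-hand sides satisfy z = A z̄. -/
theorem reducedPrecursor_of_normalForm {c : SolClass} (h : NormalForm c φ p) :
    ReducedPrecursor φ p := by
  obtain ⟨A₀, M₁, hC, h⟩ := h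
  have hL : A₀ = 1 → ReducedPrecursor φ p := by
    rintro rfl
    refine ⟨0, 0, 1, by simp, ?_⟩
    filter_upwards [hC.modulus] with x a
    rw [a]
    simp
    norm_num
  have hZ : (∀ᶠ u in 𝓝 p.2.1, M₁ u = 0) → ReducedPrecursor φ p := by
    intro hM
    refine ⟨1, 0, 0, by simp, ?_⟩
    filter_upwards [hC.shear, eventually_u hM] with x a b
    rw [a, b]
    simp
  have hK : A₀ ≠ 1 → (∃ κ : ℂ, κ ≠ 0 ∧ ∀ᶠ u in 𝓝 p.2.1, M₁ u = κ) → ReducedPrecursor φ p := by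
    rintro h1 ⟨κ, -, hM⟩
    obtain ⟨c, hc⟩ := exists_rotation_rate hC.unit h1 (z := κ) (by
      rw [← hM.self_of_nhds]
      exact hC.real.self_of_nhds)
    refine ⟨1, 0, c, by simp, ?_⟩
    filter_upwards [hC.shear, hC.modulus, eventually_u hM] with x a a' b
    rw [a, a', b]
    push_cast
    linear_combination hc
  have hD : A₀ ≠ 1 → (∃ (κ : ℂ) (d : ℝ), κ ≠ 0 ∧ p.2.1 + d ≠ 0 ∧
      ∀ᶠ u in 𝓝 p.2.1, M₁ u = κ / (u + d)) → ReducedPrecursor φ p := by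
    rintro h1 ⟨κ, d, -, hd, hM⟩
    have hκ : κ = A₀ * conj κ := by
      have hd' : (p.2.1 : ℂ) + d ≠ 0 := by exact_mod_cast hd
      have := hC.real.self_of_nhds
      rw [hM.self_of_nhds] at this
      simp only [map_div₀, map_add, Complex.conj_ofReal] at this
      field_simp at this
      exact this
    obtain ⟨c, hc⟩ := exists_rotation_rate hC.unit h1 (z := κ + (A₀ + 1) / 2) (by
      simp only [map_add, map_div₀, map_one, map_ofNat]
      linear_combination hκ - hC.unit / 2)
    refine ⟨d, 1, c, by simp, ?_⟩
    filter_upwards [hC.shear, hC.modulus, eventually_u hM, eventually_u (continuousAt_add_ne hd)]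
      with x a a' b e
    have e' : (x.2.1 : ℂ) + d ≠ 0 := by exact_mod_cast e
    rw [a, a', b]
    push_cast
    have : κ / (x.2.1 + d) * (d + 1 * x.2.1) = κ := by
      field_simp
      ring
    linear_combination hc - this
  cases c with
  | BP => exact hD (by rintro rfl; simp at h) h.2
  | CP => exact hK (by rintro rfl; simp at h) h.2
  | BE => exact hD (by rw [h.1]; norm_num) h.2
  | CE => exact hK (by rw [h.1]; norm_num) h.2
  | L => exact hL h
  | BL => exact hL h.1
  | AP => exact hZ h.2
  | AE => exact hZ h.2
  | AL => exact hZ h.2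

/-- For A = 1 the class L imposes nothing further. Otherwise M(y₀ + y₁u) is a constant κ, and the
cases κ = 0, then y₁ = 0, then y₁ ≠ 0 give the three shapes of M. Whether A = -1 or A² ≠ 1 decides
between exponential and power. -/
theorem exists_normalForm (hr : Regular φ p) (ht : ReducedType01 φ p)
    (hp : ReducedPrecursor φ p) : ∃ c, NormalForm c φ p := by
  obtain ⟨A₀, M₁, hC⟩ := ht.exists_constantModulus hr
  obtain ⟨y₀, y₁, c, hne, hc⟩ := hp
  by_cases h1 : A₀ = 1
  · exact ⟨.L, A₀, M₁, hC, h1⟩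
  set κ : ℂ := Complex.I * c - (y₁ + Complex.I * c) * (A₀ + 1) / 2 with hκ
  have hMY : ∀ᶠ u in 𝓝 p.2.1, M₁ u * (y₀ + y₁ * u) = κ := eventually_of_eventually_u (by
    filter_upwards [hc, hC.shear, hC.modulus] with x a b d
    rw [b, d] at a
    linear_combination -a)
  have hdich : A₀ = -1 ∨ A₀ ^ 2 ≠ 1 := by
    by_contra! h
    rcases mul_self_eq_one_iff.1 ((sq A₀).symm.trans h.2) with h' | h'
    exacts [h1 h', h.1 h']
  by_cases hκ0 : κ = 0
  -- With y₀ = y₁ = 0 the value of κ is ic(1 - A)/2, so κ = 0 and A ≠ 1 would force c = 0 as well.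
  · have hY : y₀ ≠ 0 ∨ y₁ ≠ 0 := by
      by_contra! h
      obtain ⟨rfl, rfl⟩ := h
      have hc0 : c ≠ 0 := by simpa using hne
      have : Complex.I * c * (1 - A₀) = 0 := by
        rw [hκ] at hκ0
        push_cast at hκ0
        linear_combination 2 * hκ0
      simp [hc0, sub_eq_zero] at this
      exact h1 this.symm
    have hM : ∀ᶠ u in 𝓝 p.2.1, M₁ u = 0 := by
      filter_upwards [hMY.eventually_nhds, hC.smooth.eventually] with u hu hs
      have h0 := hu.self_of_nhds
      rw [hκ0] at h0
      rcases mul_eq_zero.1 h0 with h | h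
      · exact h
      -- At a zero of the affine factor the product rule leaves M y₁ = 0, and y₁ = 0 would make the
      -- factor vanish identically.
      · have hd : HasDerivAt (fun u : ℝ => M₁ u * (y₀ + y₁ * (u : ℂ)))
            (deriv M₁ u * (y₀ + y₁ * (u : ℂ)) + M₁ u * y₁) u := by
          have ha : HasDerivAt (fun u : ℝ => (y₀ : ℂ) + y₁ * (u : ℂ)) y₁ u := by
            simpa using ((Complex.ofRealCLM.hasDerivAt (x := u)).const_mul (y₁ : ℂ)).const_add
              (y₀ : ℂ)
          exact hs.differentiableAt.hasDerivAt.mul ha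
        have hd0 : HasDerivAt (fun u : ℝ => M₁ u * (y₀ + y₁ * (u : ℂ))) 0 u :=
          (hasDerivAt_const u κ).congr_of_eventuallyEq hu
        have e := hd.unique hd0
        rw [h, mul_zero, zero_add] at e
        refine (mul_eq_zero.1 e).resolve_right fun hy => ?_
        have hy' : y₁ = 0 := by exact_mod_cast hy
        rw [hy, zero_mul, add_zero] at h
        have h' : y₀ = 0 := by exact_mod_cast h
        exact hY.elim (fun a => a h') fun a => a hy'
    rcases hdich with h | h
    · exact ⟨.AE, A₀, M₁, hC, h, hM⟩
    · exact ⟨.AP, A₀, M₁, hC, h, hM⟩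
  · by_cases hy : y₁ = 0
    · have hy0 : (y₀ : ℂ) ≠ 0 := by
        intro h
        have := hMY.self_of_nhds
        simp [h, hy] at this
        exact hκ0 this.symm
      have hM : ∃ κ : ℂ, κ ≠ 0 ∧ ∀ᶠ u in 𝓝 p.2.1, M₁ u = κ := by
        refine ⟨κ / y₀, div_ne_zero hκ0 hy0, ?_⟩
        filter_upwards [hMY] with u hu
        rw [← hu, hy]
        field_simp
        simp
      rcases hdich with h | h
      · exact ⟨.CE, A₀, M₁, hC, h, hM⟩
      · exact ⟨.CP, A₀, M₁, hC, h, hM⟩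
    · have hy' : (y₁ : ℂ) ≠ 0 := by exact_mod_cast hy
      have hY : ∀ u : ℝ, (y₀ : ℂ) + y₁ * u = y₁ * (u + (y₀ / y₁ : ℝ)) := by
        intro u
        push_cast
        field_simp
        ring
      have hM : ∃ (κ : ℂ) (d : ℝ), κ ≠ 0 ∧ p.2.1 + d ≠ 0 ∧
          ∀ᶠ u in 𝓝 p.2.1, M₁ u = κ / (u + d) := by
        have hd : p.2.1 + y₀ / y₁ ≠ 0 := by
          intro h
          have := hMY.self_of_nhds
          rw [hY, ← Complex.ofReal_add, h] at this
          simp at this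
          exact hκ0 this.symm
        refine ⟨κ / y₁, y₀ / y₁, div_ne_zero hκ0 hy', hd, ?_⟩
        filter_upwards [hMY, continuousAt_add_ne hd] with u hu hu0
        have hu0' : (u : ℂ) + (y₀ / y₁ : ℝ) ≠ 0 := by exact_mod_cast hu0
        rw [hY] at hu
        rw [eq_div_iff hu0', eq_div_iff hy', ← hu]
        ring
      rcases hdich with h | h
      · exact ⟨.BE, A₀, M₁, hC, h, hM⟩
      · exact ⟨.BP, A₀, M₁, hC, h, hM⟩

end

/-! ### Form-preserving coordinate transformations -/

theorem exists_antideriv {ρ : ℝ → ℝ} {t : ℝ} (h : SmoothNear ρ t) :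
    ∃ r : ℝ → ℝ, SmoothNear r t ∧ ∀ᶠ u in 𝓝 t, deriv r u = ρ u := by
  obtain ⟨ε, hε, hb⟩ := Metric.eventually_nhds_iff_ball.1 h
  have hc : ContDiffOn ℝ ∞ ρ (Metric.ball t ε) := fun u hu => (hb u hu).contDiffWithinAt
  have hd : ∀ u ∈ Metric.ball t ε, HasDerivAt (fun u => ∫ s in t..u, ρ s) (ρ u) u := by
    intro u hu
    refine intervalIntegral.integral_hasDerivAt_right ?_
      (hc.continuousOn.stronglyMeasurableAtFilter Metric.isOpen_ball u hu)
      (hb u hu).continuousAt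
    refine (hc.continuousOn.mono ?_).intervalIntegrable
    exact (convex_ball t ε).ordConnected.uIcc_subset (Metric.mem_ball_self hε) hu
  have hball := Metric.ball_mem_nhds t hε
  refine ⟨fun u => ∫ s in t..u, ρ s, ?_, ?_⟩
  · have : ContDiffOn ℝ ∞ (fun u => ∫ s in t..u, ρ s) (Metric.ball t ε) := by
      rw [contDiffOn_infty_iff_deriv_of_isOpen Metric.isOpen_ball]
      exact ⟨fun u hu => (hd u hu).differentiableAt.differentiableWithinAt,
        hc.congr fun u hu => (hd u hu).deriv⟩
    filter_upwards [hball] with u hu using this.contDiffAt (Metric.isOpen_ball.mem_nhds hu)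
  · filter_upwards [hball] with u hu using (hd u hu).deriv

/-- The action of a coordinate transformation on the `(ζ, u)`-space. -/
noncomputable def tau (a k u₀ : ℝ) (h : ℝ → ℂ) (x : Spacetime) : ℂ × ℝ :=
  (Complex.exp (Complex.I * k) * (x.1 + h x.2.1), (x.2.1 + u₀) / a)

theorem exp_I_mul_conj (k : ℝ) :
    Complex.exp (Complex.I * k) * conj (Complex.exp (Complex.I * k)) = 1 := by
  rw [← Complex.exp_conj, ← Complex.exp_add]
  simp

theorem hasDerivAt_ofReal_comp {r : ℝ → ℝ} {r' t : ℝ} (h : HasDerivAt r r' t) :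
    HasDerivAt (fun u => (r u : ℂ)) (r' : ℂ) t :=
  (Complex.ofRealCLM.hasFDerivAt (x := r t)).comp_hasDerivAt t h

/-- The terms with h' in the new v cancel the cross terms of du with dζ and dζ̄, and the factors a
and 1/a cancel in du dv. Only the du² coefficient is a genuine condition. -/
theorem pullsBack_iff {a k u₀ : ℝ} {h : ℝ → ℂ} {r : ℝ → ℝ} {F f : ℂ × ℝ → ℂ} {p : Spacetime}
    (ha : a ≠ 0) (hh : SmoothNear h p.2.1) (hr : SmoothNear r p.2.1) :
    PullsBack (transf a k u₀ h r) F f p ↔ ∀ᶠ x in 𝓝 p, profile f x =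
      (F (tau a k u₀ h x) + conj (F (tau a k u₀ h x))) / a ^ 2
        + 2 * (deriv (deriv h) x.2.1 * conj x.1 + conj (deriv (deriv h) x.2.1) * x.1)
        + 2 * deriv r x.2.1 - 2 * (deriv h x.2.1 * conj (deriv h x.2.1)) := by
  refine eventually_congr ?_
  filter_upwards [eventually_u hh.eventually, eventually_u hr.eventually] with x hx hrx
  set e := Complex.exp (Complex.I * k) with he
  have hee : e * conj e = 1 := exp_I_mul_conj k
  have ha' : (a : ℂ) ≠ 0 := by exact_mod_cast ha
  have dh := HasPd.comp_u hx.differentiableAt.hasDerivAt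
  have dh' := HasPd.comp_u hx.deriv.differentiableAt.hasDerivAt
  have dr := HasPd.comp_u (hasDerivAt_ofReal_comp hrx.differentiableAt.hasDerivAt)
  have d0 : HasPd (fun y => coord 0 (transf a k u₀ h r y)) _ x :=
    ((HasPd.const e x).mul ((HasPd.fst x).add dh))
  have d1 : HasPd (fun y => coord 1 (transf a k u₀ h r y)) _ x := d0.conj
  have d2 : HasPd (fun y => coord 2 (transf a k u₀ h r y)) _ x :=
    ((hasPd_affine (u₀ / a) (1 / a) x)).congr (Eventually.of_forall fun y => by
      simp [coord, transf]
      ring)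
  have d3 : HasPd (fun y => coord 3 (transf a k u₀ h r y)) _ x :=
    ((HasPd.const (a : ℂ) x).mul (((HasPd.v x).add
      ((dh'.mul (HasPd.fst x).conj).add (dh'.conj.mul (HasPd.fst x)))).add dr)).congr
      (Eventually.of_forall fun y => by
        have : ∀ z : ℂ, ((2 * z.re : ℝ) : ℂ) = z + conj z := fun z => by
          rw [Complex.add_conj]
        simp only [coord, transf]
        rw [Complex.ofReal_mul, Complex.ofReal_add, Complex.ofReal_add, this]
        simp)
  have key : ∀ i j : Fin 4, ∑ r', ∑ s, pd i (fun y => coord r' (transf a k u₀ h r y)) x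
      * pd j (fun y => coord s (transf a k u₀ h r y)) x * metric F (transf a k u₀ h r x) r' s =
      if i = 2 ∧ j = 2 then
        -((F (tau a k u₀ h x) + conj (F (tau a k u₀ h x))) / a ^ 2
        + 2 * (deriv (deriv h) x.2.1 * conj x.1 + conj (deriv (deriv h) x.2.1) * x.1)
        + 2 * deriv r x.2.1 - 2 * (deriv h x.2.1 * conj (deriv h x.2.1)))
      else metric f x i j := by
    intro i j
    have hF : F (tau a k u₀ h x) = F ((transf a k u₀ h r x).1, (transf a k u₀ h r x).2.1) := rfl
    rw [hF]
    simp only [Fin.sum_univ_four, d0.2, d1.2, d2.2, d3.2, metric]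
    generalize F ((transf a k u₀ h r x).1, (transf a k u₀ h r x).2.1) = Φ
    fin_cases i <;> fin_cases j <;> simp [Equiv.swap_apply_def] <;> field_simp <;>
      first
      | linear_combination hee
      | linear_combination (deriv h x.2.1) * hee
      | linear_combination (conj (deriv h x.2.1)) * hee
      | linear_combination (2 * a ^ 2 * deriv h x.2.1 * conj (deriv h x.2.1)) * hee
  have hm : metric f x 2 2 = -profile f x := by simp [metric, profile, lift]
  constructor
  · intro H
    have := H 2 2
    rw [key, if_pos ⟨rfl, rfl⟩, hm] at this
    exact neg_injective this
  · intro H i j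
    rw [key]
    split_ifs with hij
    · rw [hij.1, hij.2, hm, H]
    · rfl

/-! ### Passing between f and its second ζ-derivative -/

section Hess

variable {f : ℂ × ℝ → ℂ} {p : Spacetime} {K : Spacetime → ℂ}

/-- Only f + f̄ is known, but one ∂_ζ removes the antiholomorphic terms and a second one the affine
function. -/
theorem hess_eq_of_profile (hf : Hol (lift f) p) (hK : Hol K p) {α β : ℝ → ℂ}
    (hα : SmoothNear α p.2.1) (hβ : SmoothNear β p.2.1)
    (h : ∀ᶠ x in 𝓝 p, profile f x = K x + conj (K x) + (α x.2.1 * x.1 + β x.2.1)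
      + conj (α x.2.1 * x.1 + β x.2.1)) : ∀ᶠ x in 𝓝 p, hess f x = pd 0 (pd 0 K) x := by
  have hlin : Hol (fun x => α x.2.1 * x.1 + β x.2.1) p :=
    ((Hol.comp_u hα).mul (Hol.fst p)).add (Hol.comp_u hβ)
  have h1 : ∀ᶠ x in 𝓝 p, pd 0 (lift f) x = pd 0 K x + α x.2.1 := by
    filter_upwards [h.eventually_nhds, hf.eventually, hK.eventually, hlin.eventually,
      eventually_u hα.eventually, eventually_u hβ.eventually] with x hx hfx hKx hlx ha hb
    have dl := (((HasPd.comp_u ha.differentiableAt.hasDerivAt).mul (HasPd.fst x)).add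
      (HasPd.comp_u hb.differentiableAt.hasDerivAt)).2 0
    have l := (hasPd_profile hfx).2 0
    have r := (((hKx.hasPd.add hKx.hasPd_conj).add hlx.hasPd).add hlx.hasPd_conj).2 0
    rw [← pd_congr 0 hx, l] at r
    simp only [dl] at r
    simpa using r
  filter_upwards [h1.eventually_nhds, hK.eventually, eventually_u hα.eventually] with x hx hKx ha
  rw [hess, pd_congr 0 hx]
  have := ((hKx.pd 0).hasPd.add (HasPd.comp_u ha.differentiableAt.hasDerivAt)).2 0
  rw [this]
  simp

theorem exists_affine_of_hess_eq (hf : Hol (lift f) p) (hK : Hol K p)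
    (h : ∀ᶠ x in 𝓝 p, hess f x = pd 0 (pd 0 K) x) : ∃ α β : ℝ → ℂ, SmoothNear α p.2.1 ∧
      SmoothNear β p.2.1 ∧ ∀ᶠ x in 𝓝 p, lift f x = K x + (α x.2.1 * x.1 + β x.2.1) := by
  have hR := hf.sub hK
  have e1 : ∀ᶠ x in 𝓝 p, pd 0 (fun y => lift f y - K y) x = pd 0 (lift f) x - pd 0 K x := by
    filter_upwards [hf.eventually, hK.eventually] with x a b using (a.1.hasPd.sub b.1.hasPd).2 0
  obtain ⟨α, hα, hα'⟩ := (hR.pd 0).exists_eq_comp_u (by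
    filter_upwards [e1.eventually_nhds, h, hf.eventually, hK.eventually] with x a b c d
    rw [pd_congr 0 a, ((c.pd 0).1.hasPd.sub (d.pd 0).1.hasPd).2 0]
    exact sub_eq_zero.2 b)
  obtain ⟨β, hβ, hβ'⟩ := (hR.sub ((Hol.comp_u hα).mul (Hol.fst p))).exists_eq_comp_u (by
    filter_upwards [hα', hR.eventually, eventually_u hα.eventually] with x a b c
    refine ((b.1.hasPd.sub
      ((HasPd.comp_u c.differentiableAt.hasDerivAt).mul (HasPd.fst x))).2 0).trans ?_
    simp only [a]
    simp)
  refine ⟨α, β, hα, hβ, ?_⟩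
  filter_upwards [hβ'] with x hx
  linear_combination hx

end Hess

theorem smoothNear_tau {a k u₀ : ℝ} {h : ℝ → ℂ} {p : Spacetime} (hh : SmoothNear h p.2.1) :
    SmoothNear (tau a k u₀ h) p := by
  refine SmoothNear.prodMk ((SmoothNear.const _ _).mul ((smoothNear_fst p).add hh.comp_u)) ?_
  exact SmoothNear.comp (φ := fun x : Spacetime => x.2.1) (g := fun u : ℝ => (u + u₀) / a)
    (smoothNear_of_contDiff (by fun_prop) _) (smoothNear_u p)

theorem smoothNear_rescale {E : Type*} [NormedAddCommGroup E] [NormedSpace ℝ E] {c : ℝ → E}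
    {a u₀ t : ℝ} (h : SmoothNear c ((t + u₀) / a)) : SmoothNear (fun u => c ((u + u₀) / a)) t :=
  SmoothNear.comp (φ := fun u : ℝ => (u + u₀) / a) h
    (smoothNear_of_contDiff (by fun_prop) _)

/-- The pulled back main part of a solution. -/
noncomputable def pullback (a k u₀ : ℝ) (h : ℝ → ℂ) (F : ℂ × ℝ → ℂ) (x : Spacetime) : ℂ :=
  F (tau a k u₀ h x) / a ^ 2

/-- The contributions of gζ, h'', r' and |h'|² to f + f̄ are all of the form αζ + β plus its
conjugate, so they do not survive two ζ-derivatives. -/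
theorem hess_eq_of_pullsBack {a k u₀ : ℝ} {h : ℝ → ℂ} {r : ℝ → ℝ} {F F₀ f : ℂ × ℝ → ℂ}
    {p : Spacetime} {g : ℝ → ℂ} (ha : a ≠ 0) (hh : SmoothNear h p.2.1) (hr : SmoothNear r p.2.1)
    (hf : Hol (lift f) p) (hg : SmoothNear g ((p.2.1 + u₀) / a))
    (hF : ∀ᶠ y in 𝓝 (tau a k u₀ h p), F y = F₀ y + g y.2 * y.1)
    (hK : Hol (pullback a k u₀ h F₀) p) (hP : PullsBack (transf a k u₀ h r) F f p) :
    ∀ᶠ x in 𝓝 p, hess f x = pd 0 (pd 0 (pullback a k u₀ h F₀)) x := by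
  rw [pullsBack_iff ha hh hr] at hP
  have ha' : (a : ℂ) ≠ 0 := by exact_mod_cast ha
  set e := Complex.exp (Complex.I * k) with he
  have hg' := smoothNear_rescale hg
  refine hess_eq_of_profile hf hK
    (α := fun u => g ((u + u₀) / a) * e * ((a : ℂ) ^ 2)⁻¹ + 2 * conj (deriv (deriv h) u))
    (β := fun u => g ((u + u₀) / a) * e * ((a : ℂ) ^ 2)⁻¹ * h u
      + (deriv r u - deriv h u * conj (deriv h u)))
    (((hg'.mul (SmoothNear.const _ _)).mul (SmoothNear.const _ _)).add
      ((SmoothNear.const _ _).mul hh.deriv.deriv.conj))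
    ((((hg'.mul (SmoothNear.const _ _)).mul (SmoothNear.const _ _)).mul hh).add
      (hr.deriv.ofReal.sub (hh.deriv.mul hh.deriv.conj))) ?_
  filter_upwards [hP, (smoothNear_tau hh).continuousAt.eventually hF] with x hx hFx
  rw [hx, hFx, pullback, tau]
  simp only [map_add, map_mul, map_sub, map_div₀, map_pow, Complex.conj_conj, Complex.conj_ofReal,
    map_inv₀, map_ofNat]
  field_simp
  ring

/-- Write f = K + αζ + β with K the pulled back main part. The part γ of α not produced by h''
defines g in the new variable, and r' absorbs the real part of β - γh together with |h'|². The
imaginary part of the ζ-free term does not affect the metric. -/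
theorem exists_pullsBack {a k u₀ : ℝ} {h : ℝ → ℂ} {F₀ f : ℂ × ℝ → ℂ} {p : Spacetime} (ha : a ≠ 0)
    (hh : SmoothNear h p.2.1) (hf : Hol (lift f) p) (hK : Hol (pullback a k u₀ h F₀) p)
    (h0 : ∀ᶠ x in 𝓝 p, hess f x = pd 0 (pd 0 (pullback a k u₀ h F₀)) x) :
    ∃ (r : ℝ → ℝ) (g : ℝ → ℂ), SmoothNear r p.2.1 ∧ SmoothNear g ((p.2.1 + u₀) / a) ∧
      PullsBack (transf a k u₀ h r) (fun y => F₀ y + g y.2 * y.1) f p := by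
  obtain ⟨α, β, hα, hβ, hl⟩ := exists_affine_of_hess_eq hf hK h0
  have ha' : (a : ℂ) ≠ 0 := by exact_mod_cast ha
  set e := Complex.exp (Complex.I * k) with he
  have he0 : e ≠ 0 := Complex.exp_ne_zero _
  have hec : conj e ≠ 0 := by simpa using he0
  have hγ : SmoothNear (fun u => α u - 2 * conj (deriv (deriv h) u)) p.2.1 :=
    hα.sub ((SmoothNear.const _ _).mul hh.deriv.deriv.conj)
  set γ : ℝ → ℂ := fun u => α u - 2 * conj (deriv (deriv h) u) with hγdef
  obtain ⟨r, hr, hr'⟩ := exists_antideriv ((hβ.sub (hγ.mul hh)).add (hh.deriv.mul hh.deriv.conj)).re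
  have hg : SmoothNear (fun s : ℝ => γ (a * s - u₀) * (e⁻¹ * (a : ℂ) ^ 2)) ((p.2.1 + u₀) / a) := by
    refine SmoothNear.mul ?_ (SmoothNear.const _ _)
    refine SmoothNear.comp (φ := fun s : ℝ => a * s - u₀) (g := γ) ?_
      (smoothNear_of_contDiff (by fun_prop) _)
    convert hγ using 1
    field_simp
    ring
  refine ⟨r, _, hr, hg, (pullsBack_iff ha hh hr).2 ?_⟩
  filter_upwards [hl, eventually_u hr'] with x hx hrx
  have e2 : a * ((x.2.1 + u₀) / a) - u₀ = x.2.1 := by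
    field_simp
    ring
  have hre : ∀ z : ℂ, 2 * (z.re : ℂ) = z + conj z := fun z => by
    rw [Complex.add_conj]; push_cast; ring
  rw [profile, hx, hrx, hre, pullback]
  simp only [tau, e2, hγdef]
  simp only [map_add, map_mul, map_sub, map_div₀, map_pow, Complex.conj_conj, Complex.conj_ofReal,
    map_inv₀, map_ofNat]
  rw [← he]
  field_simp
  ring

/-! ### Branches of the logarithm and phase factors -/

theorem IsLogBranch.ne_zero {ℓ : ℂ → ℂ} {w : ℂ} (h : IsLogBranch ℓ w) : w ≠ 0 := by
  rw [← h.2.self_of_nhds]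
  exact Complex.exp_ne_zero _

theorem IsLogBranch.eventually_hasDerivAt {ℓ : ℂ → ℂ} {w : ℂ} (h : IsLogBranch ℓ w) :
    ∀ᶠ z in 𝓝 w, z ≠ 0 ∧ HasDerivAt ℓ z⁻¹ z := by
  filter_upwards [h.1.eventually_analyticAt, h.2.eventually_nhds] with z hz he
  have h0 : z ≠ 0 := by
    rw [← he.self_of_nhds]
    exact Complex.exp_ne_zero _
  refine ⟨h0, ?_⟩
  have h1 := hz.differentiableAt.hasDerivAt
  have h2 : HasDerivAt (fun z => Complex.exp (ℓ z)) 1 z :=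
    (hasDerivAt_id z).congr_of_eventuallyEq he
  have h3 := h1.cexp.unique h2
  rw [he.self_of_nhds] at h3
  rwa [eq_inv_of_mul_eq_one_right h3] at h1

/-- Transports a branch along z ↦ z exp c, so that a constant factor of a power can be traded for a
factor of its base. -/
theorem isLogBranch_shift {ℓ : ℂ → ℂ} {w : ℂ} (h : IsLogBranch ℓ w) (c : ℂ) :
    IsLogBranch (fun z => ℓ (z * Complex.exp (-c)) + c) (w * Complex.exp c) := by
  have e : w * Complex.exp c * Complex.exp (-c) = w := by
    rw [mul_assoc, ← Complex.exp_add]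
    simp
  refine ⟨?_, ?_⟩
  · refine AnalyticAt.add ?_ analyticAt_const
    refine AnalyticAt.fun_comp (f := fun z => z * Complex.exp (-c)) (g := ℓ) ?_ (by fun_prop)
    rw [e]
    exact h.1
  · have hc : ContinuousAt (fun z : ℂ => z * Complex.exp (-c)) (w * Complex.exp c) := by fun_prop
    have h2 : ∀ᶠ z in 𝓝 (w * Complex.exp c * Complex.exp (-c)), Complex.exp (ℓ z) = z := by
      rw [e]
      exact h.2
    filter_upwards [hc.eventually h2] with z hz
    rw [Complex.exp_add, hz, mul_assoc, ← Complex.exp_add]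
    simp

theorem exists_isLogBranch {w : ℂ} (h : w ≠ 0) : ∃ ℓ, IsLogBranch ℓ w := by
  have h1 : IsLogBranch Complex.log 1 := by
    refine ⟨analyticAt_clog (by simp), ?_⟩
    filter_upwards [eventually_ne_nhds one_ne_zero] with z hz using Complex.exp_log hz
  have := isLogBranch_shift h1 (Complex.log w)
  rw [Complex.exp_log h, one_mul] at this
  exact ⟨_, this⟩

/-- A nonvanishing smooth function of `u` with logarithmic derivative `i θ`, `θ` real. -/
structure PhaseFactor (E : ℝ → ℂ) (θ : ℝ → ℝ) (t : ℝ) : Prop where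
  smooth : SmoothNear E t
  smooth_rate : SmoothNear θ t
  ne : E t ≠ 0
  deriv : ∀ᶠ u in 𝓝 t, HasDerivAt E (Complex.I * θ u * E u) u

namespace PhaseFactor

variable {E : ℝ → ℂ} {θ : ℝ → ℝ} {t : ℝ}

theorem const {c : ℂ} (hc : c ≠ 0) (t : ℝ) : PhaseFactor (fun _ => c) (fun _ => 0) t :=
  ⟨SmoothNear.const _ _, SmoothNear.const _ _, hc,
    Eventually.of_forall fun u => (hasDerivAt_const u c).congr_deriv (by simp)⟩

theorem exp_I (t : ℝ) : PhaseFactor (fun u => Complex.exp (Complex.I * u)) (fun _ => 1) t := by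
  refine ⟨?_, SmoothNear.const _ _, Complex.exp_ne_zero _, Eventually.of_forall fun u => ?_⟩
  · exact ((SmoothNear.const _ _).mul
      (smoothNear_of_contDiff contDiff_id t).ofReal).cexp
  · have := ((Complex.ofRealCLM.hasDerivAt (x := u)).const_mul Complex.I).cexp
    refine this.congr_deriv ?_
    simp [mul_comm]

theorem cpow (k : ℝ) (ht : 0 < t) :
    PhaseFactor (fun u => (u : ℂ) ^ (-(Complex.I * k))) (fun u => -k / u) t := by
  have hpos : ∀ᶠ u in 𝓝 t, 0 < u := eventually_gt_nhds ht
  have e : ∀ u : ℝ, 0 < u → (u : ℂ) ^ (-(Complex.I * k))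
      = Complex.exp (Real.log u * (-(Complex.I * k))) := fun u hu => by
    rw [Complex.cpow_def_of_ne_zero (by exact_mod_cast hu.ne'), Complex.ofReal_log hu.le]
  have hlog : SmoothNear Real.log t := by
    filter_upwards [hpos] with u hu using Real.contDiffAt_log.2 hu.ne'
  have hinv : SmoothNear (fun u : ℝ => -k / u) t := by
    filter_upwards [hpos] with u hu
    exact contDiffAt_const.div contDiffAt_id hu.ne'
  refine ⟨?_, hinv, ?_, ?_⟩
  · refine SmoothNear.congr (φ := fun u => Complex.exp (Real.log u * (-(Complex.I * k)))) ?_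
      (hpos.mono fun u hu => (e u hu).symm)
    exact (hlog.ofReal.mul (SmoothNear.const _ _)).cexp
  · rw [e t ht]
    exact Complex.exp_ne_zero _
  · filter_upwards [hpos.eventually_nhds] with u hu
    have h1 := ((hasDerivAt_ofReal_comp (Real.hasDerivAt_log hu.self_of_nhds.ne')).mul_const
      (-(Complex.I * k))).cexp
    refine (h1.congr_of_eventuallyEq (hu.mono e)).congr_deriv ?_
    rw [← e u hu.self_of_nhds]
    push_cast
    ring

theorem const_mul (h : PhaseFactor E θ t) {c : ℂ} (hc : c ≠ 0) :
    PhaseFactor (fun u => c * E u) θ t := by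
  refine ⟨(SmoothNear.const _ _).mul h.smooth, h.smooth_rate, mul_ne_zero hc h.ne, ?_⟩
  filter_upwards [h.deriv] with u hu
  exact (hu.const_mul c).congr_deriv (by ring)

theorem rescale {a u₀ : ℝ} (h : PhaseFactor E θ ((t + u₀) / a)) :
    PhaseFactor (fun u => E ((u + u₀) / a)) (fun u => θ ((u + u₀) / a) / a) t := by
  refine ⟨smoothNear_rescale h.smooth, ?_, h.ne, ?_⟩
  · have := smoothNear_rescale h.smooth_rate
    filter_upwards [this] with u hu using hu.div_const a
  · have hc : ContinuousAt (fun u : ℝ => (u + u₀) / a) t := by fun_prop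
    filter_upwards [hc.eventually h.deriv] with u hu
    have h1 : HasDerivAt (fun u : ℝ => (u + u₀) / a) (1 / a) u :=
      ((hasDerivAt_id u).add_const u₀).div_const a
    have := hu.scomp u h1
    refine this.congr_deriv ?_
    simp only [Complex.real_smul]
    push_cast
    ring

end PhaseFactor

/-! ### Powers of `ζ + h(u)` -/

/-- `φ` is a power of `ζ + h(u)` with exponent `s`, up to a factor with logarithmic derivative
`R(u)`. -/
structure PowerLike (φ : Spacetime → ℂ) (p : Spacetime) (s : ℂ) (h R : ℝ → ℂ) : Prop where
  hol : Hol φ p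
  ne : φ p ≠ 0
  exponent : s ≠ 0
  smooth : SmoothNear h p.2.1
  smooth' : SmoothNear R p.2.1
  base : p.1 + h p.2.1 ≠ 0
  pd_zero : ∀ᶠ x in 𝓝 p, pd 0 φ x = φ x * (s / (x.1 + h x.2.1))
  pd_two : ∀ᶠ x in 𝓝 p, pd 2 φ x = φ x * (R x.2.1 + s * (deriv h x.2.1 / (x.1 + h x.2.1)))

/-- Equal logarithmic derivatives make the quotient constant. -/
theorem exists_eq_const_mul {φ ψ : Spacetime → ℂ} {p : Spacetime} (hφ : Hol φ p) (hψ : Hol ψ p)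
    (h0 : φ p ≠ 0) (h1 : ψ p ≠ 0)
    (h : ∀ᶠ x in 𝓝 p, pd 0 φ x * ψ x = φ x * pd 0 ψ x ∧ pd 2 φ x * ψ x = φ x * pd 2 ψ x) :
    ∃ B : ℂ, B ≠ 0 ∧ ∀ᶠ x in 𝓝 p, φ x = B * ψ x := by
  have hne := hψ.smooth.continuousAt.eventually_ne h1
  refine ⟨φ p / ψ p, div_ne_zero h0 h1, ?_⟩
  have := (hφ.div hψ h1).eventually_eq_const (by
    filter_upwards [hφ.eventually, hψ.eventually, hne, h] with x a b c d
    have := (a.smooth.hasPd.div b.smooth.hasPd c).2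
    rw [this, this]
    simp [d.1, d.2])
  filter_upwards [this, hne] with x hx hn
  rw [← hx, div_mul_cancel₀ _ hn]

section Base

variable {p : Spacetime} {h : ℝ → ℂ}

theorem hasPd_base {x : Spacetime} (hh : SmoothNear h x.2.1) :
    HasPd (fun y => y.1 + h y.2.1) ![1, 0, deriv h x.2.1, 0] x := by
  have := (HasPd.fst x).add (HasPd.comp_u hh.differentiableAt.hasDerivAt)
  refine ⟨this.1, fun i => (this.2 i).trans ?_⟩
  fin_cases i <;> simp

theorem hol_base (hh : SmoothNear h p.2.1) : Hol (fun y => y.1 + h y.2.1) p :=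
  (Hol.fst p).add (Hol.comp_u hh)

theorem eventually_base_ne (hh : SmoothNear h p.2.1) (h0 : p.1 + h p.2.1 ≠ 0) :
    ∀ᶠ x in 𝓝 p, x.1 + h x.2.1 ≠ 0 :=
  (hol_base hh).smooth.continuousAt.eventually_ne h0

end Base

namespace PowerLike

variable {φ ψ : Spacetime → ℂ} {p : Spacetime} {s : ℂ} {h R : ℝ → ℂ}

theorem base_ne (H : PowerLike φ p s h R) : ∀ᶠ x in 𝓝 p, x.1 + h x.2.1 ≠ 0 :=
  eventually_base_ne H.smooth H.base

theorem regular (H : PowerLike φ p s h R) : Regular φ p :=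
  ⟨H.hol, H.ne, by
    rw [H.pd_zero.self_of_nhds]
    exact mul_ne_zero H.ne (div_ne_zero H.exponent H.base)⟩

theorem congr (H : PowerLike φ p s h R) (e : φ =ᶠ[𝓝 p] ψ) : PowerLike ψ p s h R := by
  refine ⟨H.hol.congr e, e.self_of_nhds ▸ H.ne, H.exponent, H.smooth, H.smooth', H.base, ?_, ?_⟩
  · filter_upwards [H.pd_zero, e.eventually_nhds] with x hx ex
    rw [← pd_congr 0 ex, hx, ex.self_of_nhds]
  · filter_upwards [H.pd_two, e.eventually_nhds] with x hx ex
    rw [← pd_congr 2 ex, hx, ex.self_of_nhds]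

theorem exists_eq_const_mul {R' : ℝ → ℂ} (H : PowerLike φ p s h R) (H' : PowerLike ψ p s h R')
    (hR : ∀ᶠ u in 𝓝 p.2.1, R u = R' u) : ∃ B : ℂ, B ≠ 0 ∧ ∀ᶠ x in 𝓝 p, φ x = B * ψ x := by
  refine PPWave.exists_eq_const_mul H.hol H'.hol H.ne H'.ne ?_
  filter_upwards [H.pd_zero, H.pd_two, H'.pd_zero, H'.pd_two, eventually_u hR] with x a b c d e
  rw [a, b, c, d, e]
  constructor <;> ring

theorem pd_zero_pd_zero (H : PowerLike φ p s h R) : ∀ᶠ x in 𝓝 p,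
    pd 0 (pd 0 φ) x = pd 0 φ x * ((s - 1) / (x.1 + h x.2.1)) := by
  filter_upwards [H.pd_zero.eventually_nhds, H.hol.eventually, H.base_ne,
    eventually_u H.smooth.eventually] with x a b c d
  have := ((b.hasPd).mul ((HasPd.const s x).div (hasPd_base d) c)).2 0
  rw [pd_congr 0 a, this, a.self_of_nhds]
  simp only [Matrix.cons_val_zero]
  field_simp
  ring

/-- The `ζ`-derivative of a power. -/
theorem deriv_zeta (H : PowerLike φ p s h R) (hs : s ≠ 1) :
    PowerLike (pd 0 φ) p (s - 1) h R := by
  refine ⟨H.hol.pd 0, H.regular.ne', sub_ne_zero.2 hs, H.smooth, H.smooth', H.base,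
    H.pd_zero_pd_zero, ?_⟩
  filter_upwards [H.pd_zero.eventually_nhds, H.pd_two, H.hol.eventually, H.base_ne,
    eventually_u H.smooth.eventually] with x a a' b c d
  have := ((b.hasPd).mul ((HasPd.const s x).div (hasPd_base d) c)).2 2
  rw [pd_congr 2 a, this, a.self_of_nhds]
  simp only [Matrix.cons_val, a']
  field_simp
  ring

theorem ratio (H : PowerLike φ p s h R) : ∀ᶠ x in 𝓝 p, ratio φ x = (x.1 + h x.2.1) * s⁻¹ := by
  filter_upwards [H.pd_zero, H.base_ne, H.regular.eventually] with x a b c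
  have := c.ne
  have := H.exponent
  rw [PPWave.ratio, a]
  field_simp

theorem slope (H : PowerLike φ p s h R) : ∀ᶠ x in 𝓝 p,
    slope φ x = -(R x.2.1 * s⁻¹) * (x.1 + h x.2.1) - deriv h x.2.1 := by
  filter_upwards [H.pd_zero, H.pd_two, H.base_ne, H.regular.eventually] with x a a' b c
  have := c.ne
  have := H.exponent
  rw [PPWave.slope, a, a']
  field_simp
  ring

theorem modulus (H : PowerLike φ p s h R) : ∀ᶠ x in 𝓝 p, modulus φ x = -1 - 4 * s⁻¹ := by
  filter_upwards [H.ratio.eventually_nhds, H.regular.eventually,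
    eventually_u H.smooth.eventually] with x a b c
  have := ((hasPd_base c).mul (HasPd.const s⁻¹ x)).2 0
  rw [b.modulus_eq, pd_congr 0 a, this]
  simp

theorem shear (H : PowerLike φ p s h R) : ∀ᶠ x in 𝓝 p, shear φ x = -(R x.2.1 * s⁻¹) := by
  filter_upwards [H.slope.eventually_nhds, eventually_u H.smooth.eventually,
    eventually_u H.smooth'.eventually] with x a c d
  have hd := (((HasPd.comp_u d.differentiableAt.hasDerivAt).mul (HasPd.const s⁻¹ x)).neg.mul
    (hasPd_base c)).sub (HasPd.comp_u c.deriv.differentiableAt.hasDerivAt)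
  rw [PPWave.shear, pd_congr 0 a]
  refine (hd.2 0).trans ?_
  simp

theorem constantModulus (H : PowerLike φ p s h R) {A₀ : ℂ} {M₁ : ℝ → ℂ}
    (hA : A₀ * conj A₀ = 1) (hs : -1 - 4 * s⁻¹ = A₀) (hM : ∀ᶠ u in 𝓝 p.2.1, -(R u * s⁻¹) = M₁ u)
    (hreal : ∀ᶠ u in 𝓝 p.2.1, M₁ u = A₀ * conj (M₁ u)) : ConstantModulus φ p A₀ M₁ := by
  refine ⟨hA, (H.smooth'.mul (SmoothNear.const _ _)).neg.congr hM, ?_, ?_, hreal⟩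
  · filter_upwards [H.modulus] with x hx
    rw [hx, hs]
  · filter_upwards [H.shear, eventually_u hM] with x a b
    rw [a, b]

end PowerLike

/-- The equation for A says ∂_ζ(φ/φ_ζ) = 1/s, so sφ/φ_ζ = ζ + H(u), and φ_ζ/φ is s/(ζ + H). The
identity for φ/φ_ζ then yields φ_u/φ, with -sM as the part independent of ζ. -/
theorem ConstantModulus.exists_powerLike {φ : Spacetime → ℂ} {p : Spacetime} {A₀ s : ℂ}
    {M₁ : ℝ → ℂ} (h : ConstantModulus φ p A₀ M₁) (hr : Regular φ p) (hs : s ≠ 0)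
    (hA : -1 - 4 * s⁻¹ = A₀) : ∃ H, PowerLike φ p s H (fun u => -(s * M₁ u)) := by
  have hpd : ∀ᶠ x in 𝓝 p, pd 0 (ratio φ) x = s⁻¹ := by
    filter_upwards [hr.eventually, h.modulus] with x a b
    rw [a.modulus_eq, ← hA] at b
    linear_combination (-1 / 4 : ℂ) * b
  have hZ := (Hol.const s p).mul hr.hol_ratio
  obtain ⟨H, hH, hH'⟩ := (hZ.sub (Hol.fst p)).exists_eq_comp_u (by
    filter_upwards [hr.eventually, hpd] with x a b
    refine (((HasPd.const s x).mul a.hol_ratio.hasPd).sub (HasPd.fst x)).2 0 |>.trans ?_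
    simp [b, hs])
  have hbase : ∀ᶠ x in 𝓝 p, x.1 + H x.2.1 = s * ratio φ x := by
    filter_upwards [hH'] with x hx
    rw [← hx]
    ring
  have hpd2 : ∀ᶠ x in 𝓝 p, pd 2 (ratio φ) x = deriv H x.2.1 * s⁻¹ := by
    filter_upwards [hbase.eventually_nhds, eventually_u hH.eventually] with x a b
    have hd := ((hasPd_base b).mul (HasPd.const s⁻¹ x)).2 2
    have e : ratio φ =ᶠ[𝓝 x] fun y => (y.1 + H y.2.1) * s⁻¹ := a.mono fun y hy => by
      simp only [hy]
      field_simp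
    rw [pd_congr 2 e, hd]
    simp
  refine ⟨H, hr.hol, hr.ne, hs, hH, ((SmoothNear.const _ _).mul h.smooth).neg, ?_, ?_, ?_⟩
  · rw [hbase.self_of_nhds]
    exact mul_ne_zero hs (div_ne_zero hr.ne hr.ne')
  · filter_upwards [hbase, hr.eventually] with x a b
    rw [a, ratio]
    have := b.ne
    have := b.ne'
    field_simp
  · filter_upwards [hbase, hr.eventually, hpd, hpd2, h.shear] with x a b c d e
    have key := b.flow_ratio
    have := b.ne
    have := b.ne'
    rw [flow, c, d, e, slope, ratio] at key
    rw [a, ratio]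
    field_simp at key ⊢
    linear_combination (-1 : ℂ) * key

/-! ### The three families of potentials -/

theorem modulus_congr {φ ψ : Spacetime → ℂ} {x : Spacetime} (h : φ =ᶠ[𝓝 x] ψ) :
    modulus φ x = modulus ψ x := by
  have h1 : pd 0 φ =ᶠ[𝓝 x] pd 0 ψ := by
    filter_upwards [h.eventually_nhds] with y hy using pd_congr 0 hy
  rw [modulus, modulus, pd_congr 0 h1, h1.self_of_nhds, h.self_of_nhds]

theorem shear_congr {φ ψ : Spacetime → ℂ} {x : Spacetime} (h : φ =ᶠ[𝓝 x] ψ) :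
    shear φ x = shear ψ x := by
  refine pd_congr 0 ?_
  filter_upwards [h.eventually_nhds] with y hy
  rw [slope, slope, pd_congr 0 hy, pd_congr 2 hy]

theorem Regular.congr {φ ψ : Spacetime → ℂ} {p : Spacetime} (hr : Regular φ p)
    (h : φ =ᶠ[𝓝 p] ψ) : Regular ψ p :=
  ⟨hr.hol.congr h, h.self_of_nhds ▸ hr.ne, pd_congr 0 h ▸ hr.ne'⟩

theorem ConstantModulus.congr {φ ψ : Spacetime → ℂ} {p : Spacetime} {A₀ : ℂ} {M₁ : ℝ → ℂ}
    (hc : ConstantModulus φ p A₀ M₁) (h : φ =ᶠ[𝓝 p] ψ) : ConstantModulus ψ p A₀ M₁ := by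
  refine ⟨hc.unit, hc.smooth, ?_, ?_, hc.real⟩
  · filter_upwards [hc.modulus, h.eventually_nhds] with x a b
    rw [← modulus_congr b, a]
  · filter_upwards [hc.shear, h.eventually_nhds] with x a b
    rw [← shear_congr b, a]

theorem pd_zero_pd_zero_const_mul {K : Spacetime → ℂ} {p : Spacetime} (hK : Hol K p) (B : ℂ) :
    ∀ᶠ x in 𝓝 p, pd 0 (pd 0 fun y => B * K y) x = B * pd 0 (pd 0 K) x := by
  have h1 : ∀ᶠ x in 𝓝 p, pd 0 (fun y => B * K y) x = B * pd 0 K x := by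
    filter_upwards [hK.eventually] with x hx
    refine (((HasPd.const B x).mul hx.smooth.hasPd).2 0).trans ?_
    simp
  filter_upwards [h1.eventually_nhds, (hK.pd 0).eventually] with x a hx
  rw [pd_congr 0 a]
  refine (((HasPd.const B x).mul hx.smooth.hasPd).2 0).trans ?_
  simp

/-- Splits a nonzero complex constant into the real factor k₀ allowed in a class form and a rotation
of ζ. -/
theorem exp_re_mul_exp_im (c : ℂ) :
    (Real.exp c.re : ℂ) * Complex.exp (Complex.I * c.im) = Complex.exp c := by
  rw [Complex.ofReal_exp, ← Complex.exp_add]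
  congr 1
  rw [mul_comm Complex.I]
  exact Complex.re_add_im c

section Families

variable {p : Spacetime} {h : ℝ → ℂ}

/-- The potentials `(E(u) ζ)^{2ik}`. -/
noncomputable def powForm (E : ℝ → ℂ) (k : ℝ) (ℓ : ℂ → ℂ) (y : ℂ × ℝ) : ℂ :=
  Complex.exp (2 * Complex.I * k * ℓ (E y.2 * y.1))

/-- The potentials `exp(E(u) ζ)`. -/
noncomputable def expForm (E : ℝ → ℂ) (y : ℂ × ℝ) : ℂ := Complex.exp (E y.2 * y.1)

/-- The potentials `c(u) log ζ`. -/
noncomputable def logForm (c : ℝ → ℂ) (ℓ : ℂ → ℂ) (y : ℂ × ℝ) : ℂ := c y.2 * ℓ y.1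

theorem one_sub_I_mul_ne_zero (k : ℝ) : 1 - Complex.I * k ≠ 0 := fun h => by
  simpa using congrArg Complex.re h

theorem one_add_I_mul_ne_zero (k : ℝ) : 1 + Complex.I * k ≠ 0 := fun h => by
  simpa using congrArg Complex.re h

/-- The factor E contributes through E^{2ik}, whose logarithmic derivative is 2ik · iθ = -2kθ. -/
theorem powerLike_cexp {E : ℝ → ℂ} {θ : ℝ → ℝ} {k : ℝ} {ℓ : ℂ → ℂ} {c : ℂ} (hc : c ≠ 0)
    (hk : k ≠ 0) (hh : SmoothNear h p.2.1) (hE : PhaseFactor E θ p.2.1)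
    (hℓ : IsLogBranch ℓ (E p.2.1 * (p.1 + h p.2.1))) :
    PowerLike (fun x => Complex.exp (2 * Complex.I * k * ℓ (E x.2.1 * (x.1 + h x.2.1))) * c) p
      (2 * Complex.I * k) h (fun u => -(2 * k * θ u)) := by
  have hw : Hol (fun x => E x.2.1 * (x.1 + h x.2.1)) p := (Hol.comp_u hE.smooth).mul (hol_base hh)
  have hbase := right_ne_zero_of_mul hℓ.ne_zero
  have hd : ∀ᶠ x in 𝓝 p,
      pd 0 (fun x => Complex.exp (2 * Complex.I * k * ℓ (E x.2.1 * (x.1 + h x.2.1))) * c) x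
        = Complex.exp (2 * Complex.I * k * ℓ (E x.2.1 * (x.1 + h x.2.1))) * c
          * (2 * Complex.I * k / (x.1 + h x.2.1)) ∧
      pd 2 (fun x => Complex.exp (2 * Complex.I * k * ℓ (E x.2.1 * (x.1 + h x.2.1))) * c) x
        = Complex.exp (2 * Complex.I * k * ℓ (E x.2.1 * (x.1 + h x.2.1))) * c
          * (-(2 * k * θ x.2.1) + 2 * Complex.I * k * (deriv h x.2.1 / (x.1 + h x.2.1))) := by
    filter_upwards [hw.smooth.continuousAt.eventually hℓ.eventually_hasDerivAt,
      eventually_u hE.deriv, eventually_u hh.eventually, eventually_base_ne hh hbase,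
      eventually_u (hE.smooth.continuousAt.eventually_ne hE.ne)] with x a b d e f
    have hd := (((HasPd.const (2 * Complex.I * k) x).mul
      (((HasPd.comp_u b).mul (hasPd_base d)).comp_hol a.2)).cexp).mul (HasPd.const c x)
    constructor
    · refine (hd.2 0).trans ?_
      simp
      field_simp
    · refine (hd.2 2).trans ?_
      simp
      field_simp
      linear_combination (k * θ x.2.1 * (x.1 + h x.2.1)) * Complex.I_sq
  refine ⟨?_, mul_ne_zero (Complex.exp_ne_zero _) hc, by simpa using hk, hh, ?_, hbase,
    hd.mono fun x hx => hx.1, hd.mono fun x hx => hx.2⟩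
  · exact (((Hol.const _ p).mul (hw.comp_hol hℓ.1)).cexp).mul (Hol.const c p)
  · exact ((SmoothNear.const (2 * k : ℂ) p.2.1).mul hE.smooth_rate.ofReal).neg

variable {a κ u₀ : ℝ} {E : ℝ → ℂ} {θ : ℝ → ℝ}

theorem powerLike_pullback {k : ℝ} {ℓ : ℂ → ℂ} (ha : a ≠ 0) (hk : k ≠ 0)
    (hh : SmoothNear h p.2.1) (hE : PhaseFactor E θ ((p.2.1 + u₀) / a))
    (hℓ : IsLogBranch ℓ (E ((p.2.1 + u₀) / a) * (tau a κ u₀ h p).1)) :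
    PowerLike (pullback a κ u₀ h (powForm E k ℓ)) p (2 * Complex.I * k) h
      (fun u => -(2 * k * (θ ((u + u₀) / a) / a : ℝ))) := by
  have ha' : ((a : ℂ) ^ 2)⁻¹ ≠ 0 := inv_ne_zero (pow_ne_zero 2 (by exact_mod_cast ha))
  have hE' := (hE.rescale).const_mul (Complex.exp_ne_zero (Complex.I * κ))
  have := powerLike_cexp (ℓ := ℓ) ha' hk hh hE' (by
    convert hℓ using 1
    simp only [tau]
    ring)
  convert this using 3 with x
  have e : E (tau a κ u₀ h x).2 * (tau a κ u₀ h x).1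
      = Complex.exp (Complex.I * κ) * E ((x.2.1 + u₀) / a) * (x.1 + h x.2.1) := by
    simp only [tau]
    ring
  rw [pullback, powForm, e, div_eq_mul_inv]

theorem powerLike_hess_pullback {k : ℝ} {ℓ : ℂ → ℂ} (ha : a ≠ 0) (hk : k ≠ 0)
    (hh : SmoothNear h p.2.1) (hE : PhaseFactor E θ ((p.2.1 + u₀) / a))
    (hℓ : IsLogBranch ℓ (E ((p.2.1 + u₀) / a) * (tau a κ u₀ h p).1)) :
    PowerLike (pd 0 (pd 0 (pullback a κ u₀ h (powForm E k ℓ)))) p (2 * Complex.I * k - 1 - 1) h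
      (fun u => -(2 * k * (θ ((u + u₀) / a) / a : ℝ))) := by
  refine ((powerLike_pullback ha hk hh hE hℓ).deriv_zeta ?_).deriv_zeta ?_
  · intro h
    simpa using congrArg Complex.re h
  · intro h
    have := congrArg Complex.re h
    norm_num at this

theorem exponent_ne_zero (k : ℝ) : 2 * Complex.I * k - 1 - 1 ≠ 0 := fun h => by
  have := congrArg Complex.re h
  norm_num at this

/-- Two ζ-derivatives lower the exponent 2ik to 2ik - 2, and A becomes a Cayley transform of k. Its
unimodularity is the reason for imaginary exponents in the class forms. -/
theorem modulus_exponent (k : ℝ) : -1 - 4 * (2 * Complex.I * k - 1 - 1)⁻¹ =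
    (1 + Complex.I * k) / (1 - Complex.I * k) := by
  have h1 := one_sub_I_mul_ne_zero k
  have h2 : 2 * Complex.I * k - 1 - 1 = -2 * (1 - Complex.I * k) := by ring
  rw [h2]
  field_simp
  ring

theorem conj_one_sub_I (k : ℝ) : conj (1 - Complex.I * k) = 1 + Complex.I * k := by
  simp

theorem conj_one_add_I (k : ℝ) : conj (1 + Complex.I * k) = 1 - Complex.I * k := by
  simp [sub_eq_add_neg]

theorem constantModulus_powForm {k : ℝ} {ℓ : ℂ → ℂ} (ha : a ≠ 0) (hk : k ≠ 0)
    (hh : SmoothNear h p.2.1) (hE : PhaseFactor E θ ((p.2.1 + u₀) / a))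
    (hℓ : IsLogBranch ℓ (E ((p.2.1 + u₀) / a) * (tau a κ u₀ h p).1)) :
    ConstantModulus (pd 0 (pd 0 (pullback a κ u₀ h (powForm E k ℓ)))) p
      ((1 + Complex.I * k) / (1 - Complex.I * k))
      (fun u => -(k * (θ ((u + u₀) / a) / a : ℝ)) / (1 - Complex.I * k)) := by
  have h1 := one_sub_I_mul_ne_zero k
  have h2 := one_add_I_mul_ne_zero k
  refine (powerLike_hess_pullback ha hk hh hE hℓ).constantModulus ?_ (modulus_exponent k) ?_ ?_
  · rw [map_div₀, conj_one_sub_I, conj_one_add_I]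
    field_simp
  · refine Eventually.of_forall fun u => ?_
    have h3 : 2 * Complex.I * k - 1 - 1 = -2 * (1 - Complex.I * k) := by ring
    rw [h3]
    field_simp
  · refine Eventually.of_forall fun u => ?_
    rw [map_div₀, conj_one_sub_I, map_neg, map_mul, Complex.conj_ofReal, Complex.conj_ofReal,
      div_mul_div_comm, mul_comm (1 + Complex.I * (k : ℂ)), mul_div_mul_right _ _ h2]

/-- The model built with k₀ = 1 and κ = 0 agrees with φ up to a constant B. Multiplying the base of
the power by exp c with 2ikc = log B absorbs it: the modulus of exp c becomes k₀ and its phase the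
rotation κ. -/
theorem exists_powForm {φ : Spacetime → ℂ} {M₁ : ℝ → ℂ} {k : ℝ} (hr : Regular φ p)
    (hc : ConstantModulus φ p ((1 + Complex.I * k) / (1 - Complex.I * k)) M₁) (hk : k ≠ 0)
    (ha : a ≠ 0) (hE : PhaseFactor E θ ((p.2.1 + u₀) / a))
    (hM : ∀ᶠ u in 𝓝 p.2.1, M₁ u = -(k * (θ ((u + u₀) / a) / a : ℝ)) / (1 - Complex.I * k)) :
    ∃ (k₀ κ : ℝ) (h : ℝ → ℂ) (ℓ : ℂ → ℂ), k₀ ≠ 0 ∧ SmoothNear h p.2.1 ∧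
      IsLogBranch ℓ (k₀ * E ((p.2.1 + u₀) / a) * (tau a κ u₀ h p).1) ∧
      Hol (pullback a κ u₀ h (powForm (fun t => k₀ * E t) k ℓ)) p ∧
      ∀ᶠ x in 𝓝 p, φ x = pd 0 (pd 0 (pullback a κ u₀ h (powForm (fun t => k₀ * E t) k ℓ))) x := by
  have h1 := one_sub_I_mul_ne_zero k
  obtain ⟨h, hφ⟩ := hc.exists_powerLike hr (exponent_ne_zero k) (modulus_exponent k)
  obtain ⟨ℓ, hℓ⟩ := exists_isLogBranch (w := E ((p.2.1 + u₀) / a) * (tau a 0 u₀ h p).1)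
    (mul_ne_zero hE.ne (by simpa [tau] using hφ.base))
  have hK := (powerLike_pullback ha hk hφ.smooth hE hℓ).hol
  obtain ⟨B, hB, hB'⟩ := hφ.exists_eq_const_mul
    (powerLike_hess_pullback ha hk hφ.smooth hE hℓ) (by
      filter_upwards [hM] with u hu
      rw [hu]
      field_simp
      ring)
  have hk' : 2 * Complex.I * (k : ℂ) ≠ 0 := by simpa using hk
  set c := Complex.log B / (2 * Complex.I * k) with hcdef
  have hcB : Complex.exp (2 * Complex.I * k * c) = B := by
    rw [hcdef, mul_div_cancel₀ _ hk', Complex.exp_log hB]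
  have hec := exp_re_mul_exp_im c
  have hcc : Complex.exp c * Complex.exp (-c) = 1 := by rw [← Complex.exp_add]; simp
  have e : pullback a c.im u₀ h (powForm (fun t => Real.exp c.re * E t) k
      (fun z => ℓ (z * Complex.exp (-c)) + c))
      = fun x => B * pullback a 0 u₀ h (powForm E k ℓ) x := by
    funext x
    simp only [pullback, powForm, tau]
    have e1 : Real.exp c.re * E ((x.2.1 + u₀) / a) *
        (Complex.exp (Complex.I * c.im) * (x.1 + h x.2.1)) * Complex.exp (-c)
        = E ((x.2.1 + u₀) / a) * (Complex.exp (Complex.I * (0 : ℝ)) * (x.1 + h x.2.1)) := by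
      have : Complex.exp (Complex.I * (0 : ℝ)) = 1 := by simp
      rw [this]
      linear_combination (E ((x.2.1 + u₀) / a) * (x.1 + h x.2.1) * Complex.exp (-c)) * hec
        + E ((x.2.1 + u₀) / a) * (x.1 + h x.2.1) * hcc
    rw [e1, mul_add, Complex.exp_add, hcB]
    ring
  refine ⟨Real.exp c.re, c.im, h, _, (Real.exp_pos _).ne', hφ.smooth, ?_,
    by rw [e]; exact (Hol.const B p).mul hK, ?_⟩
  · convert isLogBranch_shift hℓ c using 1
    simp only [tau]
    have : Complex.exp (Complex.I * (0 : ℝ)) = 1 := by simp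
    rw [this, ← hec]
    ring
  · rw [e]
    filter_upwards [hB', pd_zero_pd_zero_const_mul hK B] with x x1 x2
    rw [x1, x2]

theorem hasPd_logForm {c : ℝ → ℂ} {ℓ : ℂ → ℂ} {D : ℂ} (hh : SmoothNear h p.2.1)
    (hc : SmoothNear c p.2.1) (hℓ : IsLogBranch ℓ (D * (p.1 + h p.2.1))) :
    Hol (fun x => c x.2.1 * ℓ (D * (x.1 + h x.2.1))) p ∧
    ∀ᶠ x in 𝓝 p, pd 0 (fun x => c x.2.1 * ℓ (D * (x.1 + h x.2.1))) x
      = c x.2.1 / (x.1 + h x.2.1) := by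
  have hw : Hol (fun x => D * (x.1 + h x.2.1)) p := (Hol.const D p).mul (hol_base hh)
  have hD := left_ne_zero_of_mul hℓ.ne_zero
  refine ⟨(Hol.comp_u hc).mul (hw.comp_hol hℓ.1), ?_⟩
  filter_upwards [hw.smooth.continuousAt.eventually hℓ.eventually_hasDerivAt,
    eventually_u hc.eventually, eventually_u hh.eventually,
    eventually_base_ne hh (right_ne_zero_of_mul hℓ.ne_zero)] with x a b d e
  refine (((HasPd.comp_u b.differentiableAt.hasDerivAt).mul
    (((HasPd.const D x).mul (hasPd_base d)).comp_hol a.2)).2 0).trans ?_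
  simp
  field_simp

/-- The logarithm itself is not a power, but its first ζ-derivative c/(ζ + h) is one with exponent
-1; the second derivative lowers this to -2. -/
theorem powerLike_logForm {c : ℝ → ℂ} {ℓ : ℂ → ℂ} {D : ℂ} (hh : SmoothNear h p.2.1)
    (hc : SmoothNear c p.2.1) (hc0 : c p.2.1 ≠ 0) (hℓ : IsLogBranch ℓ (D * (p.1 + h p.2.1))) :
    PowerLike (pd 0 (pd 0 fun x => c x.2.1 * ℓ (D * (x.1 + h x.2.1)))) p (-1 - 1) h
      (fun u => deriv c u / c u) := by
  obtain ⟨-, hpd⟩ := hasPd_logForm hh hc hℓ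
  have hbase := right_ne_zero_of_mul hℓ.ne_zero
  have hne := eventually_base_ne hh hbase
  have hcn := eventually_u (hc.continuousAt.eventually_ne hc0)
  have H : PowerLike (fun x => c x.2.1 / (x.1 + h x.2.1)) p (-1) h (fun u => deriv c u / c u) := by
    have hd : ∀ᶠ x in 𝓝 p,
        pd 0 (fun x => c x.2.1 / (x.1 + h x.2.1)) x
          = c x.2.1 / (x.1 + h x.2.1) * (-1 / (x.1 + h x.2.1)) ∧
        pd 2 (fun x => c x.2.1 / (x.1 + h x.2.1)) x = c x.2.1 / (x.1 + h x.2.1) *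
          (deriv c x.2.1 / c x.2.1 + -1 * (deriv h x.2.1 / (x.1 + h x.2.1))) := by
      filter_upwards [hne, hcn, eventually_u hc.eventually, eventually_u hh.eventually]
        with x a e b d
      have hd := (HasPd.comp_u b.differentiableAt.hasDerivAt).div (hasPd_base d) a
      constructor
      · refine (hd.2 0).trans ?_
        simp
        field_simp
      · refine (hd.2 2).trans ?_
        simp
        field_simp
        ring
    exact ⟨(Hol.comp_u hc).div (hol_base hh) hbase, div_ne_zero hc0 hbase, by simp, hh,
      hc.deriv.div hc hc0, hbase, hd.mono fun x hx => hx.1, hd.mono fun x hx => hx.2⟩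
  exact (H.congr (hpd.mono fun x hx => hx.symm)).deriv_zeta (by norm_num)

theorem constantModulus_logForm {c : ℝ → ℂ} {ℓ : ℂ → ℂ} {D : ℂ} (hh : SmoothNear h p.2.1)
    (hc : SmoothNear c p.2.1) (hc0 : c p.2.1 ≠ 0) (hℓ : IsLogBranch ℓ (D * (p.1 + h p.2.1)))
    (hreal : ∀ᶠ u in 𝓝 p.2.1, conj (deriv c u / c u) = deriv c u / c u) :
    ConstantModulus (pd 0 (pd 0 fun x => c x.2.1 * ℓ (D * (x.1 + h x.2.1)))) p 1
      (fun u => deriv c u / c u / 2) := by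
  refine (powerLike_logForm hh hc hc0 hℓ).constantModulus (by simp) (by norm_num) ?_ ?_
  · refine Eventually.of_forall fun u => ?_
    norm_num
    ring
  · filter_upwards [hreal] with u hu
    rw [map_div₀ (starRingEnd ℂ) (deriv c u / c u), hu, map_ofNat, one_mul]

/-- A factor inside the logarithm would only add a function of u, so the constant B cannot be
absorbed by ζ as for powers. It remains as a coefficient, to be treated class by class. -/
theorem exists_logForm {φ : Spacetime → ℂ} {M₁ : ℝ → ℂ} (hr : Regular φ p)
    (hM : ConstantModulus φ p 1 M₁) {c : ℝ → ℂ} (hc : SmoothNear c p.2.1) (hc0 : c p.2.1 ≠ 0)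
    (hcM : ∀ᶠ u in 𝓝 p.2.1, M₁ u = deriv c u / c u / 2) :
    ∃ (B : ℂ) (h : ℝ → ℂ) (ℓ : ℂ → ℂ), B ≠ 0 ∧ SmoothNear h p.2.1 ∧
      IsLogBranch ℓ (p.1 + h p.2.1) ∧
      Hol (fun x => B * (c x.2.1 * ℓ (x.1 + h x.2.1))) p ∧
      ∀ᶠ x in 𝓝 p, φ x = pd 0 (pd 0 fun x => B * (c x.2.1 * ℓ (x.1 + h x.2.1))) x := by
  obtain ⟨h, hφ⟩ := hM.exists_powerLike hr (s := -1 - 1) (by norm_num) (by norm_num)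
  obtain ⟨ℓ, hℓ⟩ := exists_isLogBranch hφ.base
  have hℓ' : IsLogBranch ℓ (1 * (p.1 + h p.2.1)) := by rwa [one_mul]
  have hK := (hasPd_logForm hφ.smooth hc hℓ').1
  have hP := powerLike_logForm hφ.smooth hc hc0 hℓ'
  simp only [one_mul] at hK hP
  obtain ⟨B, hB, hB'⟩ := hφ.exists_eq_const_mul hP (by
      filter_upwards [hcM] with u hu
      rw [hu]
      ring)
  refine ⟨B, h, ℓ, hB, hφ.smooth, hℓ, (Hol.const B p).mul hK, ?_⟩
  filter_upwards [hB', pd_zero_pd_zero_const_mul hK B] with x x1 x2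
  rw [x1, x2]

theorem hess_cexp {β : ℝ → ℂ} (hβ : SmoothNear β p.2.1) (hh : SmoothNear h p.2.1) (c : ℂ) :
    Hol (fun x => Complex.exp (β x.2.1 * (x.1 + h x.2.1)) * c) p ∧
    ∀ᶠ x in 𝓝 p, pd 0 (pd 0 fun x => Complex.exp (β x.2.1 * (x.1 + h x.2.1)) * c) x
      = β x.2.1 ^ 2 * (Complex.exp (β x.2.1 * (x.1 + h x.2.1)) * c) := by
  have hK : Hol (fun x => Complex.exp (β x.2.1 * (x.1 + h x.2.1)) * c) p :=
    ((Hol.comp_u hβ).mul (hol_base hh)).cexp.mul (Hol.const c p)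
  have h1 : ∀ᶠ x in 𝓝 p, pd 0 (fun x => Complex.exp (β x.2.1 * (x.1 + h x.2.1)) * c) x
      = β x.2.1 * (Complex.exp (β x.2.1 * (x.1 + h x.2.1)) * c) := by
    filter_upwards [eventually_u hβ.eventually, eventually_u hh.eventually] with x b d
    refine ((((HasPd.comp_u b.differentiableAt.hasDerivAt).mul (hasPd_base d)).cexp.mul
      (HasPd.const c x)).2 0).trans ?_
    simp
    ring
  refine ⟨hK, ?_⟩
  filter_upwards [h1.eventually_nhds, hK.eventually, eventually_u hβ.eventually] with x a b d
  rw [pd_congr 0 a]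
  refine (((HasPd.comp_u d.differentiableAt.hasDerivAt).mul b.smooth.hasPd).2 0).trans ?_
  simp only [a.self_of_nhds]
  simp
  ring

/-- Here φ/φ_ζ = 1/β depends on u alone, so A = -1, and q is affine in ζ with leading coefficient
-iθ. -/
theorem constantModulus_cexp {β : ℝ → ℂ} {θ : ℝ → ℝ} (hβ : PhaseFactor β θ p.2.1)
    (hh : SmoothNear h p.2.1) {c : ℂ} (hc : c ≠ 0) :
    Regular (pd 0 (pd 0 fun x => Complex.exp (β x.2.1 * (x.1 + h x.2.1)) * c)) p ∧
    ConstantModulus (pd 0 (pd 0 fun x => Complex.exp (β x.2.1 * (x.1 + h x.2.1)) * c)) p (-1)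
      (fun u => -(Complex.I * θ u)) := by
  obtain ⟨-, he⟩ := hess_cexp hβ.smooth hh c
  set φ : Spacetime → ℂ :=
    fun x => β x.2.1 ^ 2 * (Complex.exp (β x.2.1 * (x.1 + h x.2.1)) * c) with hφ
  have hβ0 := eventually_u (hβ.smooth.continuousAt.eventually_ne hβ.ne)
  have hol : Hol φ p := by
    have := ((Hol.comp_u hβ.smooth).mul (Hol.comp_u hβ.smooth)).mul
      (((Hol.comp_u hβ.smooth).mul (hol_base hh)).cexp.mul (Hol.const c p))
    simp only [← sq] at this
    exact this
  have hpd : ∀ᶠ x in 𝓝 p, pd 0 φ x = φ x * β x.2.1 ∧ pd 2 φ x = φ x * (Complex.I * θ x.2.1 *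
      (2 + β x.2.1 * (x.1 + h x.2.1)) + β x.2.1 * deriv h x.2.1) := by
    filter_upwards [eventually_u hβ.deriv, eventually_u hh.eventually] with x b d
    have hd := ((HasPd.comp_u b).mul (HasPd.comp_u b)).mul
      (((HasPd.comp_u b).mul (hasPd_base d)).cexp.mul (HasPd.const c x))
    simp only [← sq] at hd
    constructor
    · refine (hd.2 0).trans ?_
      simp [hφ]
      ring
    · refine (hd.2 2).trans ?_
      simp [hφ]
      ring
  have hr : Regular φ p := by
    have h0 : φ p ≠ 0 :=
      mul_ne_zero (pow_ne_zero 2 hβ.ne) (mul_ne_zero (Complex.exp_ne_zero _) hc)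
    exact ⟨hol, h0, by
      rw [hpd.self_of_nhds.1]
      exact mul_ne_zero h0 hβ.ne⟩
  have hratio : ∀ᶠ x in 𝓝 p, ratio φ x = (β x.2.1)⁻¹ := by
    filter_upwards [hpd, hr.eventually, hβ0] with x b d e
    have := d.ne
    rw [ratio, b.1]
    field_simp
  have hslope : ∀ᶠ x in 𝓝 p, slope φ x = -(Complex.I * θ x.2.1) * (x.1 + h x.2.1)
      - (2 * (Complex.I * θ x.2.1) / β x.2.1 + deriv h x.2.1) := by
    filter_upwards [hpd, hr.eventually, hβ0] with x b d e
    have := d.ne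
    rw [slope, b.1, b.2]
    field_simp
    ring
  have hθ : SmoothNear (fun u => Complex.I * θ u) p.2.1 :=
    (SmoothNear.const _ _).mul hβ.smooth_rate.ofReal
  have hcm : ConstantModulus φ p (-1) (fun u => -(Complex.I * θ u)) := by
    refine ⟨by simp, hθ.neg, ?_, ?_, Eventually.of_forall fun u => by simp⟩
    · filter_upwards [hratio.eventually_nhds, hr.eventually, hβ0,
        eventually_u hβ.smooth.eventually] with x a b d e
      rw [b.modulus_eq, pd_congr 0 a,
        ((HasPd.comp_u e.differentiableAt.hasDerivAt).inv d).2 0]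
      simp
    · have hν := ((SmoothNear.const 2 _).mul hθ).div hβ.smooth hβ.ne |>.add hh.deriv
      filter_upwards [hslope.eventually_nhds, eventually_u hθ.eventually,
        eventually_u hν.eventually, eventually_u hh.eventually] with x a b d e
      rw [shear, pd_congr 0 a]
      refine (((HasPd.comp_u b.differentiableAt.hasDerivAt).neg.mul (hasPd_base e)).sub
        (HasPd.comp_u d.differentiableAt.hasDerivAt)).2 0 |>.trans ?_
      simp
  have he' : φ =ᶠ[𝓝 p] pd 0 (pd 0 fun x => Complex.exp (β x.2.1 * (x.1 + h x.2.1)) * c) :=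
    he.mono fun x hx => hx.symm
  exact ⟨hr.congr he', hcm.congr he'⟩

theorem pullback_expForm (x : Spacetime) : pullback a κ u₀ h (expForm E) x =
    Complex.exp (Complex.exp (Complex.I * κ) * E ((x.2.1 + u₀) / a) * (x.1 + h x.2.1))
      * ((a : ℂ) ^ 2)⁻¹ := by
  rw [pullback, expForm, tau, div_eq_mul_inv]
  congr 2
  simp only
  ring

theorem hol_expForm (hh : SmoothNear h p.2.1) (hE : PhaseFactor E θ ((p.2.1 + u₀) / a)) :
    Hol (pullback a κ u₀ h (expForm E)) p := by
  have := (hess_cexp (hE.rescale.const_mul (Complex.exp_ne_zero (Complex.I * κ))).smooth hh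
    ((a : ℂ) ^ 2)⁻¹).1
  rwa [← funext pullback_expForm] at this

theorem constantModulus_expForm (ha : a ≠ 0) (hh : SmoothNear h p.2.1)
    (hE : PhaseFactor E θ ((p.2.1 + u₀) / a)) :
    Regular (pd 0 (pd 0 (pullback a κ u₀ h (expForm E)))) p ∧
    ConstantModulus (pd 0 (pd 0 (pullback a κ u₀ h (expForm E)))) p (-1)
      (fun u => -(Complex.I * (θ ((u + u₀) / a) / a : ℝ))) := by
  have := constantModulus_cexp (hE.rescale.const_mul (Complex.exp_ne_zero (Complex.I * κ))) hh
    (c := ((a : ℂ) ^ 2)⁻¹) (inv_ne_zero (pow_ne_zero 2 (by exact_mod_cast ha)))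
  rwa [← funext pullback_expForm] at this

/-- For A = -1 the function ψ = φ/φ_ζ depends on u alone, and ψ_u = Mψ makes ψE a constant B in the
rescaled variable. Thus φ = C(u) exp(βζ) with β = E/B. The coefficient C is absorbed by the shift h
= L/β, where exp L = a²C/β², and 1/B splits into k₀ and a rotation. -/
theorem exists_expForm {φ : Spacetime → ℂ} {M₁ : ℝ → ℂ} (hr : Regular φ p)
    (hc : ConstantModulus φ p (-1) M₁) (ha : a ≠ 0) (hE : PhaseFactor E θ ((p.2.1 + u₀) / a))
    (hM : ∀ᶠ u in 𝓝 p.2.1, M₁ u = -(Complex.I * (θ ((u + u₀) / a) / a : ℝ))) :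
    ∃ (k₀ κ : ℝ) (h : ℝ → ℂ), k₀ ≠ 0 ∧ SmoothNear h p.2.1 ∧
      Hol (pullback a κ u₀ h (expForm fun t => k₀ * E t)) p ∧
      ∀ᶠ x in 𝓝 p, φ x = pd 0 (pd 0 (pullback a κ u₀ h (expForm fun t => k₀ * E t))) x := by
  have ha' : (a : ℂ) ≠ 0 := by exact_mod_cast ha
  have hE' := hE.rescale
  set E' : ℝ → ℂ := fun u => E ((u + u₀) / a) with hE'def
  set θ' : ℝ → ℝ := fun u => θ ((u + u₀) / a) / a
  have hpd : ∀ᶠ x in 𝓝 p, pd 0 (ratio φ) x = 0 := by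
    filter_upwards [hr.eventually, hc.modulus] with x a b
    rw [a.modulus_eq] at b
    linear_combination (-1 / 4 : ℂ) * b
  obtain ⟨B, hB⟩ : ∃ B, ∀ᶠ x in 𝓝 p, ratio φ x * E' x.2.1 = B := by
    refine ⟨_, (hr.hol_ratio.mul (Hol.comp_u hE'.smooth)).eventually_eq_const ?_⟩
    filter_upwards [hr.eventually, hpd, eventually_u hE'.deriv, eventually_u hM, hc.shear]
      with x a b d e f
    have hd := (a.hol_ratio.hasPd.mul (HasPd.comp_u d)).2
    have key := a.flow_ratio
    rw [flow, b, f, e] at key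
    refine ⟨(hd 0).trans (by simp [b]), (hd 2).trans ?_⟩
    simp
    linear_combination E' x.2.1 * key
  have hB0 : B ≠ 0 := by
    rw [← hB.self_of_nhds]
    exact mul_ne_zero (div_ne_zero hr.ne hr.ne') hE'.ne
  have hβ := hE'.const_mul (inv_ne_zero hB0)
  set β : ℝ → ℂ := fun u => B⁻¹ * E' u with hβdef
  have hpdφ : ∀ᶠ x in 𝓝 p, pd 0 φ x = φ x * β x.2.1 := by
    filter_upwards [hB, hr.eventually] with x b d
    have := d.ne
    have := d.ne'
    rw [ratio] at b
    simp only [hβdef]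
    field_simp at b ⊢
    linear_combination (-1 : ℂ) * b
  have hexp : Hol (fun x => Complex.exp (-(β x.2.1 * x.1))) p :=
    ((Hol.comp_u hβ.smooth).mul (Hol.fst p)).neg.cexp
  obtain ⟨C, hC, hC'⟩ := (hr.hol.mul hexp).exists_eq_comp_u (by
    filter_upwards [hpdφ, hr.eventually, eventually_u hβ.deriv] with x b d e
    refine ((d.hol.hasPd.mul ((HasPd.comp_u e).mul (HasPd.fst x)).neg.cexp).2 0).trans ?_
    simp [b]
    ring)
  have hC0 : C p.2.1 ≠ 0 := by
    rw [← hC'.self_of_nhds]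
    exact mul_ne_zero hr.ne (Complex.exp_ne_zero _)
  obtain ⟨L, hL, hL'⟩ := (((SmoothNear.const ((a : ℂ) ^ 2) _).mul hC).div
    (hβ.smooth.mul hβ.smooth) (mul_ne_zero hβ.ne hβ.ne)).exists_log
    (div_ne_zero (mul_ne_zero (pow_ne_zero 2 ha') hC0) (mul_ne_zero hβ.ne hβ.ne))
  have hh : SmoothNear (fun u => L u / β u) p.2.1 := hL.div hβ.smooth hβ.ne
  obtain ⟨c, hcB⟩ : ∃ c, Complex.exp c = B⁻¹ := ⟨_, Complex.exp_log (inv_ne_zero hB0)⟩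
  have hec := exp_re_mul_exp_im c
  rw [hcB] at hec
  have e : pullback a c.im u₀ (fun u => L u / β u)
      (expForm fun t => Real.exp c.re * E t) =
      fun x => Complex.exp (β x.2.1 * (x.1 + L x.2.1 / β x.2.1)) * ((a : ℂ) ^ 2)⁻¹ := by
    funext x
    rw [pullback_expForm]
    congr 3
    simp only [hβdef, hE'def]
    rw [← hec]
    ring
  obtain ⟨hK, hess⟩ := hess_cexp hβ.smooth hh ((a : ℂ) ^ 2)⁻¹
  refine ⟨Real.exp c.re, c.im, fun u => L u / β u,
    (Real.exp_pos _).ne', hh, by rwa [e], ?_⟩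
  rw [e]
  filter_upwards [hess, hC', eventually_u hL',
    eventually_u (hβ.smooth.continuousAt.eventually_ne hβ.ne)] with x b d f g
  rw [b, mul_add, mul_div_cancel₀ _ g, Complex.exp_add, f, ← d, Complex.exp_neg]
  have := Complex.exp_ne_zero (β x.2.1 * x.1)
  field_simp

end Families

/-! ### Belonging to a class in terms of the normal form -/

section

variable {f : ℂ × ℝ → ℂ} {p : Spacetime}

/-- The inverse Cayley transform ik = (A₀ - 1)/(A₀ + 1) is imaginary because conjugation inverts A₀.
It is defined since A₀ ≠ -1, and nonzero since A₀ ≠ 1. -/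
theorem exists_modulus_eq {A₀ : ℂ} (hA : A₀ * conj A₀ = 1) (hA2 : A₀ ^ 2 ≠ 1) :
    ∃ k : ℝ, k ≠ 0 ∧ A₀ = (1 + Complex.I * k) / (1 - Complex.I * k) := by
  have h0 : A₀ ≠ 0 := left_ne_zero_of_mul_eq_one hA
  have h1 : A₀ + 1 ≠ 0 := fun h => hA2 (by linear_combination (A₀ - 1) * h)
  have h2 : A₀ - 1 ≠ 0 := fun h => hA2 (by linear_combination (A₀ + 1) * h)
  have hc : conj A₀ = A₀⁻¹ := (eq_inv_of_mul_eq_one_right hA)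
  set z := (A₀ - 1) / (A₀ + 1) with hz
  have hz0 : z ≠ 0 := div_ne_zero h2 h1
  have h3 : A₀⁻¹ + 1 ≠ 0 := fun h => h1 (by
    have := congrArg (A₀ * ·) h
    simp only [mul_add, mul_inv_cancel₀ h0] at this
    linear_combination this)
  have hconj : conj z = -z := by
    rw [hz, map_div₀, map_sub, map_add, map_one, hc, ← neg_div, div_eq_div_iff h3 h1]
    field_simp
    ring
  have hre : z.re = 0 := by
    have := congrArg Complex.re hconj
    simp only [Complex.conj_re, Complex.neg_re] at this
    linarith
  have hI : Complex.I * z.im = z := by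
    apply Complex.ext <;> simp [hre]
  refine ⟨z.im, fun h => hz0 (by rw [← hI, h]; simp), ?_⟩
  rw [hI, hz]
  have h4 : 1 - (A₀ - 1) / (A₀ + 1) = 2 / (A₀ + 1) := by
    field_simp
    ring
  rw [h4]
  field_simp
  ring

/-- The hypothesis says that (1 - ik)κ is real, and m is this number divided by -k. -/
theorem exists_real_factor {κ : ℂ} {k : ℝ} (hk : k ≠ 0) (hκ : κ ≠ 0)
    (h : κ = (1 + Complex.I * k) / (1 - Complex.I * k) * conj κ) :
    ∃ m : ℝ, m ≠ 0 ∧ κ = -(k * m) / (1 - Complex.I * k) := by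
  have h1 := one_sub_I_mul_ne_zero k
  have hreal : conj ((1 - Complex.I * k) * κ) = (1 - Complex.I * k) * κ := by
    rw [map_mul, conj_one_sub_I]
    conv_rhs => rw [h]
    field_simp
  obtain ⟨r, hr⟩ := Complex.conj_eq_iff_real.1 hreal
  have hk' : (k : ℂ) ≠ 0 := by exact_mod_cast hk
  refine ⟨-r / k, div_ne_zero (neg_ne_zero.2 fun h0 => ?_) hk, ?_⟩
  · rw [h0, Complex.ofReal_zero] at hr
    exact mul_ne_zero h1 hκ hr
  · rw [eq_div_iff h1, mul_comm, hr]
    push_cast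
    field_simp

theorem eq_conj_of_div_affine {κ A₀ : ℂ} {M₁ : ℝ → ℂ} {d t : ℝ} (hd : t + d ≠ 0)
    (hM : ∀ᶠ u in 𝓝 t, M₁ u = κ / (u + d)) (hreal : ∀ᶠ u in 𝓝 t, M₁ u = A₀ * conj (M₁ u)) :
    κ = A₀ * conj κ := by
  have h := hreal.self_of_nhds
  have hd' : (t : ℂ) + d ≠ 0 := by exact_mod_cast hd
  rw [hM.self_of_nhds, map_div₀, map_add, Complex.conj_ofReal, Complex.conj_ofReal] at h
  field_simp at h
  exact h

theorem eq_I_mul_im {κ : ℂ} (h : κ = -1 * conj κ) : κ = Complex.I * κ.im := by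
  have := congrArg Complex.re h
  simp at this
  apply Complex.ext
  · simp
    linarith
  · simp

/-- A negative scaling is allowed; a = t moves the new coordinate u to 1, as the positivity demanded
in BP and BE requires. -/
theorem exists_div_pos {t : ℝ} (h : t ≠ 0) : ∃ a : ℝ, a ≠ 0 ∧ 0 < t / a := by
  refine ⟨t, h, ?_⟩
  rw [div_self h]
  exact one_pos

variable {a k u₀ : ℝ} {h : ℝ → ℂ} {r : ℝ → ℝ} {F : ℂ × ℝ → ℂ} {g : ℝ → ℂ}
  {E : ℝ → ℂ} {θ : ℝ → ℝ}

theorem constantModulus_of_powForm {k₁ : ℝ} {ℓ : ℂ → ℂ} (hf : Hol (lift f) p) (ha : a ≠ 0)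
    (hh : SmoothNear h p.2.1) (hr : SmoothNear r p.2.1) (hg : SmoothNear g ((p.2.1 + u₀) / a))
    (hP : PullsBack (transf a k u₀ h r) F f p) (hk : k₁ ≠ 0)
    (hE : PhaseFactor E θ ((p.2.1 + u₀) / a))
    (hℓ : IsLogBranch ℓ (E ((p.2.1 + u₀) / a) * (tau a k u₀ h p).1))
    (hF : ∀ᶠ y in 𝓝 (tau a k u₀ h p), F y = powForm E k₁ ℓ y + g y.2 * y.1) :
    Regular (hess f) p ∧ ConstantModulus (hess f) p
      ((1 + Complex.I * k₁) / (1 - Complex.I * k₁))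
      (fun u => -(k₁ * (θ ((u + u₀) / a) / a : ℝ)) / (1 - Complex.I * k₁)) := by
  have e := hess_eq_of_pullsBack ha hh hr hf hg hF (powerLike_pullback ha hk hh hE hℓ).hol hP
  have e' := e.mono fun x hx => hx.symm
  exact ⟨(powerLike_hess_pullback ha hk hh hE hℓ).regular.congr e',
    (constantModulus_powForm ha hk hh hE hℓ).congr e'⟩

theorem modulus_sq_ne_one {k₁ : ℝ} (hk : k₁ ≠ 0) :
    ((1 + Complex.I * k₁) / (1 - Complex.I * k₁)) ^ 2 ≠ 1 := by
  have h1 := one_sub_I_mul_ne_zero k₁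
  have hk' : (k₁ : ℂ) ≠ 0 := by exact_mod_cast hk
  intro h
  rw [div_pow, div_eq_one_iff_eq (pow_ne_zero 2 h1)] at h
  have : 4 * Complex.I * (k₁ : ℂ) = 0 := by linear_combination h
  simp [hk] at this

theorem constantModulus_of_expForm (hf : Hol (lift f) p) (ha : a ≠ 0)
    (hh : SmoothNear h p.2.1) (hr : SmoothNear r p.2.1) (hg : SmoothNear g ((p.2.1 + u₀) / a))
    (hP : PullsBack (transf a k u₀ h r) F f p) (hE : PhaseFactor E θ ((p.2.1 + u₀) / a))
    (hF : ∀ᶠ y in 𝓝 (tau a k u₀ h p), F y = expForm E y + g y.2 * y.1) :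
    Regular (hess f) p ∧ ConstantModulus (hess f) p (-1)
      (fun u => -(Complex.I * (θ ((u + u₀) / a) / a : ℝ))) := by
  have e := hess_eq_of_pullsBack ha hh hr hf hg hF (hol_expForm hh hE) hP
  have e' := e.mono fun x hx => hx.symm
  obtain ⟨h1, h2⟩ := constantModulus_expForm (κ := k) ha hh hE
  exact ⟨h1.congr e', h2.congr e'⟩

/-- The constant w drops out of the logarithmic derivative of the coefficient, so M = ρ'/(2ρ) is
real, in accordance with A = 1. -/
theorem constantModulus_of_logForm {c : ℝ → ℂ} {ℓ : ℂ → ℂ} {w : ℂ} {ρ : ℝ → ℝ}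
    (hf : Hol (lift f) p) (ha : a ≠ 0) (hh : SmoothNear h p.2.1) (hr : SmoothNear r p.2.1)
    (hg : SmoothNear g ((p.2.1 + u₀) / a)) (hP : PullsBack (transf a k u₀ h r) F f p)
    (hρ : SmoothNear ρ p.2.1) (hρ0 : ρ p.2.1 ≠ 0) (hw : w ≠ 0)
    (hc : ∀ u, c ((u + u₀) / a) / a ^ 2 = w * ρ u) (hℓ : IsLogBranch ℓ (tau a k u₀ h p).1)
    (hF : ∀ᶠ y in 𝓝 (tau a k u₀ h p), F y = logForm c ℓ y + g y.2 * y.1) :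
    Regular (hess f) p ∧ ConstantModulus (hess f) p 1 (fun u => (deriv ρ u / ρ u / 2 : ℝ)) := by
  have eK : pullback a k u₀ h (logForm c ℓ) =
      fun x => w * ρ x.2.1 * ℓ (Complex.exp (Complex.I * k) * (x.1 + h x.2.1)) := by
    funext x
    rw [pullback, logForm, ← hc]
    simp only [tau]
    ring
  have hs : SmoothNear (fun u => w * (ρ u : ℂ)) p.2.1 := (SmoothNear.const _ _).mul hρ.ofReal
  have hs0 : w * (ρ p.2.1 : ℂ) ≠ 0 := mul_ne_zero hw (by exact_mod_cast hρ0)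
  have hd : ∀ᶠ u in 𝓝 p.2.1, deriv (fun u => w * (ρ u : ℂ)) u / (w * ρ u)
      = (deriv ρ u / ρ u : ℝ) := by
    filter_upwards [hρ.eventually] with u hu
    rw [((hasDerivAt_ofReal_comp hu.differentiableAt.hasDerivAt).const_mul w).deriv,
      mul_div_mul_left _ _ hw]
    push_cast
    rfl
  have hK := (hasPd_logForm hh hs hℓ).1
  rw [← eK] at hK
  have e := hess_eq_of_pullsBack ha hh hr hf hg hF hK hP
  rw [eK] at e
  have e' := e.mono fun x hx => hx.symm
  have hcm := constantModulus_logForm hh hs hs0 hℓ (by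
    filter_upwards [hd] with u hu
    rw [hu, Complex.conj_ofReal])
  have hM : ∀ᶠ u in 𝓝 p.2.1, deriv (fun u => w * (ρ u : ℂ)) u / (w * ρ u) / 2
      = (deriv ρ u / ρ u / 2 : ℝ) := by
    filter_upwards [hd] with u hu
    rw [hu]
    push_cast
    rfl
  refine ⟨(powerLike_logForm hh hs hs0 hℓ).regular.congr e', ?_⟩
  have h2 := hcm.congr e'
  refine ⟨h2.unit, h2.smooth.congr hM, h2.modulus, ?_,
    Eventually.of_forall fun u => by rw [one_mul, Complex.conj_ofReal]⟩
  filter_upwards [h2.shear, eventually_u hM] with x x1 x2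
  rw [x1, x2]

/-- The logarithmic derivative of a power of u is homogeneous of degree -1, so the scaling a
cancels. -/
theorem rate_cpow {k₁ : ℝ} (ha : a ≠ 0) (hu : 0 < (p.2.1 + u₀) / a) : p.2.1 + u₀ ≠ 0 ∧
    ∀ᶠ u in 𝓝 p.2.1, -k₁ / ((u + u₀) / a) / a = -k₁ / (u + u₀) := by
  have h0 : p.2.1 + u₀ ≠ 0 := fun h => by simp [h] at hu
  refine ⟨h0, ?_⟩
  filter_upwards [continuousAt_add_ne h0] with u hu
  field_simp

theorem normalForm_of_belongsTo {c : SolClass} (hf : Hol (lift f) p) (hc : BelongsTo c f p) :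
    Regular (hess f) p ∧ NormalForm c (hess f) p := by
  obtain ⟨a, k, u₀, h, r, F, ha, hh, hr, ⟨g, hg, hF⟩, hP⟩ := hc
  have ha' : (a : ℂ) ≠ 0 := by exact_mod_cast ha
  change SmoothNear g ((p.2.1 + u₀) / a) at hg
  cases c with
  | BP =>
    obtain ⟨hu, k₀, k₁, k₂, h0, h1, h2, ℓ, hℓ, hF⟩ := hF
    change 0 < (p.2.1 + u₀) / a at hu
    obtain ⟨hreg, hcm⟩ := constantModulus_of_powForm hf ha hh hr hg hP h2
      ((PhaseFactor.cpow k₁ hu).const_mul (c := k₀) (by exact_mod_cast h0)) hℓ hF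
    obtain ⟨hd, hrate⟩ := rate_cpow (k₁ := k₁) ha hu
    refine ⟨hreg, _, _, hcm, modulus_sq_ne_one h2, k₂ * k₁ / (1 - Complex.I * k₂), u₀,
      div_ne_zero (by simp [h1, h2]) (one_sub_I_mul_ne_zero k₂), hd, ?_⟩
    filter_upwards [hrate] with u hu
    rw [hu]
    push_cast
    ring
  | CP =>
    obtain ⟨k₀, k₁, h0, h1, ℓ, hℓ, hF⟩ := hF
    obtain ⟨hreg, hcm⟩ := constantModulus_of_powForm hf ha hh hr hg hP h1
      ((PhaseFactor.exp_I _).const_mul (c := k₀) (by exact_mod_cast h0)) hℓ hF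
    refine ⟨hreg, _, _, hcm, modulus_sq_ne_one h1, -(k₁ * (1 / a : ℝ)) / (1 - Complex.I * k₁),
      div_ne_zero (by simp [h1, ha]) (one_sub_I_mul_ne_zero k₁),
      Eventually.of_forall fun u => rfl⟩
  | BE =>
    obtain ⟨hu, k₀, k₁, h0, h1, hF⟩ := hF
    change 0 < (p.2.1 + u₀) / a at hu
    obtain ⟨hreg, hcm⟩ := constantModulus_of_expForm hf ha hh hr hg hP
      ((PhaseFactor.cpow k₁ hu).const_mul (c := k₀) (by exact_mod_cast h0)) hF
    obtain ⟨hd, hrate⟩ := rate_cpow (k₁ := k₁) ha hu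
    refine ⟨hreg, _, _, hcm, rfl, Complex.I * k₁, u₀, by simp [h1], hd, ?_⟩
    filter_upwards [hrate] with u hu
    rw [hu]
    push_cast
    ring
  | CE =>
    obtain ⟨k₀, h0, hF⟩ := hF
    obtain ⟨hreg, hcm⟩ := constantModulus_of_expForm hf ha hh hr hg hP
      ((PhaseFactor.exp_I _).const_mul (c := k₀) (by exact_mod_cast h0)) hF
    exact ⟨hreg, _, _, hcm, rfl, -(Complex.I * (1 / a : ℝ)), by simp [ha],
      Eventually.of_forall fun u => rfl⟩
  | L =>
    obtain ⟨k', η, hη, hη0, ℓ, hℓ, hF⟩ := hF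
    obtain ⟨hreg, hcm⟩ := constantModulus_of_logForm (c := fun t => Complex.exp (Complex.I * k') * η t)
      (w := Complex.exp (Complex.I * k') / a ^ 2) hf ha hh hr hg hP (smoothNear_rescale hη) hη0
      (div_ne_zero (Complex.exp_ne_zero _) (pow_ne_zero 2 ha')) (fun u => by ring) hℓ hF
    exact ⟨hreg, _, _, hcm, rfl⟩
  | BL =>
    obtain ⟨hu, C, hC, ℓ, hℓ, hF⟩ := hF
    change (p.2.1 + u₀) / a ≠ 0 at hu
    have hu0 : p.2.1 + u₀ ≠ 0 := fun h => hu (by rw [h, zero_div])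
    have hder : ∀ u : ℝ, u + u₀ ≠ 0 → HasDerivAt (fun u : ℝ => ((u + u₀) ^ 2)⁻¹)
        (-(2 * (u + u₀)) / ((u + u₀) ^ 2) ^ 2) u := fun u hu => by
      have := (((hasDerivAt_id u).add_const u₀).pow 2).inv (pow_ne_zero 2 hu)
      refine this.congr_deriv ?_
      simp
    have hρ : SmoothNear (fun u : ℝ => ((u + u₀) ^ 2)⁻¹) p.2.1 := by
      filter_upwards [continuousAt_add_ne hu0] with u hu
      exact ContDiffAt.inv (by fun_prop) (pow_ne_zero 2 hu)
    obtain ⟨hreg, hcm⟩ := constantModulus_of_logForm (c := fun t => C * ((t : ℂ) ^ 2)⁻¹)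
      hf ha hh hr hg hP hρ (inv_ne_zero (pow_ne_zero 2 hu0)) hC (fun u => by
        push_cast
        field_simp) hℓ hF
    refine ⟨hreg, _, _, hcm, rfl, u₀, hu0, ?_⟩
    filter_upwards [continuousAt_add_ne hu0] with u hu
    have hu' : (u : ℂ) + u₀ ≠ 0 := by exact_mod_cast hu
    rw [(hder u hu).deriv]
    push_cast
    field_simp
  | AP =>
    obtain ⟨k₀, k₁, h0, h1, ℓ, hℓ, hF⟩ := hF
    obtain ⟨hreg, hcm⟩ := constantModulus_of_powForm hf ha hh hr hg hP h1
      (PhaseFactor.const (c := k₀) (by exact_mod_cast h0) _) hℓ hF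
    exact ⟨hreg, _, _, hcm, modulus_sq_ne_one h1, Eventually.of_forall fun u => by simp⟩
  | AE =>
    obtain ⟨k₀, h0, hF⟩ := hF
    obtain ⟨hreg, hcm⟩ := constantModulus_of_expForm hf ha hh hr hg hP
      (PhaseFactor.const (c := k₀) (by exact_mod_cast h0) _) hF
    exact ⟨hreg, _, _, hcm, rfl, Eventually.of_forall fun u => by simp⟩
  | AL =>
    obtain ⟨k', ℓ, hℓ, hF⟩ := hF
    obtain ⟨hreg, hcm⟩ := constantModulus_of_logForm (c := fun _ => Complex.exp (Complex.I * k'))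
      (w := Complex.exp (Complex.I * k') / a ^ 2) (ρ := fun _ => 1) hf ha hh hr hg hP
      (SmoothNear.const _ _) one_ne_zero
      (div_ne_zero (Complex.exp_ne_zero _) (pow_ne_zero 2 ha')) (fun u => by simp) hℓ hF
    exact ⟨hreg, _, _, hcm, rfl, Eventually.of_forall fun u => by simp⟩

theorem belongsTo_of_hess {c : SolClass} {F₀ : ℂ × ℝ → ℂ} (ha : a ≠ 0) (hh : SmoothNear h p.2.1)
    (hf : Hol (lift f) p) (hK : Hol (pullback a k u₀ h F₀) p)
    (h0 : ∀ᶠ x in 𝓝 p, hess f x = pd 0 (pd 0 (pullback a k u₀ h F₀)) x)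
    (hform : ∀ g : ℝ → ℂ, SmoothNear g ((p.2.1 + u₀) / a) →
      IsClassForm c (fun y => F₀ y + g y.2 * y.1) (tau a k u₀ h p)) : BelongsTo c f p := by
  obtain ⟨r, g, hr, hg, hP⟩ := exists_pullsBack ha hh hf hK h0
  exact ⟨a, k, u₀, h, r, _, ha, hh, hr, hform g hg, hP⟩

theorem pullback_logForm_one {c : ℝ → ℂ} {ℓ : ℂ → ℂ} : pullback 1 0 u₀ h (logForm c ℓ) =
    fun x => c (x.2.1 + u₀) * ℓ (x.1 + h x.2.1) := by
  funext x
  simp [pullback, logForm, tau]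

theorem tau_one_fst : (tau a 0 u₀ h p).1 = p.1 + h p.2.1 := by
  simp [tau]

/-- The translation u₀ = d moves the pole of M to the origin. The scaling a makes the new u positive
(BP, BE), turns the rate into 1 (CP, CE), or gives the logarithm a coefficient of modulus one (AL).
-/
theorem belongsTo_of_normalForm {c : SolClass} (hf : Hol (lift f) p) (hr : Regular (hess f) p)
    (hc : NormalForm c (hess f) p) : BelongsTo c f p := by
  obtain ⟨A₀, M₁, hcm, hc⟩ := hc
  cases c with
  | BP =>
    obtain ⟨hA, κ, d, hκ, hd, hM⟩ := hc
    obtain ⟨k₂, hk₂, rfl⟩ := exists_modulus_eq hcm.unit hA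
    obtain ⟨m, hm, rfl⟩ := exists_real_factor hk₂ hκ (eq_conj_of_div_affine hd hM hcm.real)
    obtain ⟨a, ha, hu⟩ := exists_div_pos hd
    obtain ⟨k₀, κ', h, ℓ, hk₀, hh, hℓ, hK, he⟩ := exists_powForm hr hcm hk₂ ha
      (PhaseFactor.cpow (-m) hu) (by
        filter_upwards [hM, (rate_cpow (k₁ := -m) ha hu).2] with u x1 x2
        rw [x1, x2]
        push_cast
        ring)
    exact belongsTo_of_hess ha hh hf hK he fun g hg => ⟨g, hg, hu, k₀, -m, k₂, hk₀,
      neg_ne_zero.2 hm, hk₂, ℓ, hℓ, Eventually.of_forall fun y => rfl⟩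
  | CP =>
    obtain ⟨hA, κ, hκ, hM⟩ := hc
    obtain ⟨k₁, hk₁, rfl⟩ := exists_modulus_eq hcm.unit hA
    have hreal := hcm.real.self_of_nhds
    rw [hM.self_of_nhds] at hreal
    obtain ⟨m, hm, rfl⟩ := exists_real_factor hk₁ hκ hreal
    obtain ⟨k₀, κ', h, ℓ, hk₀, hh, hℓ, hK, he⟩ := exists_powForm (u₀ := 0) hr hcm hk₁
      (inv_ne_zero hm) (PhaseFactor.exp_I _) (by
        filter_upwards [hM] with u x1
        rw [x1, one_div, inv_inv])
    exact belongsTo_of_hess (inv_ne_zero hm) hh hf hK he fun g hg => ⟨g, hg, k₀, k₁, hk₀, hk₁, ℓ,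
      hℓ, Eventually.of_forall fun y => rfl⟩
  | BE =>
    obtain ⟨rfl, κ, d, hκ, hd, hM⟩ := hc
    have hi := eq_I_mul_im (eq_conj_of_div_affine hd hM hcm.real)
    have him : κ.im ≠ 0 := fun h => hκ (by rw [hi, h]; simp)
    obtain ⟨a, ha, hu⟩ := exists_div_pos hd
    obtain ⟨k₀, κ', h, hk₀, hh, hK, he⟩ := exists_expForm hr hcm ha
      (PhaseFactor.cpow κ.im hu) (by
        filter_upwards [hM, (rate_cpow (k₁ := κ.im) ha hu).2] with u x1 x2
        rw [x1, x2]
        conv_lhs => rw [hi]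
        push_cast
        ring)
    exact belongsTo_of_hess ha hh hf hK he fun g hg => ⟨g, hg, hu, k₀, κ.im, hk₀, him,
      Eventually.of_forall fun y => rfl⟩
  | CE =>
    obtain ⟨rfl, κ, hκ, hM⟩ := hc
    have hreal := hcm.real.self_of_nhds
    rw [hM.self_of_nhds] at hreal
    have hi := eq_I_mul_im hreal
    have him : κ.im ≠ 0 := fun h => hκ (by rw [hi, h]; simp)
    have ha : -(κ.im)⁻¹ ≠ 0 := neg_ne_zero.2 (inv_ne_zero him)
    obtain ⟨k₀, κ', h, hk₀, hh, hK, he⟩ := exists_expForm (u₀ := 0) hr hcm ha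
      (PhaseFactor.exp_I _) (by
        filter_upwards [hM] with u x1
        rw [x1]
        conv_lhs => rw [hi]
        simp)
    exact belongsTo_of_hess ha hh hf hK he fun g hg => ⟨g, hg, k₀, hk₀,
      Eventually.of_forall fun y => rfl⟩
  | L =>
    obtain rfl := hc
    -- As A = 1, M is real, and exp ρ with ρ' = 2M has half logarithmic derivative M. The modulus of
    -- B joins exp ρ in the real coefficient h, and its phase is exp(ik).
    obtain ⟨ρ, hρ, hρ'⟩ := exists_antideriv ((SmoothNear.const 2 _).mul hcm.smooth).re
    obtain ⟨B, h, ℓ, hB, hh, hℓ, hK, he⟩ := exists_logForm hr hcm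
      (c := fun u => Complex.exp (ρ u)) hρ.ofReal.cexp (Complex.exp_ne_zero _) (by
        filter_upwards [hρ.eventually, hρ', hcm.real] with u x1 x2 x3
        rw [one_mul, eq_comm, Complex.conj_eq_iff_re] at x3
        rw [(hasDerivAt_ofReal_comp x1.differentiableAt.hasDerivAt).cexp.deriv, x2,
          mul_div_cancel_left₀ _ (Complex.exp_ne_zero _), ← x3]
        simp)
    have hη : SmoothNear (fun u => ‖B‖ * Real.exp (ρ u)) p.2.1 := by
      filter_upwards [hρ] with u hu
      exact contDiffAt_const.mul hu.exp
    have e : pullback 1 0 0 h (logForm (fun u => Complex.exp (Complex.I * B.arg) *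
        ((‖B‖ * Real.exp (ρ u) : ℝ) : ℂ)) ℓ) =
        fun x => B * (Complex.exp (ρ x.2.1) * ℓ (x.1 + h x.2.1)) := by
      rw [pullback_logForm_one]
      funext x
      rw [add_zero]
      conv_rhs => rw [← Complex.norm_mul_exp_arg_mul_I B]
      push_cast
      ring_nf
    have ht : (p.2.1 + 0) / 1 = p.2.1 := by simp
    rw [← e] at hK he
    exact belongsTo_of_hess one_ne_zero hh hf hK he fun g hg =>
      ⟨g, hg, B.arg, fun u => ‖B‖ * Real.exp (ρ u), by
        change SmoothNear _ ((p.2.1 + 0) / 1)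
        rwa [ht],
        mul_ne_zero (norm_ne_zero_iff.2 hB) (Real.exp_pos _).ne', ℓ, by rwa [tau_one_fst],
        Eventually.of_forall fun y => rfl⟩
  | BL =>
    obtain ⟨rfl, d, hd, hM⟩ := hc
    have hd' : (p.2.1 : ℂ) + d ≠ 0 := by exact_mod_cast hd
    have hs : SmoothNear (fun u : ℝ => (u : ℂ) + d) p.2.1 :=
      (smoothNear_of_contDiff contDiff_id _).ofReal.add (SmoothNear.const _ _)
    obtain ⟨B, h, ℓ, hB, hh, hℓ, hK, he⟩ := exists_logForm hr hcm
      -- The coefficient (u + d)⁻² is the one whose half logarithmic derivative is M = -1/(u + d).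
      (c := fun u => (((u : ℂ) + d) * ((u : ℂ) + d))⁻¹) ((hs.mul hs).inv (mul_ne_zero hd' hd'))
      (inv_ne_zero (mul_ne_zero hd' hd')) (by
        filter_upwards [hM, continuousAt_add_ne hd] with u x1 x2
        have x2' : (u : ℂ) + d ≠ 0 := by exact_mod_cast x2
        have h1 : HasDerivAt (fun u : ℝ => (u : ℂ) + d) 1 u :=
          (Complex.ofRealCLM.hasDerivAt (x := u)).add_const (d : ℂ)
        have h2 : HasDerivAt (fun u : ℝ => (((u : ℂ) + d) * ((u : ℂ) + d))⁻¹)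
            (-(1 * ((u : ℂ) + d) + ((u : ℂ) + d) * 1) / (((u : ℂ) + d) * ((u : ℂ) + d)) ^ 2) u :=
          (h1.mul h1).inv (mul_ne_zero x2' x2')
        rw [x1, h2.deriv]
        field_simp
        norm_num)
    have e : pullback 1 0 d h (logForm (fun t => B * ((t : ℂ) ^ 2)⁻¹) ℓ) = fun x =>
        B * ((((x.2.1 : ℂ) + d) * ((x.2.1 : ℂ) + d))⁻¹ * ℓ (x.1 + h x.2.1)) := by
      rw [pullback_logForm_one]
      funext x
      push_cast
      ring
    rw [← e] at hK he
    exact belongsTo_of_hess one_ne_zero hh hf hK he fun g hg =>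
      ⟨g, hg, by simpa [tau] using hd, B, hB, ℓ, by rwa [tau_one_fst],
        Eventually.of_forall fun y => rfl⟩
  | AP =>
    obtain ⟨hA, hM⟩ := hc
    obtain ⟨k₁, hk₁, rfl⟩ := exists_modulus_eq hcm.unit hA
    obtain ⟨k₀, κ', h, ℓ, hk₀, hh, hℓ, hK, he⟩ := exists_powForm (u₀ := 0) hr hcm hk₁
      one_ne_zero (PhaseFactor.const one_ne_zero _) (by
        filter_upwards [hM] with u x1
        simp [x1])
    simp only [mul_one] at hℓ hK he
    exact belongsTo_of_hess one_ne_zero hh hf hK he fun g hg => ⟨g, hg, k₀, k₁, hk₀, hk₁, ℓ, hℓ,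
      Eventually.of_forall fun y => rfl⟩
  | AE =>
    obtain ⟨rfl, hM⟩ := hc
    obtain ⟨k₀, κ', h, hk₀, hh, hK, he⟩ := exists_expForm (u₀ := 0) hr hcm
      one_ne_zero (PhaseFactor.const one_ne_zero _) (by
        filter_upwards [hM] with u x1
        simp [x1])
    simp only [mul_one] at hK he
    exact belongsTo_of_hess one_ne_zero hh hf hK he fun g hg => ⟨g, hg, k₀, hk₀,
      Eventually.of_forall fun y => rfl⟩
  | AL =>
    obtain ⟨rfl, hM⟩ := hc
    obtain ⟨B, h, ℓ, hB, hh, hℓ, hK, he⟩ := exists_logForm hr hcm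
      (c := fun _ => 1) (SmoothNear.const _ _) one_ne_zero (by
        filter_upwards [hM] with u x1
        simp [x1])
    simp only [one_mul] at hK he
    have hn : 0 < ‖B‖ := norm_pos_iff.2 hB
    -- The pullback divides the potential by a², so a = |B|^(-1/2) restores the modulus of B from a
    -- unimodular coefficient.
    have hs : (Real.sqrt ‖B‖)⁻¹ ≠ 0 := inv_ne_zero (Real.sqrt_pos.2 hn).ne'
    have e : pullback (Real.sqrt ‖B‖)⁻¹ 0 0 h (logForm (fun _ => Complex.exp (Complex.I * B.arg)) ℓ)
        = fun x => B * ℓ (x.1 + h x.2.1) := by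
      funext x
      have h1 : ((((Real.sqrt ‖B‖)⁻¹ : ℝ) : ℂ) ^ 2)⁻¹ = ‖B‖ := by
        rw [← Complex.ofReal_pow, inv_pow, Real.sq_sqrt hn.le, Complex.ofReal_inv, inv_inv]
      rw [pullback, logForm, tau_one_fst, div_eq_mul_inv, h1]
      conv_rhs => rw [← Complex.norm_mul_exp_arg_mul_I B]
      ring_nf
    rw [← e] at hK he
    exact belongsTo_of_hess hs hh hf hK he fun g hg =>
      ⟨g, hg, B.arg, ℓ, by rwa [tau_one_fst], Eventually.of_forall fun y => rfl⟩

theorem Adapted.invariantCondition_iff_belongsTo {T : Tetrad} (hf : Hol (lift f) p)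
    (hT : Adapted f T p) (c : SolClass) : InvariantCondition c f T p ↔ BelongsTo c f p := by
  rw [hT.invariantCondition_iff]
  exact ⟨fun h => belongsTo_of_normalForm hf hT.regular (normalForm_of_reducedCondition hT.regular h),
    fun h => reducedCondition_of_normalForm (normalForm_of_belongsTo hf h).2⟩

end

end PPWave

/-! ### The proposition -/

theorem proposition5p9 (f : ℂ × ℝ → ℂ) (p : PPWave.Spacetime)
    (hsmooth : PPWave.SmoothNear f (p.1, p.2.1))
    (hhol : ∀ᶠ q in nhds (p.1, p.2.1), DifferentiableAt ℂ (fun z : ℂ => f (z, q.2)) q.1) :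
    (PPWave.IsType01Precursor f p ↔ ∃ c : PPWave.SolClass, PPWave.BelongsTo c f p) ∧
    ∀ c : PPWave.SolClass,
      (PPWave.BelongsTo c f p → ∃ T : PPWave.Tetrad, PPWave.IsInvariantTetrad f T p) ∧
      ∀ T : PPWave.Tetrad, PPWave.IsInvariantTetrad f T p →
        (PPWave.InvariantCondition c f T p ↔ PPWave.BelongsTo c f p) := by
  have hf := PPWave.hol_lift hsmooth hhol
  refine ⟨⟨?_, ?_⟩, fun c => ⟨fun hc => ?_, fun T hT => ?_⟩⟩
  · rintro ⟨T, hT, h01, hpre⟩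
    obtain ⟨T', hT', -, h01', hpre'⟩ := PPWave.exists_adapted_of_invariant hf hT
    have hr := hT'.regular
    obtain ⟨c, hc⟩ := PPWave.exists_normalForm hr (hT'.isType01_iff.1 (h01' h01))
      (hT'.reducedPrecursor (hpre' hpre))
    exact ⟨c, PPWave.belongsTo_of_normalForm hf hr hc⟩
  · rintro ⟨c, hc⟩
    obtain ⟨hr, hN⟩ := PPWave.normalForm_of_belongsTo hf hc
    obtain ⟨T, hT, hinv⟩ := PPWave.exists_adapted hf hr
    refine ⟨T, hinv, hT.isType01_iff.2 ?_, hT.isPrecursor (PPWave.reducedPrecursor_of_normalForm hN)⟩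
    obtain ⟨_, _, hcm, -⟩ := hN
    exact hcm.type01
  · obtain ⟨T, -, hinv⟩ := PPWave.exists_adapted hf (PPWave.normalForm_of_belongsTo hf hc).1
    exact ⟨T, hinv⟩
  · obtain ⟨T', hT', hcond, -⟩ := PPWave.exists_adapted_of_invariant hf hT
    rw [hcond]
    exact hT'.invariantCondition_iff_belongsTo hf c
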